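/- Let $(M,g)$ be a simply connected (in particular connected) two-dimensional spacetime, i.e. a smooth, Hausdorff, second countable $2$-manifold $M$ without boundary with a smooth Lorentzian metric $g$ of signature $(-,+)$ and a time orientation. Let $$\mathcal L^*M=\{\alpha\in T^*M \mid \alpha\neq 0,\ g^*(\alpha,\alpha)=0,\ \alpha=g(v,\cdot)\text{ for a future pointing } v\}$$ be the bundle of future pointing dual null cones, where $g^*$ is the dual metric. Let $X_g$ be the symplectic gradient of $E_g(\alpha)=g^*(\alpha,\alpha)$ with respect to the canonical symplectic form of $T^*M$, and let $\xi$ be the Euler vector field (the generator of the homotheties $\alpha\mapsto c\,\alpha$, $c>0$). The vector fields $X_g$ and $\xi$ span an integrable distribution on $\mathcal L^*M$. The space of null geodesics $\mathcal N_g$ is the leaf space of the corresponding foliation of $\mathcal L^*M$, with the quotient topology. One says that $\mathcal N_g$ is a smooth manifold if the smooth structure of $\mathcal L^*M$ descends to it, i.e. if $\mathcal N_g$ is Hausdorff and second countable and admits a smooth atlas, of dimension $\dim\mathcal L^*M-2=1$, for which the projection $\mathcal L^*M\to\mathcal N_g$ is a smooth submersion. Let $J^+_g\subseteq M\times M$ be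 the causal relation: $(p,q)\in J^+_g$ if and only if $p=q$ or there is a piecewise smooth future pointing causal curve from $p$ to $q$. The spacetime $(M,g)$ is causally simple if it is causal (there is no closed piecewise smooth future pointing causal curve) and $J^+_g$ is closed in $M\times M$. Then $\mathcal N_g$ is a smooth manifold if and only if $(M,g)$ is causally simple. -/

import Mathlib

open Set Bundle
open scoped Manifold ContDiff Topology

noncomputable section

namespace Spacetime

variable {n : ℕ} {M : Type*} [TopologicalSpace M]
  [ChartedSpace (EuclideanSpace ℝ (Fin n)) M] [IsManifold (𝓡 n) ∞ M]

/-- A smooth Lorentzian metric, of signature `(-, +, …, +)`, on an `n`-dimensional manifold `M`. -/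
structure LorentzianMetric (n : ℕ) (M : Type*) [TopologicalSpace M]
    [ChartedSpace (EuclideanSpace ℝ (Fin n)) M] [IsManifold (𝓡 n) ∞ M] where
  /-- The scalar product on each tangent space. -/
  val (x : M) : TangentSpace (𝓡 n) x →L[ℝ] TangentSpace (𝓡 n) x →L[ℝ] ℝ
  symm (x : M) (v w : TangentSpace (𝓡 n) x) : val x v w = val x w v
  /-- There is a negative vector, and the metric is positive definite on its orthogonal space. -/
  lorentzian (x : M) : ∃ v : TangentSpace (𝓡 n) x, val x v v < 0 ∧
    ∀ w : TangentSpace (𝓡 n) x, val x v w = 0 → w ≠ 0 → 0 < val x w w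
  contMDiff : ContMDiff (𝓡 n)
    ((𝓡 n).prod 𝓘(ℝ, EuclideanSpace ℝ (Fin n) →L[ℝ] EuclideanSpace ℝ (Fin n) →L[ℝ] ℝ)) ∞
    (fun x ↦ TotalSpace.mk' (EuclideanSpace ℝ (Fin n) →L[ℝ] EuclideanSpace ℝ (Fin n) →L[ℝ] ℝ)
      x (val x))

/-- A time orientation of a Lorentzian manifold, given by a smooth timelike vector field
(which is declared to be future pointing). -/
structure TimeOrientation (g : LorentzianMetric n M) where
  /-- The timelike vector field. -/
  field (x : M) : TangentSpace (𝓡 n) x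
  timelike (x : M) : g.val x (field x) (field x) < 0
  contMDiff : ContMDiff (𝓡 n) (𝓡 n).tangent ∞
    (fun x ↦ (⟨x, field x⟩ : TangentBundle (𝓡 n) M))

variable {g : LorentzianMetric n M}

/-- A tangent vector is future pointing (causal) if it is nonzero, timelike or null, and lies in
the same half of the causal cone as the time orientation. -/
def TimeOrientation.IsFuture (T : TimeOrientation g) {x : M} (v : TangentSpace (𝓡 n) x) : Prop :=
  v ≠ 0 ∧ g.val x v v ≤ 0 ∧ g.val x v (T.field x) < 0

/-! ### The causal relation -/

/-- `q` is the endpoint of a smooth future pointing causal curve starting at `p`. -/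
def TimeOrientation.CausalStep (T : TimeOrientation g) (p q : M) : Prop :=
  ∃ γ : ℝ → M, γ 0 = p ∧ γ 1 = q ∧ ContMDiffOn 𝓘(ℝ, ℝ) (𝓡 n) ∞ γ (Icc 0 1) ∧
    ∀ t ∈ Icc (0 : ℝ) 1,
      T.IsFuture (mfderivWithin 𝓘(ℝ, ℝ) (𝓡 n) γ (Icc 0 1) t (1 : ℝ) : TangentSpace (𝓡 n) (γ t))

/-- The causal relation `J⁺ ⊆ M × M`: `(p, q) ∈ J⁺` if `p = q` or if there is a piecewise smooth
future pointing causal curve from `p` to `q`. -/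
def TimeOrientation.causalRel (T : TimeOrientation g) : Set (M × M) :=
  {z | Relation.ReflTransGen T.CausalStep z.1 z.2}

/-- There is no closed piecewise smooth future pointing causal curve. -/
def TimeOrientation.IsCausal (T : TimeOrientation g) : Prop :=
  ∀ p : M, ¬ Relation.TransGen T.CausalStep p p

/-- A spacetime is causally simple if it is causal and `J⁺` is closed in `M × M`. -/
def TimeOrientation.IsCausallySimple (T : TimeOrientation g) : Prop :=
  T.IsCausal ∧ IsClosed T.causalRel

/-! ### The cogeodesic flow on the cotangent bundle -/

/-- The cotangent bundle `T*M`. -/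
abbrev Cotangent (n : ℕ) (M : Type*) [TopologicalSpace M]
    [ChartedSpace (EuclideanSpace ℝ (Fin n)) M] [IsManifold (𝓡 n) ∞ M] : Type _ :=
  TotalSpace (EuclideanSpace ℝ (Fin n) →L[ℝ] ℝ)
    (fun x : M ↦ TangentSpace (𝓡 n) x →L[ℝ] ℝ)

/-- The model with corners of the `2 n`-dimensional manifold `T*M`. -/
abbrev cotangentModel (n : ℕ) :=
  (𝓡 n).prod 𝓘(ℝ, EuclideanSpace ℝ (Fin n) →L[ℝ] ℝ)

/-- The tangent vector `v` dual to the covector `α`, i.e. `α = g(v, ·)`. -/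
def LorentzianMetric.sharp (g : LorentzianMetric n M) (α : Cotangent n M) :
    TangentSpace (𝓡 n) α.proj :=
  (g.val α.proj).inverse α.snd

/-- The Hamiltonian `E_g(α) = g*(α, α)`, where `g*` is the dual metric. -/
def LorentzianMetric.energy (g : LorentzianMetric n M) (α : Cotangent n M) : ℝ :=
  g.val α.proj (g.sharp α) (g.sharp α)

/-- The canonical symplectic form `∑ dqⁱ ∧ dpᵢ` of `T*M` at the point `α`. Mathlib identifies the
tangent space of `T*M` at `α` with the model space `ℝⁿ × (ℝⁿ)*` by means of the preferred chart of
`T*M` at `α`, that is, the canonical coordinates `(q, p)` induced by a chart of `M` at the base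
point of `α`; the components of `V` are thus `(dq(V), dp(V))`. -/
def symplecticForm (α : Cotangent n M) (V W : TangentSpace (cotangentModel n) α) : ℝ :=
  let V' : EuclideanSpace ℝ (Fin n) × (EuclideanSpace ℝ (Fin n) →L[ℝ] ℝ) := V
  let W' : EuclideanSpace ℝ (Fin n) × (EuclideanSpace ℝ (Fin n) →L[ℝ] ℝ) := W
  W'.2 V'.1 - V'.2 W'.1

/-- `V` is the value at `α` of the symplectic gradient `X_g` of the Hamiltonian `E_g`. -/
def LorentzianMetric.IsSympGradient (g : LorentzianMetric n M) (α : Cotangent n M)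
    (V : TangentSpace (cotangentModel n) α) : Prop :=
  ∀ W : TangentSpace (cotangentModel n) α,
    symplecticForm α V W = (mfderiv (cotangentModel n) 𝓘(ℝ, ℝ) g.energy α W : ℝ)

/-! ### The space of null geodesics -/

/-- The future pointing dual null cones `ℒ*M ⊆ T*M`. -/
def TimeOrientation.nullCone (T : TimeOrientation g) : Set (Cotangent n M) :=
  {α | g.energy α = 0 ∧ α.snd ≠ 0 ∧ T.IsFuture (g.sharp α)}

/-- `α` and `β` lie on the same integral curve, in `ℒ*M`, of the vector field `X_g`
(i.e. on the same orbit of the cogeodesic flow). -/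
def TimeOrientation.FlowStep (T : TimeOrientation g) (α β : T.nullCone) : Prop :=
  ∃ (a b : ℝ) (Γ : ℝ → Cotangent n M),
    (∀ t ∈ Ioo a b, Γ t ∈ T.nullCone ∧
      ∃ V : TangentSpace (cotangentModel n) (Γ t), g.IsSympGradient (Γ t) V ∧
        HasMFDerivAt 𝓘(ℝ, ℝ) (cotangentModel n) Γ t ((1 : ℝ →L[ℝ] ℝ).smulRight V)) ∧
    (∃ s ∈ Ioo a b, Γ s = α) ∧ ∃ t ∈ Ioo a b, Γ t = β

/-- `β = c α` for some `c > 0`, i.e. `α` and `β` lie on the same orbit of the flow of the Euler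
vector field. -/
def TimeOrientation.EulerStep (T : TimeOrientation g) (α β : T.nullCone) : Prop :=
  ∃ c : ℝ, 0 < c ∧ (β : Cotangent n M) = ⟨α.1.proj, c • α.1.snd⟩

/-- Two points of `ℒ*M` lie in the same leaf of the foliation spanned by `X_g` and the Euler
vector field, i.e. one is reached from the other by moving finitely many times along integral
curves of these two vector fields. -/
def TimeOrientation.leafSetoid (T : TimeOrientation g) : Setoid T.nullCone :=
  Relation.EqvGen.setoid fun α β ↦ T.FlowStep α β ∨ T.EulerStep α β

/-- The space of null geodesics `𝒩_g`: the leaf space of `ℒ*M`. -/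
def TimeOrientation.NullGeodesics (T : TimeOrientation g) : Type _ :=
  Quotient T.leafSetoid

/-- `𝒩_g` carries the quotient topology. -/
instance TimeOrientation.instTopologicalSpaceNullGeodesics (T : TimeOrientation g) :
    TopologicalSpace T.NullGeodesics :=
  inferInstanceAs (TopologicalSpace (Quotient T.leafSetoid))

/-- The projection `ℒ*M → 𝒩_g`. -/
def TimeOrientation.toLeaf (T : TimeOrientation g) (α : T.nullCone) : T.NullGeodesics :=
  Quotient.mk T.leafSetoid α

/-- For a given atlas on `𝒩_g`, the projection `ℒ*M → 𝒩_g` is a smooth submersion, where `ℒ*M` is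
viewed as an embedded submanifold of `T*M`: the projection is smooth (near each point it is the
restriction of a smooth map defined on an open subset of `T*M`), and through each point of `ℒ*M`
passes a smooth local section. -/
def TimeOrientation.IsSubmersionToLeaf (T : TimeOrientation g) (d : ℕ)
    [ChartedSpace (EuclideanSpace ℝ (Fin d)) T.NullGeodesics] : Prop :=
  ∀ α : T.nullCone,
    (∃ (U : Set (Cotangent n M)) (F : Cotangent n M → T.NullGeodesics),
      IsOpen U ∧ α.1 ∈ U ∧ ContMDiffOn (cotangentModel n) (𝓡 d) ∞ F U ∧
        ∀ β : T.nullCone, β.1 ∈ U → F β = T.toLeaf β) ∧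
    (∃ (U : Set T.NullGeodesics) (σ : T.NullGeodesics → T.nullCone),
      IsOpen U ∧ T.toLeaf α ∈ U ∧
        ContMDiffOn (𝓡 d) (cotangentModel n) ∞ (fun κ ↦ (σ κ : Cotangent n M)) U ∧
        (∀ κ ∈ U, T.toLeaf (σ κ) = κ) ∧ σ (T.toLeaf α) = α)

/-- `𝒩_g` is a smooth manifold, i.e. the smooth structure of `ℒ*M` descends to `𝒩_g`: with the
quotient topology, `𝒩_g` is Hausdorff and second countable, and it carries a smooth atlas (of
dimension `2 n - 3 = dim ℒ*M - 2`) for which the projection `ℒ*M → 𝒩_g` is a submersion. -/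
def TimeOrientation.NullGeodesicsIsSmoothManifold (T : TimeOrientation g) : Prop :=
  T2Space T.NullGeodesics ∧ SecondCountableTopology T.NullGeodesics ∧
    ∃ _ : ChartedSpace (EuclideanSpace ℝ (Fin (2 * n - 3))) T.NullGeodesics,
      IsManifold (𝓡 (2 * n - 3)) ∞ T.NullGeodesics ∧ T.IsSubmersionToLeaf (2 * n - 3)

end Spacetime

end

/-!
# Null geodesics and causal simplicity of simply connected spacetimes of dimension two

In dimension two the future null cone at a point consists of two rays, so near every point there are
null coordinates `(u, v)`, in which the metric is a negative multiple of `du dv` and future pointing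
vectors increase both coordinates (`exists_nullBox`). They come from first integrals of the two null
line fields, hence from smooth dependence of the solutions of a scalar ordinary differential
equation on their initial values (`exists_smooth_flow`). Simple connectedness lets one name the two
coordinates consistently on all of `M` (`exists_orientedAtlas`): on overlaps the coordinates `u` are
increasing functions of each other, and so are the coordinates `v`. This gives two global transverse
foliations, the level curves of `u` and those of `v`. By Hamilton's equations the null geodesic
through the covector `-c du` runs along the level curve of `u` (`eventually_flowStep`,
`OrientedAtlas.along_flow`), so `𝒩_g` is the disjoint union of the leaf spaces of the two
foliations, each of them open in it (`OrientedAtlas.geodesic_eq_iff`,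
`OrientedAtlas.exists_eq_geodesic`, `OrientedAtlas.isOpenMap_geodesic`).

Most of the argument concerns these foliations only, with the orders that the coordinates induce
(`NullAtlas`), and the notion common to both directions is local simplicity: every point has a box
in which each leaf has at most one plaque. Countably many simple boxes cover `M` and
carry a measure on the transversals; measuring saturations of half boxes and gluing over the
simply connected `M` gives a height, a continuous function that locally is an increasing function of
`u` (`NullAtlas.LocallySimple.exists_isHeight`). Heights are nondecreasing along causal curves, and
a causal curve along which the height of one foliation does not change runs inside a leaf of it.

*Causal simplicity gives a smooth space of null geodesics.* If leaves returned to every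
neighbourhood of a point on different plaques, then closedness of the causal relation would give a
closed causal curve through the point, so the foliations are locally simple
(`NullAtlas.IsCausalRel.locallySimple`). Two distinct leaves either have different heights or
contain points that are not causally related in either direction; both possibilities persist nearby,
so the leaf spaces are Hausdorff (`NullAtlas.IsHeight.exists_separation`). The coordinates `u` of
simple boxes descend to charts, whose transition functions are smooth because they are given by
sliding along leaves (`OrientedAtlas.exists_holonomy`,
`OrientedAtlas.IsLeafChart.contDiffOn_transition`).

*A smooth space of null geodesics gives causal simplicity.* Local sections of the submersion `ℒ*M →
𝒩_g` show that the foliations are locally simple (`OrientedAtlas.locallySimple`), so there are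
heights `f` and `f'` for the two foliations. They already rule out closed causal curves. The height
`f` induces on the leaf space, which is connected and Hausdorff, a locally injective open map to the
line; such a map is injective (`IsOpenMap.injective_of_locally`), so leaves are determined by their
heights. An open and closed argument with staircases of null segments then identifies the causal
relation with the product order: `q` is in the causal future of `p` if and only if `f p ≤ f q` and
`f' p ≤ f' q` (`NullAtlas.IsHeight.causal_iff`). That relation is closed.
-/

open Set Bundle Filter
open scoped Manifold ContDiff Topology NNReal

noncomputable section

/-! ### Gluing along a simply connected space -/

section Gluing

variable {X A ι : Type*} [TopologicalSpace X]

/-- The bundle with discrete fibre `A` whose sections are the functions `X → A` that differ from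
each `f i` by a locally constant function on `U i`. -/
def gluingCore [AddCommGroup A] [TopologicalSpace A] [DiscreteTopology A]
    (U : ι → Set X) (hU : ∀ i, IsOpen (U i)) (f : ι → X → A)
    (hf : ∀ i j, ∀ x ∈ U i ∩ U j, ∀ᶠ y in 𝓝 x, f i y - f j y = f i x - f j x)
    (idx : X → ι) (hidx : ∀ x, x ∈ U (idx x)) : FiberBundleCore ι X A where
  baseSet := U
  isOpen_baseSet := hU
  indexAt := idx
  mem_baseSet_at := hidx
  coordChange i j x a := a + (f i x - f j x)
  coordChange_self i x _ v := by simp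
  continuousOn_coordChange i j := by
    rintro ⟨x, a⟩ ⟨hx, -⟩
    refine ContinuousAt.continuousWithinAt ?_
    have h : (fun p : X × A ↦ p.2 + (f i p.1 - f j p.1)) =ᶠ[𝓝 (x, a)]
        fun p ↦ p.2 + (f i x - f j x) := by
      filter_upwards [(continuous_fst.tendsto (x, a)).eventually (hf i j x hx)] with p hp
      rw [hp]
    exact ContinuousAt.congr (by fun_prop) h.symm
  coordChange_comp i j k x _ v := by abel

/-- Local functions on a simply connected space that pairwise differ by locally constant functions
come from a global function, up to locally constant functions. -/
theorem exists_glue_of_simplyConnected [SimplyConnectedSpace X] [LocallyPathConnectedSpace X]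
    [AddCommGroup A] (U : ι → Set X) (hU : ∀ i, IsOpen (U i)) (hcov : ∀ x, ∃ i, x ∈ U i)
    (f : ι → X → A)
    (hf : ∀ i j, ∀ x ∈ U i ∩ U j, ∀ᶠ y in 𝓝 x, f i y - f j y = f i x - f j x) :
    ∃ F : X → A, ∀ i, ∀ x ∈ U i, ∀ᶠ y in 𝓝 x, F y - f i y = F x - f i x := by
  -- the bundle of the local solutions is a covering space, which has a section
  let : TopologicalSpace A := ⊥
  have : DiscreteTopology A := ⟨rfl⟩
  choose idx hidx using hcov
  let Z := gluingCore U hU f hf idx hidx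
  have hcm : IsCoveringMap Z.proj := FiberBundle.isCoveringMap (F := A) (E := Z.Fiber)
  have x₀ : X := Classical.choice (inferInstance : Nonempty X)
  let e₀ : Z.TotalSpace := ⟨x₀, (0 : A)⟩
  obtain ⟨s, ⟨-, hs⟩, -⟩ := hcm.existsUnique_continuousMap_lifts (ContinuousMap.id X) x₀ e₀ rfl
  have hs' (x : X) : (s x).proj = x := congrFun hs x
  let c (i : ι) (x : X) : A := ((Z.localTriv i) (s x)).2
  let b (x : X) : A := (s x).2
  have hc (i : ι) (x : X) : c i x = b x + (f (idx (s x).proj) (s x).proj - f i (s x).proj) :=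
    rfl
  refine ⟨fun x ↦ c (idx x) x + f (idx x) x, fun i x hx ↦ ?_⟩
  have key (y : X) : c (idx y) y + f (idx y) y - f i y = c i y := by
    rw [hc, hc, hs']; abel
  simp only [key]
  have hcont : ContinuousAt (c i) x := by
    have h1 : ContinuousAt (Z.localTriv i) (s x) := by
      refine (Z.localTriv i).continuousOn.continuousAt
        ((Z.localTriv i).open_source.mem_nhds ?_)
      rw [(Z.localTriv i).mem_source]
      change (s x).proj ∈ U i
      rw [hs']
      exact hx
    exact continuous_snd.continuousAt.comp (h1.comp s.continuous.continuousAt)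
  exact hcont.eventually (isOpen_discrete {c i x} |>.mem_nhds rfl)

end Gluing

/-! ### Smooth first integrals of a planar line field -/

section FirstIntegral

theorem hasFDerivAt_of_partial {F F₁ F₂ : ℝ → ℝ → ℝ}
    (h₁ : ∀ t y, HasDerivAt (F · y) (F₁ t y) t) (h₂ : ∀ t y, HasDerivAt (F t ·) (F₂ t y) y)
    (c₁ : Continuous ↿F₁) (c₂ : Continuous ↿F₂) (p : ℝ × ℝ) :
    HasFDerivAt ↿F ((ContinuousLinearMap.toSpanSingleton ℝ (F₁ p.1 p.2)).coprod
      (ContinuousLinearMap.toSpanSingleton ℝ (F₂ p.1 p.2))) p := by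
  refine (hasStrictFDerivAt_uncurry_coprod (𝕜 := ℝ) (u := p) (f := F)
    (f₁ := fun t y ↦ ContinuousLinearMap.toSpanSingleton ℝ (F₁ t y))
    (f₂ := fun t y ↦ ContinuousLinearMap.toSpanSingleton ℝ (F₂ t y)) ?_ ?_ ?_ ?_).hasFDerivAt
  · exact .of_forall fun v ↦ (h₁ v.1 v.2).hasFDerivAt
  · exact .of_forall fun v ↦ (h₂ v.1 v.2).hasFDerivAt
  · exact ((ContinuousLinearMap.toSpanSingletonCLE (𝕜 := ℝ) (E := ℝ)).continuous.comp
      c₁).continuousAt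
  · exact ((ContinuousLinearMap.toSpanSingletonCLE (𝕜 := ℝ) (E := ℝ)).continuous.comp
      c₂).continuousAt

/-- A function of two variables whose partial derivatives are `C^k` is `C^(k+1)`. -/
theorem contDiff_succ_of_partial {F F₁ F₂ : ℝ → ℝ → ℝ} {k : ℕ}
    (h₁ : ∀ t y, HasDerivAt (F · y) (F₁ t y) t) (h₂ : ∀ t y, HasDerivAt (F t ·) (F₂ t y) y)
    (c₁ : ContDiff ℝ k ↿F₁) (c₂ : ContDiff ℝ k ↿F₂) : ContDiff ℝ (k + 1) ↿F := by
  refine contDiff_succ_iff_hasFDerivAt.2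
    ⟨_, ?_, hasFDerivAt_of_partial h₁ h₂ c₁.continuous c₂.continuous⟩
  have h (G : ℝ × ℝ → ℝ) (hG : ContDiff ℝ k G) :
      ContDiff ℝ k fun p ↦ ContinuousLinearMap.toSpanSingleton ℝ (G p) :=
    (ContinuousLinearMap.toSpanSingletonCLE (𝕜 := ℝ) (E := ℝ)).contDiff.comp hG
  have h' : ContDiff ℝ k fun p : ℝ × ℝ ↦
      (ContinuousLinearMap.toSpanSingleton ℝ (↿F₁ p)).comp (ContinuousLinearMap.fst ℝ ℝ ℝ) +
      (ContinuousLinearMap.toSpanSingleton ℝ (↿F₂ p)).comp (ContinuousLinearMap.snd ℝ ℝ ℝ) :=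
    ((h _ c₁).clm_comp contDiff_const).add ((h _ c₂).clm_comp contDiff_const)
  exact h'

theorem hasDerivAt_primitive_param {g g₂ : ℝ → ℝ → ℝ} (hg : Continuous ↿g) (hg₂ : Continuous ↿g₂)
    (h : ∀ t y, HasDerivAt (g t ·) (g₂ t y) y) (t y : ℝ) :
    HasDerivAt (fun y ↦ ∫ s in (0 : ℝ)..t, g s y) (∫ s in (0 : ℝ)..t, g₂ s y) y := by
  obtain ⟨C, hC⟩ := (isCompact_uIcc (a := (0 : ℝ)) (b := t)).prod
    (isCompact_closedBall y 1) |>.exists_bound_of_continuousOn hg₂.continuousOn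
  have hm {G : ℝ → ℝ → ℝ} (hG : Continuous ↿G) (z : ℝ) : Continuous fun s ↦ G s z :=
    hG.comp (by fun_prop : Continuous fun s : ℝ ↦ (s, z))
  refine (intervalIntegral.hasDerivAt_integral_of_dominated_loc_of_deriv_le
    (F := fun y s ↦ g s y) (F' := fun y s ↦ g₂ s y) (bound := fun _ ↦ C)
    (Metric.closedBall_mem_nhds y one_pos) (.of_forall fun z ↦ (hm hg z).aestronglyMeasurable)
    ((hm hg y).intervalIntegrable _ _) (hm hg₂ y).aestronglyMeasurable
    (.of_forall fun s hs z hz ↦ hC (s, z) ⟨uIoc_subset_uIcc hs, hz⟩) (by simp)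
    (.of_forall fun s _ z _ ↦ h s z)).2

/-- Primitives of `C^k` functions that depend on a parameter are `C^k` in both variables. -/
theorem contDiff_primitive_param (k : ℕ) : ∀ {g : ℝ → ℝ → ℝ}, ContDiff ℝ k ↿g →
    ContDiff ℝ k ↿(fun t y : ℝ ↦ ∫ s in (0 : ℝ)..t, g s y) := by
  induction k with
  | zero =>
    intro g hg
    refine contDiff_zero.2 ?_
    exact intervalIntegral.continuous_parametric_intervalIntegral_of_continuous
      (f := fun p : ℝ × ℝ ↦ fun s ↦ g s p.2) (hg.continuous.comp (by fun_prop :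
        Continuous fun q : (ℝ × ℝ) × ℝ ↦ (q.2, q.1.2))) continuous_fst
  | succ k ih =>
    intro g hg
    have hg₂ : ContDiff ℝ k ↿(fun t y ↦ fderiv ℝ ↿g (t, y) (0, 1)) :=
      (hg.fderiv_right (m := k) (by norm_cast)).clm_apply contDiff_const
    have hgd (t y : ℝ) : HasDerivAt (g t ·) (fderiv ℝ ↿g (t, y) (0, 1)) y := by
      have h1 := (hg.differentiable (by norm_cast) (t, y)).hasFDerivAt
      exact h1.comp_hasDerivAt y ((hasDerivAt_const y t).prodMk (hasDerivAt_id y))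
    refine contDiff_succ_of_partial (F₁ := g) (fun t y ↦ ?_)
      (fun t y ↦ hasDerivAt_primitive_param hg.continuous hg₂.continuous hgd t y)
      (hg.of_le (by norm_cast; omega)) (ih hg₂)
    have hc : Continuous fun s ↦ g s y :=
      hg.continuous.comp (by fun_prop : Continuous fun s : ℝ ↦ (s, y))
    exact intervalIntegral.integral_hasDerivAt_right (hc.intervalIntegrable _ _)
      (hc.stronglyMeasurableAtFilter _ _) hc.continuousAt

/-- Global solutions of a bounded and Lipschitz scalar differential equation. -/
theorem exists_global_solution {f : ℝ → ℝ → ℝ} {K L : ℝ≥0} (hc : Continuous ↿f)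
    (hK : ∀ t, LipschitzWith K (f t)) (hL : ∀ t y, ‖f t y‖ ≤ L) (y : ℝ) :
    ∃ α : ℝ → ℝ, α 0 = y ∧ ∀ t, HasDerivAt α (f t (α t)) t := by
  have hP (n : ℕ) : ∃ α : ℝ → ℝ, α 0 = y ∧
      ∀ t ∈ Icc (-(n + 1 : ℝ)) (n + 1), HasDerivWithinAt α (f t (α t)) (Icc (-(n + 1)) (n + 1)) t := by
    have h : IsPicardLindelof f (tmin := -(n + 1 : ℝ)) (tmax := n + 1)
        ⟨0, by constructor <;> linarith [(n.cast_nonneg : (0 : ℝ) ≤ n)]⟩ y (L * (n + 1)) 0 L K :=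
      { lipschitzOnWith := fun t _ ↦ (hK t).lipschitzOnWith
        continuousOn := fun x _ ↦
          (hc.comp (by fun_prop : Continuous fun s : ℝ ↦ (s, x))).continuousOn
        norm_le := fun t _ x _ ↦ hL t x
        mul_max_le := by simp }
    exact h.exists_eq_forall_mem_Icc_hasDerivWithinAt₀
  choose α h0 hα using hP
  have hd (n : ℕ) (t : ℝ) (ht : t ∈ Ioo (-(n + 1 : ℝ)) (n + 1)) :
      HasDerivAt (α n) (f t (α n t)) t :=
    (hα n t (Ioo_subset_Icc_self ht)).hasDerivAt (Icc_mem_nhds ht.1 ht.2)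
  have hmono (n m : ℕ) (h : n ≤ m) : EqOn (α n) (α m) (Ioo (-(n + 1 : ℝ)) (n + 1)) := by
    have h' : (n : ℝ) ≤ m := by exact_mod_cast h
    have hn : (0 : ℝ) ≤ n := n.cast_nonneg
    refine ODE_solution_unique_of_mem_Ioo (v := f) (s := fun _ ↦ univ) (K := K) (t₀ := 0)
      (fun t _ ↦ (hK t).lipschitzOnWith) (by constructor <;> linarith)
      (fun t ht ↦ ⟨hd n t ht, mem_univ _⟩)
      (fun t ht ↦ ⟨hd m t ⟨by linarith [ht.1], by linarith [ht.2]⟩, mem_univ _⟩) ?_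
    rw [h0, h0]
  -- the solutions on the intervals `[-(n + 1), n + 1]` agree where they are defined
  refine ⟨fun t ↦ α ⌈|t|⌉₊ t, h0 _, fun t ↦ ?_⟩
  have hev : (fun s ↦ α ⌈|s|⌉₊ s) =ᶠ[𝓝 t] α (⌈|t|⌉₊ + 1) := by
    have : ∀ᶠ s in 𝓝 t, |s| < (⌈|t|⌉₊ : ℝ) + 1 :=
      continuous_abs.continuousAt.eventually_lt continuousAt_const
        (by linarith [Nat.le_ceil |t|])
    filter_upwards [this] with s hs
    refine hmono _ _ (Nat.ceil_le.2 (by push_cast; linarith)) ?_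
    have := Nat.le_ceil |s|
    exact abs_lt.1 (by linarith)
  have h1 : α ⌈|t|⌉₊ t = α (⌈|t|⌉₊ + 1) t := hev.eq_of_nhds
  beta_reduce
  rw [h1]
  refine HasDerivAt.congr_of_eventuallyEq (hd _ t ?_) hev
  have := Nat.le_ceil |t|
  exact abs_lt.1 (by push_cast; linarith)

/-- The difference of two solutions of a scalar equation solves a linear equation, whose coefficient
is the mean of the derivative of the right-hand side between the two solutions. -/
theorem solution_sub_eq {f f₂ : ℝ → ℝ → ℝ} (hf₂ : Continuous ↿f₂)
    (hd : ∀ t y, HasDerivAt (f t ·) (f₂ t y) y) {α β : ℝ → ℝ}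
    (hα : ∀ t, HasDerivAt α (f t (α t)) t) (hβ : ∀ t, HasDerivAt β (f t (β t)) t) (t : ℝ) :
    β t - α t = (β 0 - α 0) * Real.exp (∫ s in (0 : ℝ)..t, ∫ θ in (0 : ℝ)..1,
      f₂ s (α s + θ * (β s - α s))) := by
  have cα : Continuous α := continuous_iff_continuousAt.2 fun t ↦ (hα t).continuousAt
  have cβ : Continuous β := continuous_iff_continuousAt.2 fun t ↦ (hβ t).continuousAt
  set A : ℝ → ℝ := fun s ↦ ∫ θ in (0 : ℝ)..1, f₂ s (α s + θ * (β s - α s)) with hA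
  have cA : Continuous A :=
    intervalIntegral.continuous_parametric_intervalIntegral_of_continuous'
      (f := fun s θ ↦ f₂ s (α s + θ * (β s - α s)))
      (hf₂.comp (by fun_prop : Continuous fun q : ℝ × ℝ ↦
        (q.1, α q.1 + q.2 * (β q.1 - α q.1)))) _ _
  have hAeq (s : ℝ) : f s (β s) - f s (α s) = A s * (β s - α s) := by
    have h1 (θ : ℝ) : HasDerivAt (fun θ ↦ f s (α s + θ * (β s - α s)))
        (f₂ s (α s + θ * (β s - α s)) * (β s - α s)) θ := by
      have := ((hasDerivAt_id θ).mul_const (β s - α s)).const_add (α s)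
      simpa [Function.comp_def] using! (hd s (α s + θ * (β s - α s))).comp θ this
    have h2 := intervalIntegral.integral_eq_sub_of_hasDerivAt (a := 0) (b := 1)
      (fun θ _ ↦ h1 θ) ((Continuous.mul (hf₂.comp (by fun_prop : Continuous fun θ : ℝ ↦
        (s, α s + θ * (β s - α s)))) continuous_const).intervalIntegrable _ _)
    rw [intervalIntegral.integral_mul_const] at h2
    simpa using h2.symm
  have hI (t : ℝ) : HasDerivAt (fun t ↦ ∫ s in (0 : ℝ)..t, A s) (A t) t :=
    intervalIntegral.integral_hasDerivAt_right (cA.intervalIntegrable _ _)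
      (cA.stronglyMeasurableAtFilter _ _) cA.continuousAt
  have hE (t : ℝ) : HasDerivAt
      (fun t ↦ (β t - α t) * Real.exp (-∫ s in (0 : ℝ)..t, A s)) 0 t := by
    have := ((hβ t).sub (hα t)).mul (hI t).neg.exp
    convert! this using 1
    simp only [Pi.sub_apply, Pi.neg_apply]
    rw [hAeq]; ring
  have := is_const_of_deriv_eq_zero (fun t ↦ (hE t).differentiableAt) (fun t ↦ (hE t).deriv) t 0
  simp only [intervalIntegral.integral_same, neg_zero, Real.exp_zero, mul_one] at this
  rw [← this, mul_assoc, ← Real.exp_add]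
  simp

/-- Solutions of a scalar differential equation with smooth, bounded and Lipschitz right-hand side
depend smoothly on the initial value. -/
theorem exists_smooth_flow {f : ℝ → ℝ → ℝ} {K L : ℝ≥0} (hf : ContDiff ℝ ∞ ↿f)
    (hK : ∀ t, LipschitzWith K (f t)) (hL : ∀ t y, ‖f t y‖ ≤ L) :
    ∃ ψ : ℝ → ℝ → ℝ, ContDiff ℝ ∞ ↿ψ ∧ (∀ y, ψ 0 y = y) ∧
      (∀ t y, HasDerivAt (ψ · y) (f t (ψ t y)) t) ∧
      ∀ t y, ∃ c : ℝ, 0 < c ∧ HasDerivAt (ψ t ·) c y := by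
  choose α h0 hα using exists_global_solution hf.continuous hK hL
  set f₂ : ℝ → ℝ → ℝ := fun t y ↦ fderiv ℝ ↿f (t, y) (0, 1) with hf₂_def
  have hf₂ : ContDiff ℝ ∞ ↿f₂ := (hf.fderiv_right (m := ∞) (by simp)).clm_apply contDiff_const
  have hd (t y : ℝ) : HasDerivAt (f t ·) (f₂ t y) y := by
    have h1 := (hf.differentiable (by simp) (t, y)).hasFDerivAt
    exact h1.comp_hasDerivAt y ((hasDerivAt_const y t).prodMk (hasDerivAt_id y))
  have hcα (y : ℝ) : Continuous (α y) :=
    continuous_iff_continuousAt.2 fun t ↦ (hα y t).continuousAt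
  have hdist (t y z : ℝ) : |α z t - α y t| ≤ |z - y| * Real.exp (K * |t|) := by
    rw [solution_sub_eq hf₂.continuous hd (hα y) (hα z) t, h0, h0, abs_mul, Real.abs_exp]
    gcongr
    refine (le_abs_self _).trans ?_
    have h1 (s θ : ℝ) : ‖f₂ s θ‖ ≤ K := by
      rw [← (hd s θ).deriv]
      exact norm_deriv_le_of_lipschitz (hK s)
    have h2 (s : ℝ) : ‖∫ θ in (0 : ℝ)..1, f₂ s (α y s + θ * (α z s - α y s))‖ ≤ K := by
      simpa using intervalIntegral.norm_integral_le_of_norm_le_const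
        (a := 0) (b := 1) (f := fun θ ↦ f₂ s (α y s + θ * (α z s - α y s))) fun θ _ ↦ h1 s _
    simpa using intervalIntegral.norm_integral_le_of_norm_le_const (a := 0) (b := t) fun s _ ↦ h2 s
  -- Gronwall's inequality gives the continuity of the flow
  have hcψ : Continuous ↿(fun t y ↦ α y t) := by
    refine continuous_iff_continuousAt.2 fun ⟨t, y⟩ ↦ ?_
    have h1 : Tendsto (fun p : ℝ × ℝ ↦ |p.2 - y| * Real.exp (K * |p.1|)) (𝓝 (t, y)) (𝓝 0) := by
      have : Continuous fun p : ℝ × ℝ ↦ |p.2 - y| * Real.exp (K * |p.1|) := by fun_prop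
      simpa using this.tendsto (t, y)
    have h2 : Tendsto (fun p : ℝ × ℝ ↦ α p.2 p.1 - α y p.1) (𝓝 (t, y)) (𝓝 0) :=
      squeeze_zero_norm (fun p ↦ hdist p.1 y p.2) h1
    have h3 : Tendsto (fun p : ℝ × ℝ ↦ α y p.1) (𝓝 (t, y)) (𝓝 (α y t)) :=
      ((hcα y).comp continuous_fst).tendsto (t, y)
    simpa using! h2.add h3
  -- the difference quotients have a formula that extends continuously to the diagonal
  have hdy (t y : ℝ) : HasDerivAt (fun y ↦ α y t)
      (Real.exp (∫ s in (0 : ℝ)..t, f₂ s (α y s))) y := by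
    set e : ℝ → ℝ := fun z ↦ Real.exp (∫ s in (0 : ℝ)..t, ∫ θ in (0 : ℝ)..1,
      f₂ s (α y s + θ * (α z s - α y s))) with he
    have ce : Continuous e := by
      refine Real.continuous_exp.comp
        (intervalIntegral.continuous_parametric_intervalIntegral_of_continuous' ?_ _ _)
      refine intervalIntegral.continuous_parametric_intervalIntegral_of_continuous'
        (f := fun q : ℝ × ℝ ↦ fun θ ↦ f₂ q.2 (α y q.2 + θ * (α q.1 q.2 - α y q.2))) ?_ _ _
      have h1 : Continuous fun q : (ℝ × ℝ) × ℝ ↦ α q.1.1 q.1.2 :=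
        hcψ.comp (by fun_prop : Continuous fun q : (ℝ × ℝ) × ℝ ↦ (q.1.2, q.1.1))
      have h2 : Continuous fun q : (ℝ × ℝ) × ℝ ↦ α y q.1.2 := (hcα y).comp (by fun_prop)
      exact hf₂.continuous.comp ((continuous_snd.comp continuous_fst).prodMk
        (h2.add (continuous_snd.mul (h1.sub h2))))
    have hey : e y = Real.exp (∫ s in (0 : ℝ)..t, f₂ s (α y s)) := by simp [he]
    rw [← hey, hasDerivAt_iff_tendsto_slope]
    refine (ce.continuousAt.tendsto.mono_left nhdsWithin_le_nhds).congr' ?_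
    filter_upwards [self_mem_nhdsWithin] with z hz
    have hz' : z - y ≠ 0 := sub_ne_zero.2 hz
    rw [slope_def_field, solution_sub_eq hf₂.continuous hd (hα y) (hα z) t, h0, h0]
    field_simp
    rfl
  refine ⟨fun t y ↦ α y t, contDiff_infty.2 fun k ↦ ?_, h0, fun t y ↦ hα y t,
    fun t y ↦ ⟨_, Real.exp_pos _, hdy t y⟩⟩
  -- both partial derivatives of the flow are as smooth as the flow itself
  induction k with
  | zero => exact contDiff_zero.2 hcψ
  | succ k ih =>
    have hpair : ContDiff ℝ k fun p : ℝ × ℝ ↦ (p.1, α p.2 p.1) := contDiff_fst.prodMk ih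
    have hf' : ContDiff ℝ k ↿f := hf.of_le (by exact_mod_cast le_top)
    have hf₂' : ContDiff ℝ k ↿f₂ := hf₂.of_le (by exact_mod_cast le_top)
    exact contDiff_succ_of_partial (F₁ := fun t y ↦ f t (α y t)) (fun t y ↦ hα y t) hdy
      (hf'.comp hpair) (Real.contDiff_exp.comp
        (contDiff_primitive_param k (g := fun s y ↦ f₂ s (α y s)) (hf₂'.comp hpair)))

end FirstIntegral

/-! ### Null coordinates in the plane -/

section PlanarNullCoordinates

/-- The smooth inverse function theorem, with an inverse that is smooth on its whole domain. -/
theorem exists_openPartialHomeomorph_of_injective_fderiv {E : Type*} [NormedAddCommGroup E]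
    [NormedSpace ℝ E] [FiniteDimensional ℝ E] {f : E → E} {O : Set E} (hO : IsOpen O)
    (hf : ContDiffOn ℝ ∞ f O) {x : E} (hx : x ∈ O)
    (hinj : ∀ y ∈ O, Function.Injective (fderiv ℝ f y)) :
    ∃ Φ : OpenPartialHomeomorph E E, x ∈ Φ.source ∧ Φ.source ⊆ O ∧ (∀ y, Φ y = f y) ∧
      ContDiffOn ℝ ∞ Φ Φ.source ∧ ContDiffOn ℝ ∞ Φ.symm Φ.target := by
  have : CompleteSpace E := FiniteDimensional.complete ℝ E
  let e (y : E) (hy : y ∈ O) : E ≃L[ℝ] E :=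
    (LinearEquiv.ofInjectiveEndo (fderiv ℝ f y).toLinearMap (hinj y hy)).toContinuousLinearEquiv
  have he (y : E) (hy : y ∈ O) : HasFDerivAt f (e y hy : E →L[ℝ] E) y := by
    convert! ((hf.contDiffAt (hO.mem_nhds hy)).differentiableAt (by simp)).hasFDerivAt using 1
  have hfx := hf.contDiffAt (hO.mem_nhds hx)
  let Ψ := hfx.toOpenPartialHomeomorph f (he x hx) (by simp)
  refine ⟨Ψ.restrOpen O hO, ⟨hfx.mem_toOpenPartialHomeomorph_source (he x hx) (by simp), hx⟩,
    fun y hy ↦ hy.2, fun y ↦ rfl, hf.mono fun y hy ↦ hy.2, fun z hz ↦ ?_⟩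
  have hz' : (Ψ.restrOpen O hO).symm z ∈ O := ((Ψ.restrOpen O hO).map_target hz).2
  exact ((Ψ.restrOpen O hO).contDiffAt_symm hz (he _ hz')
    (hf.contDiffAt (hO.mem_nhds hz'))).contDiffWithinAt

/-- A smooth planar line field spanned by `(1, f)` has a smooth local first integral. -/
theorem exists_first_integral {f : ℝ × ℝ → ℝ} {O : Set (ℝ × ℝ)} (hO : O ∈ 𝓝 0)
    (hf : ContDiffOn ℝ ∞ f O) :
    ∃ (u : ℝ × ℝ → ℝ) (W : Set (ℝ × ℝ)), IsOpen W ∧ 0 ∈ W ∧ W ⊆ O ∧ ContDiffOn ℝ ∞ u W ∧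
      fderiv ℝ u 0 (0, 1) = 1 ∧ ∀ p ∈ W, fderiv ℝ u p (1, f p) = 0 := by
  obtain ⟨r, hr, hrO⟩ := Metric.mem_nhds_iff.1 hO
  -- a cutoff makes the slope globally Lipschitz without changing it near the origin
  let χ : ContDiffBump (0 : ℝ × ℝ) := ⟨r / 3, r / 2, by positivity, by linarith⟩
  have hrO' : Metric.ball 0 r ⊆ O := hrO
  set F : ℝ × ℝ → ℝ := fun p ↦ χ p * f p with hF
  have hFsm : ContDiff ℝ ∞ F := by
    refine contDiff_iff_contDiffAt.2 fun p ↦ ?_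
    by_cases hp : p ∈ Metric.ball (0 : ℝ × ℝ) r
    · exact χ.contDiff.contDiffAt.mul
        (hf.contDiffAt (mem_of_superset (Metric.isOpen_ball.mem_nhds hp) hrO'))
    · have h1 : F =ᶠ[𝓝 p] fun _ ↦ 0 := by
        have : (Metric.closedBall (0 : ℝ × ℝ) (r / 2))ᶜ ∈ 𝓝 p := by
          refine Metric.isClosed_closedBall.isOpen_compl.mem_nhds fun h ↦ hp ?_
          exact Metric.closedBall_subset_ball (by linarith) h
        filter_upwards [this] with q hq
        have : χ q = 0 := χ.zero_of_le_dist (not_le.1 fun h ↦ hq h).le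
        simp [hF, this]
      exact contDiffAt_const.congr_of_eventuallyEq h1
  have hFc : HasCompactSupport F := χ.hasCompactSupport.mul_right
  have hFf : ∀ p ∈ Metric.ball (0 : ℝ × ℝ) (r / 3), F p = f p := fun p hp ↦ by
    simp [hF, χ.one_of_mem_closedBall (Metric.ball_subset_closedBall hp)]
  obtain ⟨K, hK⟩ := hFsm.lipschitzWith_of_hasCompactSupport hFc (by simp)
  obtain ⟨L, hL⟩ := hFc.exists_bound_of_continuous hFsm.continuous
  obtain ⟨ψ, hψ, hψ0, hψt, hψy⟩ := exists_smooth_flow (f := fun t y ↦ F (t, y)) (K := K)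
    (L := L.toNNReal) hFsm
    (fun t ↦ by simpa using! hK.comp (LipschitzWith.prodMk_left t))
    (fun t y ↦ (hL _).trans (Real.le_coe_toNNReal L))
  let Ψ : ℝ × ℝ → ℝ × ℝ := fun p ↦ (p.1, ψ p.1 p.2)
  have hΨ : ContDiff ℝ ∞ Ψ := contDiff_fst.prodMk hψ
  have hdt (t y : ℝ) : fderiv ℝ Ψ (t, y) (1, 0) = (1, F (t, ψ t y)) := by
    have h1 := (hΨ.differentiable (by simp) (t, y)).hasFDerivAt.comp_hasDerivAt t
      ((hasDerivAt_id t).prodMk (hasDerivAt_const t y))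
    exact h1.unique ((hasDerivAt_id t).prodMk (hψt t y))
  have hdy (t y : ℝ) : ∃ c : ℝ, 0 < c ∧ fderiv ℝ Ψ (t, y) (0, 1) = (0, c) := by
    obtain ⟨c, hc, hcd⟩ := hψy t y
    have h1 := (hΨ.differentiable (by simp) (t, y)).hasFDerivAt.comp_hasDerivAt y
      ((hasDerivAt_const y t).prodMk (hasDerivAt_id y))
    exact ⟨c, hc, h1.unique ((hasDerivAt_const y t).prodMk hcd)⟩
  have hinj (p : ℝ × ℝ) : Function.Injective (fderiv ℝ Ψ p) := by
    refine (injective_iff_map_eq_zero _).2 fun w hw ↦ ?_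
    obtain ⟨t, y⟩ := p
    obtain ⟨c, hc, hcd⟩ := hdy t y
    have hw' : w = w.1 • ((1 : ℝ), (0 : ℝ)) + w.2 • ((0 : ℝ), (1 : ℝ)) := by ext <;> simp
    rw [hw', map_add, map_smul, map_smul, hdt, hcd, Prod.ext_iff] at hw
    simp only [Prod.smul_mk, Prod.mk_add_mk, smul_eq_mul, mul_one, mul_zero, add_zero,
      Prod.fst_zero, Prod.snd_zero] at hw
    obtain ⟨h1, h2⟩ := hw
    rw [h1, zero_mul, zero_add, mul_eq_zero, or_iff_left hc.ne'] at h2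
    exact Prod.ext h1 h2
  obtain ⟨Φ, h0, -, hΦ, -, hΦs⟩ := exists_openPartialHomeomorph_of_injective_fderiv
    isOpen_univ hΨ.contDiffOn (mem_univ (0 : ℝ × ℝ)) fun p _ ↦ hinj p
  have hΨ0 (y : ℝ) : Ψ (0, y) = (0, y) := by simp [Ψ, hψ0]
  have hΦ0 : (0 : ℝ × ℝ) ∈ Φ.target := by
    have := Φ.map_source h0
    rwa [hΦ, show (0 : ℝ × ℝ) = (0, 0) from rfl, hΨ0] at this
  have hu : ContDiffOn ℝ ∞ (fun p ↦ (Φ.symm p).2) (Φ.target ∩ Metric.ball 0 (r / 3)) :=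
    contDiff_snd.comp_contDiffOn (hΦs.mono inter_subset_left)
  have hWo : IsOpen (Φ.target ∩ Metric.ball 0 (r / 3)) := Φ.open_target.inter Metric.isOpen_ball
  have h0W : (0 : ℝ × ℝ) ∈ Φ.target ∩ Metric.ball 0 (r / 3) :=
    ⟨hΦ0, Metric.mem_ball_self (by positivity)⟩
  have hud : ∀ p ∈ Φ.target ∩ Metric.ball 0 (r / 3),
      HasFDerivAt (fun p ↦ (Φ.symm p).2) (fderiv ℝ (fun p ↦ (Φ.symm p).2) p) p := fun p hp ↦
    ((hu.contDiffAt (hWo.mem_nhds hp)).differentiableAt (by simp)).hasFDerivAt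
  -- the first integral is the initial value of the solution through a point
  have huΨ : ∀ q ∈ Φ.source, (Φ.symm (Ψ q)).2 = q.2 := fun q hq ↦ by
    rw [← hΦ, Φ.left_inv hq]
  refine ⟨fun p ↦ (Φ.symm p).2, Φ.target ∩ Metric.ball 0 (r / 3), hWo, h0W,
    fun p hp ↦ hrO' (Metric.ball_subset_ball (by linarith) hp.2), hu, ?_, fun p hp ↦ ?_⟩
  · have h1 : HasDerivAt (fun y : ℝ ↦ ((0 : ℝ), y)) (0, 1) 0 :=
      (hasDerivAt_const 0 0).prodMk (hasDerivAt_id 0)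
    have h2 := HasFDerivAt.comp_hasDerivAt (0 : ℝ) (hud 0 h0W) h1
    refine h2.unique ((hasDerivAt_id (0 : ℝ)).congr_of_eventuallyEq ?_)
    have h3 : ∀ᶠ y in 𝓝 (0 : ℝ), ((0 : ℝ), y) ∈ Φ.source :=
      h1.continuousAt (Φ.open_source.mem_nhds h0)
    filter_upwards [h3] with y hy
    have := huΨ _ hy
    rwa [hΨ0] at this
  · set q := Φ.symm p with hq
    have hqs : q ∈ Φ.source := Φ.map_target hp.1
    have hpq : Ψ q = p := by rw [← hΦ, hq, Φ.right_inv hp.1]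
    have h1 : HasDerivAt (fun t : ℝ ↦ (t, q.2)) (1, 0) q.1 :=
      (hasDerivAt_id q.1).prodMk (hasDerivAt_const q.1 q.2)
    have h2 : HasDerivAt (fun t : ℝ ↦ Ψ (t, q.2)) (1, f p) q.1 := by
      have := (hΨ.differentiable (by simp) q).hasFDerivAt.comp_hasDerivAt q.1 h1
      rw [show fderiv ℝ Ψ q (1, 0) = (1, F p) by rw [← hpq]; exact hdt q.1 q.2, hFf p hp.2] at this
      exact this
    have h3 := HasFDerivAt.comp_hasDerivAt q.1 (f := fun t : ℝ ↦ Ψ (t, q.2))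
      (by simpa [hpq] using hud p hp) h2
    have h4 : HasDerivAt ((fun p ↦ (Φ.symm p).2) ∘ fun t : ℝ ↦ Ψ (t, q.2)) 0 q.1 := by
      refine (hasDerivAt_const q.1 q.2).congr_of_eventuallyEq ?_
      have : ∀ᶠ t in 𝓝 q.1, (t, q.2) ∈ Φ.source :=
        h1.continuousAt (Φ.open_source.mem_nhds hqs)
      filter_upwards [this] with t ht using huΨ _ ht
    simpa [hpq] using h3.unique h4

/-- The root `f` of `A + 2 B f + C f² = 0` that vanishes together with `A` is smooth: it has a
formula in which no division by `C` occurs. -/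
theorem exists_smooth_slope {A B C : ℝ × ℝ → ℝ} {O : Set (ℝ × ℝ)}
    (hA : ContDiffOn ℝ ∞ A O) (hB : ContDiffOn ℝ ∞ B O) (hC : ContDiffOn ℝ ∞ C O)
    (hneg : ∀ p ∈ O, B p < 0 ∧ A p * C p < B p ^ 2) :
    ∃ f : ℝ × ℝ → ℝ, ContDiffOn ℝ ∞ f O ∧ (∀ p ∈ O, A p + 2 * B p * f p + C p * f p ^ 2 = 0) ∧
      ∀ p, A p = 0 → f p = 0 := by
  have hpos (p : ℝ × ℝ) (hp : p ∈ O) : 0 < 1 - A p * C p / B p ^ 2 := by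
    have := (hneg p hp).1.ne
    rw [sub_pos, div_lt_one (by positivity)]
    exact (hneg p hp).2
  have hden (p : ℝ × ℝ) (hp : p ∈ O) : B p * (1 + √(1 - A p * C p / B p ^ 2)) ≠ 0 :=
    mul_ne_zero (hneg p hp).1.ne (by positivity)
  refine ⟨fun p ↦ -A p / (B p * (1 + √(1 - A p * C p / B p ^ 2))), ?_, fun p hp ↦ ?_,
    fun p hp ↦ by simp [hp]⟩
  · refine hA.neg.div (hB.mul (contDiffOn_const.add (ContDiffOn.sqrt (contDiffOn_const.sub
      ((hA.mul hC).div (hB.pow 2) fun p hp ↦ pow_ne_zero 2 (hneg p hp).1.ne)) ?_))) hden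
    exact fun p hp ↦ (hpos p hp).ne'
  · have hs := Real.sq_sqrt (hpos p hp).le
    have hs0 := Real.sqrt_nonneg (1 - A p * C p / B p ^ 2)
    set s := √(1 - A p * C p / B p ^ 2) with hs_def
    have hb := (hneg p hp).1.ne
    have h1 : 1 + s ≠ 0 := by positivity
    have hs' : A p * C p = B p ^ 2 * (1 - s ^ 2) := by
      rw [hs]; field_simp; ring
    have h2 : A p + 2 * B p * (-A p / (B p * (1 + s))) + C p * (-A p / (B p * (1 + s))) ^ 2 =
        A p * (B p ^ 2 * (s ^ 2 - 1) + A p * C p) / (B p ^ 2 * (1 + s) ^ 2) := by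
      field_simp; ring
    rw [h2, hs']; ring

/-- A smooth Lorentzian metric on a neighbourhood of the origin of the plane, for which the
coordinate axes are null at the origin, has null coordinates that are tangent to the identity. -/
theorem exists_planar_null_coordinates {A B C : ℝ × ℝ → ℝ} {O : Set (ℝ × ℝ)} (hO : IsOpen O)
    (h0 : 0 ∈ O) (hA : ContDiffOn ℝ ∞ A O) (hB : ContDiffOn ℝ ∞ B O) (hC : ContDiffOn ℝ ∞ C O)
    (hA0 : A 0 = 0) (hC0 : C 0 = 0) (hB0 : B 0 < 0) :
    ∃ Φ : OpenPartialHomeomorph (ℝ × ℝ) (ℝ × ℝ), 0 ∈ Φ.source ∧ Φ.source ⊆ O ∧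
      ContDiffOn ℝ ∞ Φ Φ.source ∧ ContDiffOn ℝ ∞ Φ.symm Φ.target ∧
      (∀ w : ℝ × ℝ, 0 < w.1 → 0 < w.2 → 0 < (fderiv ℝ Φ 0 w).1 ∧ 0 < (fderiv ℝ Φ 0 w).2) ∧
      ∀ p ∈ Φ.source, ∃ k > 0, ∀ w w' : ℝ × ℝ,
        A p * (w.1 * w'.1) + B p * (w.1 * w'.2 + w.2 * w'.1) + C p * (w.2 * w'.2) =
          -k * ((fderiv ℝ Φ p w).1 * (fderiv ℝ Φ p w').2 +
            (fderiv ℝ Φ p w).2 * (fderiv ℝ Φ p w').1) := by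
  have cA := (hA.continuousOn.continuousAt (hO.mem_nhds h0))
  have cB := (hB.continuousOn.continuousAt (hO.mem_nhds h0))
  have cC := (hC.continuousOn.continuousAt (hO.mem_nhds h0))
  obtain ⟨O₁, hO₁, hO₁o, h0₁⟩ : ∃ O₁ ⊆ {p | p ∈ O ∧ B p < 0 ∧ A p * C p < B p ^ 2},
      IsOpen O₁ ∧ 0 ∈ O₁ := by
    refine mem_nhds_iff.1 ?_
    refine (hO.eventually_mem h0).and
      ((cB.eventually_lt continuousAt_const hB0).and ((cA.mul cC).eventually_lt (cB.pow 2) ?_))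
    rw [Pi.mul_apply, hA0]
    have := hB0.ne
    simp only [zero_mul]
    positivity
  have hOO : O₁ ⊆ O := fun p hp ↦ (hO₁ hp).1
  replace hA := hA.mono hOO
  replace hB := hB.mono hOO
  replace hC := hC.mono hOO
  obtain ⟨f, hf, hfe, hf0⟩ := exists_smooth_slope hA hB hC fun p hp ↦ (hO₁ hp).2
  obtain ⟨h, hh, hhe, hh0⟩ := exists_smooth_slope hC hB hA fun p hp ↦ by
    have := (hO₁ hp).2; rwa [mul_comm]
  have hswap : ContDiff ℝ ∞ (Prod.swap : ℝ × ℝ → ℝ × ℝ) := contDiff_snd.prodMk contDiff_fst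
  obtain ⟨u, W, hW, h0W, hWO, hu, hu0, hud⟩ := exists_first_integral (hO₁o.mem_nhds h0₁) hf
  obtain ⟨v', W', hW', h0W', hWO', hv', hv0', hvd'⟩ := exists_first_integral
    (f := h ∘ Prod.swap) (O := Prod.swap ⁻¹' O₁)
    ((hO₁o.preimage continuous_swap).mem_nhds h0₁) (hh.comp hswap.contDiffOn fun p hp ↦ hp)
  set v : ℝ × ℝ → ℝ := v' ∘ Prod.swap with hv_def
  have hvW : ContDiffOn ℝ ∞ v (Prod.swap ⁻¹' W') := hv'.comp hswap.contDiffOn fun p hp ↦ hp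
  have hV : IsOpen (Prod.swap ⁻¹' W') := hW'.preimage continuous_swap
  have hvd (p : ℝ × ℝ) (hp : p.swap ∈ W') (w : ℝ × ℝ) :
      fderiv ℝ v p w = fderiv ℝ v' p.swap w.swap := by
    have h1 : HasFDerivAt (Prod.swap : ℝ × ℝ → ℝ × ℝ)
        ((ContinuousLinearMap.snd ℝ ℝ ℝ).prod (ContinuousLinearMap.fst ℝ ℝ ℝ)) p :=
      hasFDerivAt_snd.prodMk hasFDerivAt_fst
    have h2 := ((hv'.contDiffAt (hW'.mem_nhds hp)).differentiableAt (by simp)).hasFDerivAt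
    rw [(h2.comp p h1).fderiv]; rfl
  -- the null directions are spanned by `X = (1, f)` and `Y = (h, 1)`
  let Gxy : ℝ × ℝ → ℝ := fun p ↦ A p * h p + B p * (1 + f p * h p) + C p * f p
  have hf00 := hf0 0 hA0
  have hh00 := hh0 0 hC0
  have cf := hf.continuousOn.continuousAt (hO₁o.mem_nhds h0₁)
  have ch := hh.continuousOn.continuousAt (hO₁o.mem_nhds h0₁)
  have cdu : ContinuousAt (fderiv ℝ u) 0 :=
    (hu.contDiffAt (hW.mem_nhds h0W)).continuousAt_fderiv (by simp)
  have cdv : ContinuousAt (fderiv ℝ v) 0 :=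
    (hvW.contDiffAt (hV.mem_nhds h0W')).continuousAt_fderiv (by simp)
  obtain ⟨O₂, hO₂, hO₂o, h0₂⟩ : ∃ O₂ ⊆ {p | p ∈ W ∧ p ∈ Prod.swap ⁻¹' W' ∧ Gxy p < 0 ∧
      0 < fderiv ℝ u p (h p, 1) ∧ 0 < fderiv ℝ v p (1, f p)}, IsOpen O₂ ∧ 0 ∈ O₂ := by
    refine mem_nhds_iff.1 ?_
    refine (hW.eventually_mem h0W).and ((hV.eventually_mem h0W').and
      ((ContinuousAt.eventually_lt (f := Gxy) (by fun_prop) continuousAt_const ?_).and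
      ((ContinuousAt.eventually_lt continuousAt_const
        (cdu.clm_apply (ch.prodMk continuousAt_const)) ?_).and
      (ContinuousAt.eventually_lt continuousAt_const
        (cdv.clm_apply (continuousAt_const.prodMk cf)) ?_))))
    · simpa [Gxy, hf00, hA0, hC0] using hB0
    · rw [hh00, hu0]; exact one_pos
    · rw [hf00, hvd 0 h0W']
      exact hv0'.symm ▸ one_pos
  -- `v` is constant along `Y` and increases along `X`, and conversely for `u`
  let F : ℝ × ℝ → ℝ × ℝ := fun p ↦ (v p, u p)
  have hF : ContDiffOn ℝ ∞ F O₂ :=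
    (hvW.mono fun p hp ↦ (hO₂ hp).2.1).prodMk (hu.mono fun p hp ↦ (hO₂ hp).1)
  have hFd (p : ℝ × ℝ) (hp : p ∈ O₂) (w : ℝ × ℝ) :
      fderiv ℝ F p w = (fderiv ℝ v p w, fderiv ℝ u p w) := by
    have h1 := ((hvW.contDiffAt (hV.mem_nhds (hO₂ hp).2.1)).differentiableAt
      (by simp)).hasFDerivAt
    have h2 := ((hu.contDiffAt (hW.mem_nhds (hO₂ hp).1)).differentiableAt (by simp)).hasFDerivAt
    rw [(h1.prodMk h2).fderiv]; rfl
  have hX (p : ℝ × ℝ) (hp : p ∈ O₂) : fderiv ℝ u p (1, f p) = 0 := hud p (hO₂ hp).1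
  have hY (p : ℝ × ℝ) (hp : p ∈ O₂) : fderiv ℝ v p (h p, 1) = 0 := by
    rw [hvd p (hO₂ hp).2.1]; exact hvd' _ (hO₂ hp).2.1
  have hdet (p : ℝ × ℝ) (hp : p ∈ O₂) : 1 - f p * h p ≠ 0 := by
    -- otherwise `Y` is a multiple of `X`
    intro h1
    have h2 : ((h p, 1) : ℝ × ℝ) = h p • ((1, f p) : ℝ × ℝ) := by
      ext
      · simp
      · simp; linarith
    have h3 := (hO₂ hp).2.2.2.1
    rw [h2, map_smul, hX p hp, smul_zero] at h3
    exact h3.false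
  have hdec (p : ℝ × ℝ) (hp : p ∈ O₂) (w : ℝ × ℝ) :
      ∃ a b : ℝ, w = a • ((1, f p) : ℝ × ℝ) + b • ((h p, 1) : ℝ × ℝ) := by
    have hc := inv_mul_cancel₀ (hdet p hp)
    refine ⟨(w.1 - h p * w.2) * (1 - f p * h p)⁻¹, (w.2 - f p * w.1) * (1 - f p * h p)⁻¹, ?_⟩
    ext
    · simp only [Prod.smul_mk, Prod.mk_add_mk, smul_eq_mul]
      linear_combination (-w.1) * hc
    · simp only [Prod.smul_mk, Prod.mk_add_mk, smul_eq_mul]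
      linear_combination (-w.2) * hc
  have hFdec (p : ℝ × ℝ) (hp : p ∈ O₂) (a b : ℝ) :
      fderiv ℝ F p (a • ((1, f p) : ℝ × ℝ) + b • ((h p, 1) : ℝ × ℝ)) =
        (a * fderiv ℝ v p (1, f p), b * fderiv ℝ u p (h p, 1)) := by
    rw [hFd p hp]
    simp only [map_add, map_smul, hX p hp, hY p hp, smul_eq_mul, mul_zero, zero_add, add_zero]
  obtain ⟨Φ, hΦ0, hΦO, hΦF, hΦ, hΦs⟩ := exists_openPartialHomeomorph_of_injective_fderiv hO₂o hF
    h0₂ fun p hp ↦ by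
      refine (injective_iff_map_eq_zero _).2 fun w hw ↦ ?_
      obtain ⟨a, b, rfl⟩ := hdec p hp w
      rw [hFdec p hp, Prod.ext_iff] at hw
      have ha : a = 0 := (mul_eq_zero.1 hw.1).resolve_right (hO₂ hp).2.2.2.2.ne'
      have hb : b = 0 := (mul_eq_zero.1 hw.2).resolve_right (hO₂ hp).2.2.2.1.ne'
      simp [ha, hb]
  have hΦF' : (Φ : ℝ × ℝ → ℝ × ℝ) = F := funext hΦF
  refine ⟨Φ, hΦ0, fun p hp ↦ hOO (hWO (hO₂ (hΦO hp)).1), hΦ, hΦs, fun w hw1 hw2 ↦ ?_,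
    fun p hp ↦ ?_⟩
  · have h1 := hFdec 0 h0₂ w.1 w.2
    have h2 := (hO₂ h0₂).2.2.2.2
    have h3 := (hO₂ h0₂).2.2.2.1
    have h4 : w.1 • ((1, f 0) : ℝ × ℝ) + w.2 • ((h 0, 1) : ℝ × ℝ) = w := by
      rw [hf00, hh00]; ext <;> simp
    rw [h4] at h1
    rw [hΦF', h1]
    exact ⟨mul_pos hw1 h2, mul_pos hw2 h3⟩
  · replace hp := hΦO hp
    have hpx := (hO₂ hp).2.2.2.2
    have hpy := (hO₂ hp).2.2.2.1
    have hG := (hO₂ hp).2.2.1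
    refine ⟨-Gxy p / (fderiv ℝ v p (1, f p) * fderiv ℝ u p (h p, 1)),
      div_pos (neg_pos.2 hG) (mul_pos hpx hpy), fun w w' ↦ ?_⟩
    obtain ⟨a, b, rfl⟩ := hdec p hp w
    obtain ⟨a', b', rfl⟩ := hdec p hp w'
    rw [hΦF', hFdec p hp, hFdec p hp]
    have e1 := hfe p (hWO (hO₂ hp).1)
    have e2 := hhe p (hWO (hO₂ hp).1)
    generalize fderiv ℝ v p (1, f p) = α at *
    generalize fderiv ℝ u p (h p, 1) = β at *
    simp only [Prod.smul_mk, Prod.mk_add_mk, smul_eq_mul, mul_one, Gxy]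
    field_simp
    linear_combination (a * a') * e1 + (b * b') * e2

end PlanarNullCoordinates

namespace Spacetime

/-! ### Smoothness of pairings -/

section Pairings

variable {n : ℕ} {M : Type*} [TopologicalSpace M]
  [ChartedSpace (EuclideanSpace ℝ (Fin n)) M] [IsManifold (𝓡 n) ∞ M]
  {EN HN N : Type*} [NormedAddCommGroup EN] [NormedSpace ℝ EN] [TopologicalSpace HN]
  {IN : ModelWithCorners ℝ EN HN} [TopologicalSpace N] [ChartedSpace HN N]
  {F : Type*} [NormedAddCommGroup F] [NormedSpace ℝ F]

theorem contMDiffAt_metric_apply (g : LorentzianMetric n M) {b : N → M}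
    {v w : ∀ m, TangentSpace (𝓡 n) (b m)} {m : N}
    (hv : ContMDiffAt IN (𝓡 n).tangent ∞ (fun m ↦ (⟨b m, v m⟩ : TangentBundle (𝓡 n) M)) m)
    (hw : ContMDiffAt IN (𝓡 n).tangent ∞ (fun m ↦ (⟨b m, w m⟩ : TangentBundle (𝓡 n) M)) m) :
    ContMDiffAt IN 𝓘(ℝ, ℝ) ∞ (fun m ↦ g.val (b m) (v m) (w m)) m := by
  have hb : ContMDiffAt IN (𝓡 n) ∞ b m := (contMDiffAt_totalSpace.1 hv).1
  have : ContMDiffAt IN ((𝓡 n).prod 𝓘(ℝ, ℝ)) ∞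
      (fun m ↦ TotalSpace.mk' ℝ (E := Bundle.Trivial M ℝ) (b m) (g.val (b m) (v m) (w m))) m := by
    apply ContMDiffAt.clm_bundle_apply₂ (F₁ := EuclideanSpace ℝ (Fin n))
      (F₂ := EuclideanSpace ℝ (Fin n))
    · exact ContMDiffAt.comp m g.contMDiff.contMDiffAt hb
    · exact hv
    · exact hw
  exact (contMDiffAt_totalSpace.1 this).2

theorem contMDiffAt_covector_apply {b : N → M} {φ : ∀ m, TangentSpace (𝓡 n) (b m) →L[ℝ] ℝ}
    {v : ∀ m, TangentSpace (𝓡 n) (b m)} {m : N}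
    (hφ : ContMDiffAt IN (cotangentModel n) ∞ (fun m ↦ (⟨b m, φ m⟩ : Cotangent n M)) m)
    (hv : ContMDiffAt IN (𝓡 n).tangent ∞ (fun m ↦ (⟨b m, v m⟩ : TangentBundle (𝓡 n) M)) m) :
    ContMDiffAt IN 𝓘(ℝ, ℝ) ∞ (fun m ↦ φ m (v m)) m := by
  have : ContMDiffAt IN ((𝓡 n).prod 𝓘(ℝ, ℝ)) ∞
      (fun m ↦ TotalSpace.mk' ℝ (E := Bundle.Trivial M ℝ) (b m) (φ m (v m))) m :=
    ContMDiffAt.clm_bundle_apply (F₁ := EuclideanSpace ℝ (Fin n)) hφ hv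
  exact (contMDiffAt_totalSpace.1 this).2

theorem contMDiffAt_mfderiv_apply {f : M → F} {b : N → M}
    {v : ∀ m, TangentSpace (𝓡 n) (b m)} {m : N}
    (hf : ContMDiffAt (𝓡 n) 𝓘(ℝ, F) ∞ f (b m))
    (hv : ContMDiffAt IN (𝓡 n).tangent ∞ (fun m ↦ (⟨b m, v m⟩ : TangentBundle (𝓡 n) M)) m) :
    ContMDiffAt IN 𝓘(ℝ, F) ∞ (fun m ↦ (mfderiv (𝓡 n) 𝓘(ℝ, F) f (b m) (v m) : F)) m := by
  have hb : ContMDiffAt IN (𝓡 n) ∞ b m := (contMDiffAt_totalSpace.1 hv).1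
  have h1 := (hf.mfderiv_const (m := ∞) (by simp)).comp m hb
  have h2 := ContMDiffAt.clm_apply_of_inCoordinates (E₂ := TangentSpace 𝓘(ℝ, F) (M := F))
    (b₂ := f ∘ b) (ϕ := fun m ↦ mfderiv (𝓡 n) 𝓘(ℝ, F) f (b m)) h1 hv (hf.comp m hb)
  exact (contMDiff_snd_tangentBundle_modelSpace F 𝓘(ℝ, F)).contMDiffAt.comp m h2

theorem contMDiffAt_mfderiv_const_vector {f : F → M} {x : F}
    (hf : ContMDiffAt 𝓘(ℝ, F) (𝓡 n) ∞ f x) (w : F) :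
    ContMDiffAt 𝓘(ℝ, F) (𝓡 n).tangent ∞
      (fun x ↦ (⟨f x, mfderiv 𝓘(ℝ, F) (𝓡 n) f x w⟩ : TangentBundle (𝓡 n) M)) x := by
  have h1 := hf.mfderiv_const (m := ∞) (by simp)
  have h2 : ContMDiffAt 𝓘(ℝ, F) 𝓘(ℝ, F).tangent ∞
      (fun y ↦ (⟨y, w⟩ : TangentBundle 𝓘(ℝ, F) F)) x :=
    contMDiffAt_vectorSpace_iff_contDiffAt.2 contDiffAt_const
  exact ContMDiffAt.clm_apply_of_inCoordinates (E₁ := TangentSpace 𝓘(ℝ, F) (M := F))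
    (b₁ := id) (b₂ := f) (ϕ := fun m ↦ mfderiv 𝓘(ℝ, F) (𝓡 n) f m) (v := fun _ ↦ w) h1 h2 hf

theorem contMDiffAt_differential {f : M → ℝ} {x : M}
    (hf : ContMDiffAt (𝓡 n) 𝓘(ℝ, ℝ) ∞ f x) :
    ContMDiffAt (𝓡 n) (cotangentModel n) ∞
      (fun x ↦ (⟨x, mfderiv (𝓡 n) 𝓘(ℝ, ℝ) f x⟩ : Cotangent n M)) x := by
  refine (contMDiffAt_hom_bundle (E₂ := Bundle.Trivial M ℝ) _).2 ⟨contMDiffAt_id, ?_⟩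
  have h1 := hf.mfderiv_const (m := ∞) (by simp)
  convert! h1 using 2 with y
  ext v
  simp [inTangentCoordinates, ContinuousLinearMap.inCoordinates]
  rfl

end Pairings

end Spacetime

namespace Spacetime

/-! ### Null boxes -/

section NullBoxes

variable {M : Type*} [TopologicalSpace M]
  [ChartedSpace (EuclideanSpace ℝ (Fin 2)) M] [IsManifold (𝓡 2) ∞ M]
  {g : LorentzianMetric 2 M} {T : TimeOrientation g}

/-- The condition that the components `u`, `v` of `f = (u, v)` are null coordinates at `x`, i.e.
`g = -k (du dv + dv du)` with `k > 0`, and that they increase in the direction of time. -/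
def IsNullCoordinateAt (T : TimeOrientation g) (f : M → ℝ × ℝ) (x : M) : Prop :=
  (∃ k > 0, ∀ v w : TangentSpace (𝓡 2) x, g.val x v w =
    -k * ((mfderiv (𝓡 2) 𝓘(ℝ, ℝ × ℝ) f x v : ℝ × ℝ).1 *
        (mfderiv (𝓡 2) 𝓘(ℝ, ℝ × ℝ) f x w : ℝ × ℝ).2 +
      (mfderiv (𝓡 2) 𝓘(ℝ, ℝ × ℝ) f x v : ℝ × ℝ).2 *
        (mfderiv (𝓡 2) 𝓘(ℝ, ℝ × ℝ) f x w : ℝ × ℝ).1)) ∧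
  0 < (mfderiv (𝓡 2) 𝓘(ℝ, ℝ × ℝ) f x (T.field x) : ℝ × ℝ).1 ∧
  0 < (mfderiv (𝓡 2) 𝓘(ℝ, ℝ × ℝ) f x (T.field x) : ℝ × ℝ).2

/-- A null box: smooth null coordinates on an open set that they map onto a square. -/
structure NullBox (T : TimeOrientation g) where
  /-- The pair `(u, v)` of null coordinates. -/
  chart : OpenPartialHomeomorph M (ℝ × ℝ)
  square : ∃ p r, chart.target = Metric.ball p r
  contMDiffOn : ContMDiffOn (𝓡 2) 𝓘(ℝ, ℝ × ℝ) ∞ chart chart.source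
  contMDiffOn_symm : ContMDiffOn 𝓘(ℝ, ℝ × ℝ) (𝓡 2) ∞ chart.symm chart.target
  null : ∀ x ∈ chart.source, IsNullCoordinateAt T chart x

/-- Null coordinates restrict to arbitrarily small null boxes. -/
theorem exists_nullBox_of_chart (e : OpenPartialHomeomorph M (ℝ × ℝ))
    (he : ContMDiffOn (𝓡 2) 𝓘(ℝ, ℝ × ℝ) ∞ e e.source)
    (hes : ContMDiffOn 𝓘(ℝ, ℝ × ℝ) (𝓡 2) ∞ e.symm e.target)
    {x : M} (hx : x ∈ e.source) {O : Set M} (hO : O ∈ 𝓝 x)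
    (hnull : ∀ y ∈ O, y ∈ e.source → IsNullCoordinateAt T e y) :
    ∃ B : NullBox T, (∀ y, B.chart y = e y) ∧ x ∈ B.chart.source ∧ B.chart.source ⊆ O ∧
      B.chart.source ⊆ e.source := by
  have h1 : e.target ∩ e.symm ⁻¹' O ∈ 𝓝 (e x) :=
    inter_mem (e.open_target.mem_nhds (e.map_source hx))
      ((e.continuousAt_symm (e.map_source hx)).preimage_mem_nhds (by rwa [e.left_inv hx]))
  obtain ⟨r, hr, hrs⟩ := Metric.mem_nhds_iff.1 h1
  let e' := (e.symm.restrOpen (Metric.ball (e x) r) Metric.isOpen_ball).symm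
  have hsrc : ∀ y, y ∈ e'.source ↔ y ∈ e.source ∧ e y ∈ Metric.ball (e x) r := fun y ↦ by
    simp [e', OpenPartialHomeomorph.restrOpen]
  have hsub : e'.source ⊆ e.source := fun y hy ↦ ((hsrc y).1 hy).1
  have hsubO : e'.source ⊆ O := fun y hy ↦ by
    have := (hrs ((hsrc y).1 hy).2).2
    rwa [mem_preimage, e.left_inv (hsub hy)] at this
  have htgt : e'.target = Metric.ball (e x) r := by
    change e.symm.source ∩ Metric.ball (e x) r = _
    exact inter_eq_right.2 fun y hy ↦ (hrs hy).1
  exact ⟨⟨e', ⟨_, _, htgt⟩, he.mono hsub, hes.mono fun y hy ↦ (hrs (htgt ▸ hy)).1,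
    fun y hy ↦ hnull y (hsubO hy) (hsub hy)⟩, fun y ↦ rfl,
    (hsrc x).2 ⟨hx, Metric.mem_ball_self hr⟩, hsubO, hsub⟩

/-- Each tangent plane is spanned by two future pointing null vectors. -/
theorem exists_null_basis (T : TimeOrientation g) (x : M) :
    ∃ a b : TangentSpace (𝓡 2) x, g.val x a a = 0 ∧ g.val x b b = 0 ∧ g.val x a b < 0 ∧
      ∃ s t : ℝ, 0 < s ∧ 0 < t ∧ T.field x = s • a + t • b := by
  have hfin : FiniteDimensional ℝ (TangentSpace (𝓡 2) x) :=
    inferInstanceAs (FiniteDimensional ℝ (EuclideanSpace ℝ (Fin 2)))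
  have h4 : Module.finrank ℝ (TangentSpace (𝓡 2) x) = 2 := finrank_euclideanSpace_fin
  obtain ⟨v, hv, hpos⟩ := g.lorentzian x
  obtain ⟨w, hw, hw0⟩ : ∃ w : TangentSpace (𝓡 2) x, g.val x v w = 0 ∧ w ≠ 0 := by
    have h1 : ∃ w ∈ LinearMap.ker (g.val x v).toLinearMap, w ≠ 0 := by
      refine Submodule.exists_mem_ne_zero_of_ne_bot fun h ↦ ?_
      have h2 := LinearMap.finrank_range_add_finrank_ker (g.val x v).toLinearMap
      have h3 := (LinearMap.range (g.val x v).toLinearMap).finrank_le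
      rw [h, finrank_bot] at h2
      rw [h4] at h2
      rw [Module.finrank_self] at h3
      omega
    obtain ⟨w, hw, hw0⟩ := h1
    exact ⟨w, hw, hw0⟩
  have hww := hpos w hw hw0
  have hwv : g.val x w v = 0 := by rw [g.symm, hw]
  have hli : LinearIndependent ℝ ![v, w] := by
    refine LinearIndependent.pair_iff.2 fun s t h ↦ ?_
    have e1 := congrArg (g.val x v) h
    have e2 := congrArg (g.val x w) h
    simp only [map_add, map_smul, hw, hwv, smul_eq_mul, mul_zero, add_zero, zero_add,
      map_zero, mul_eq_zero] at e1 e2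
    exact ⟨e1.resolve_right hv.ne, e2.resolve_right hww.ne'⟩
  have hspan : ∀ z : TangentSpace (𝓡 2) x, ∃ p q : ℝ, p • v + q • w = z := fun z ↦ by
    have := hli.span_eq_top_of_card_eq_finrank' (by simp [h4])
    refine Submodule.mem_span_pair.1 ?_
    rw [Matrix.range_cons, Matrix.range_cons, Matrix.range_empty, union_empty,
      singleton_union] at this
    rw [this]
    trivial
  obtain ⟨p, q, hpq⟩ := hspan (T.field x)
  obtain ⟨α, hα, hα2⟩ : ∃ α : ℝ, 0 < α ∧ α * α = g.val x w w :=
    ⟨√(g.val x w w), Real.sqrt_pos.2 hww, Real.mul_self_sqrt hww.le⟩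
  obtain ⟨β, hβ, hβ2⟩ : ∃ β : ℝ, 0 < β ∧ β * β = -g.val x v v :=
    ⟨√(-g.val x v v), Real.sqrt_pos.2 (by linarith), Real.mul_self_sqrt (by linarith)⟩
  have key (c d c' d' : ℝ) : g.val x (c • v + d • w) (c' • v + d' • w) =
      d * d' * (α * α) - c * c' * (β * β) := by
    simp only [map_add, map_smul, add_apply, smul_apply,
      smul_eq_mul, hw, hwv, hα2, hβ2]
    ring
  have hT : 0 < (p / α + q / β) * (p / α - q / β) := by
    have h1 := T.timelike x
    rw [← hpq, key] at h1
    have h2 : (p / α + q / β) * (p / α - q / β) =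
        -(q * q * (α * α) - p * p * (β * β)) / ((α * α) * (β * β)) := by
      field_simp; ring
    rw [h2]
    exact div_pos (by linarith) (by positivity)
  have hab : β * (-β) * (α * α) - α * α * (β * β) < 0 := by nlinarith [mul_pos hα hβ]
  -- `ε = ± 1` makes the null vectors future pointing
  obtain ⟨ε, hε, hs, ht⟩ : ∃ ε : ℝ, ε * ε = 1 ∧ 0 < ε * (p / α + q / β) ∧
      0 < ε * (p / α - q / β) := by
    rcases pos_and_pos_or_neg_and_neg_of_mul_pos hT with h | h
    · exact ⟨1, by norm_num, by linarith [h.1], by linarith [h.2]⟩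
    · exact ⟨-1, by norm_num, by linarith [h.1], by linarith [h.2]⟩
  refine ⟨(ε * α) • v + (ε * β) • w, (ε * α) • v + (-(ε * β)) • w, ?_, ?_, ?_,
    ε * (p / α + q / β) / 2, ε * (p / α - q / β) / 2, by positivity, by positivity, ?_⟩
  · rw [key]; ring
  · rw [key]; ring
  · rw [key]
    linear_combination hab + (-2 * (α * α) * (β * β)) * hε
  · rw [← hpq]
    simp only [smul_add, smul_smul]
    have e1 : p = ε * (p / α + q / β) / 2 * (ε * α) + ε * (p / α - q / β) / 2 * (ε * α) := by
      have : ε * (p / α + q / β) / 2 * (ε * α) + ε * (p / α - q / β) / 2 * (ε * α) =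
        (ε * ε) * p := by field_simp; ring
      rw [this, hε, one_mul]
    have e2 : q = ε * (p / α + q / β) / 2 * (ε * β) + ε * (p / α - q / β) / 2 * (-(ε * β)) := by
      have : ε * (p / α + q / β) / 2 * (ε * β) + ε * (p / α - q / β) / 2 * (-(ε * β)) =
        (ε * ε) * q := by field_simp; ring
      rw [this, hε, one_mul]
    conv_lhs => rw [e1, e2]
    module

section Inverse

variable {F : Type*} [NormedAddCommGroup F] [NormedSpace ℝ F] {e : OpenPartialHomeomorph M F}

theorem mfderiv_symm_mfderiv (he : ContMDiffOn (𝓡 2) 𝓘(ℝ, F) ∞ e e.source)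
    (hes : ContMDiffOn 𝓘(ℝ, F) (𝓡 2) ∞ e.symm e.target) {p : F} (hp : p ∈ e.target)
    (v : TangentSpace (𝓡 2) (e.symm p)) :
    mfderiv 𝓘(ℝ, F) (𝓡 2) e.symm p (mfderiv (𝓡 2) 𝓘(ℝ, F) e (e.symm p) v) = v := by
  have hp' := e.map_target hp
  have h1 := ((he.contMDiffAt (e.open_source.mem_nhds hp')).mdifferentiableAt
    (by simp)).hasMFDerivAt
  have h2 := ((hes.contMDiffAt (e.open_target.mem_nhds hp)).mdifferentiableAt
    (by simp)).hasMFDerivAt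
  rw [← e.right_inv hp] at h2
  have h3 := h2.comp _ h1
  have h4 : HasMFDerivAt (𝓡 2) (𝓡 2) (e.symm ∘ e) (e.symm p)
      (ContinuousLinearMap.id ℝ (TangentSpace (𝓡 2) (e.symm p))) := by
    refine (hasMFDerivAt_id _).congr_of_eventuallyEq ?_
    filter_upwards [e.open_source.mem_nhds hp'] with y hy using e.left_inv hy
  have h5 := congrArg (fun L ↦ L v) (hasMFDerivAt_unique h3 h4)
  rw [e.right_inv hp] at h5
  exact h5

theorem mfderiv_mfderiv_symm (he : ContMDiffOn (𝓡 2) 𝓘(ℝ, F) ∞ e e.source)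
    (hes : ContMDiffOn 𝓘(ℝ, F) (𝓡 2) ∞ e.symm e.target) {p : F} (hp : p ∈ e.target) (w : F) :
    mfderiv (𝓡 2) 𝓘(ℝ, F) e (e.symm p) (mfderiv 𝓘(ℝ, F) (𝓡 2) e.symm p w) = w := by
  have hp' := e.map_target hp
  have h1 := ((he.contMDiffAt (e.open_source.mem_nhds hp')).mdifferentiableAt
    (by simp)).hasMFDerivAt
  have h2 := ((hes.contMDiffAt (e.open_target.mem_nhds hp)).mdifferentiableAt
    (by simp)).hasMFDerivAt
  have h3 := h1.comp _ h2
  have h4 : HasMFDerivAt 𝓘(ℝ, F) 𝓘(ℝ, F) (e ∘ e.symm) p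
      (ContinuousLinearMap.id ℝ (TangentSpace 𝓘(ℝ, F) p)) := by
    refine (hasMFDerivAt_id _).congr_of_eventuallyEq ?_
    filter_upwards [e.open_target.mem_nhds hp] with y hy using e.right_inv hy
  exact congrArg (fun L ↦ L w) (hasMFDerivAt_unique h3 h4)

end Inverse

/-- A chart at `x`, composed with a linear map such that its coordinate axes are null at `x`. -/
theorem exists_linear_chart (T : TimeOrientation g) (x : M) :
    ∃ κ : OpenPartialHomeomorph M (ℝ × ℝ), x ∈ κ.source ∧ κ x = 0 ∧
      ContMDiffOn (𝓡 2) 𝓘(ℝ, ℝ × ℝ) ∞ κ κ.source ∧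
      ContMDiffOn 𝓘(ℝ, ℝ × ℝ) (𝓡 2) ∞ κ.symm κ.target ∧
      ∃ a b : TangentSpace (𝓡 2) x, g.val x a a = 0 ∧ g.val x b b = 0 ∧ g.val x a b < 0 ∧
        (mfderiv (𝓡 2) 𝓘(ℝ, ℝ × ℝ) κ x a : ℝ × ℝ) = (1, 0) ∧
        (mfderiv (𝓡 2) 𝓘(ℝ, ℝ × ℝ) κ x b : ℝ × ℝ) = (0, 1) ∧
        ∃ s t : ℝ, 0 < s ∧ 0 < t ∧ T.field x = s • a + t • b := by
  obtain ⟨a, b, haa, hbb, hab, hT⟩ := exists_null_basis T x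
  let c := chartAt (EuclideanSpace ℝ (Fin 2)) x
  have hx : x ∈ c.source := mem_chart_source _ x
  have hc : ContMDiffOn (𝓡 2) (𝓡 2) ∞ c c.source := contMDiffOn_chart
  have hcs : ContMDiffOn (𝓡 2) (𝓡 2) ∞ c.symm c.target := contMDiffOn_chart_symm
  let D := mfderiv (𝓡 2) (𝓡 2) c x
  let a' : EuclideanSpace ℝ (Fin 2) := D a
  let b' : EuclideanSpace ℝ (Fin 2) := D b
  have hDinj : Function.Injective D := by
    have h1 (v : TangentSpace (𝓡 2) (c.symm (c x))) := mfderiv_symm_mfderiv hc hcs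
      (c.map_source hx) v
    rw [c.left_inv hx] at h1
    exact Function.LeftInverse.injective h1
  let L : (ℝ × ℝ) →ₗ[ℝ] EuclideanSpace ℝ (Fin 2) :=
    (LinearMap.toSpanSingleton ℝ _ a').coprod (LinearMap.toSpanSingleton ℝ _ b')
  have hL (s t : ℝ) : L (s, t) = D (s • a + t • b) := by
    rw [map_add, map_smul, map_smul]; rfl
  have hLinj : Function.Injective L := by
    refine (injective_iff_map_eq_zero _).2 fun ⟨s, t⟩ h ↦ ?_
    rw [hL] at h
    have h1 : s • a + t • b = 0 := hDinj (h.trans (map_zero D).symm)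
    have e1 := congrArg (g.val x a) h1
    have e2 := congrArg (g.val x b) h1
    simp only [map_add, map_smul, haa, hbb, g.symm x b a, smul_eq_mul, mul_zero, add_zero,
      zero_add, map_zero, mul_eq_zero] at e1 e2
    exact Prod.ext (e2.resolve_right hab.ne) (e1.resolve_right hab.ne)
  let e : (ℝ × ℝ) ≃L[ℝ] EuclideanSpace ℝ (Fin 2) :=
    (L.linearEquivOfInjective hLinj (by simp)).toContinuousLinearEquiv
  have he (s t : ℝ) : e (s, t) = D (s • a + t • b) := hL s t
  let A : EuclideanSpace ℝ (Fin 2) ≃ₜ ℝ × ℝ :=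
    (Homeomorph.addRight (-c x)).trans e.symm.toHomeomorph
  have hA : ContDiff ℝ ∞ A := e.symm.contDiff.comp (contDiff_id.add contDiff_const)
  have hAs : ContDiff ℝ ∞ A.symm := by
    have : (A.symm : ℝ × ℝ → _) = fun p ↦ e p + c x :=
      funext fun p ↦ A.toEquiv.symm_apply_eq.2 (by simp [A])
    rw [this]
    exact e.contDiff.add contDiff_const
  have hAd (y w : EuclideanSpace ℝ (Fin 2)) : fderiv ℝ A y w = e.symm w := by
    have : HasFDerivAt A (e.symm : _ →L[ℝ] ℝ × ℝ) y := by
      have := (e.symm : _ →L[ℝ] ℝ × ℝ).hasFDerivAt.comp y ((hasFDerivAt_id y).add_const (-c x))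
      exact this
    rw [this.fderiv]; rfl
  have hκd (w : TangentSpace (𝓡 2) x) :
      (mfderiv (𝓡 2) 𝓘(ℝ, ℝ × ℝ) (A ∘ c) x w : ℝ × ℝ) = e.symm (D w) := by
    have h1 := ((hc.contMDiffAt (c.open_source.mem_nhds hx)).mdifferentiableAt
      (by simp)).hasMFDerivAt
    have h2 := (hA.differentiable (by simp) (c x)).hasFDerivAt.hasMFDerivAt
    rw [(h2.comp x h1).mfderiv]
    exact hAd _ _
  refine ⟨c.transHomeomorph A, hx, ?_, ?_, ?_, a, b, haa, hbb, hab, ?_, ?_, hT⟩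
  · change A (c x) = 0
    simp [A]
  · exact hA.contMDiff.comp_contMDiffOn hc
  · exact hcs.comp hAs.contMDiff.contMDiffOn fun p hp ↦ hp
  · refine (hκd a).trans (e.symm_apply_eq.2 (?_ : a' = e (1, 0)))
    rw [he, one_smul, zero_smul, add_zero]
  · refine (hκd b).trans (e.symm_apply_eq.2 (?_ : b' = e (0, 1)))
    rw [he, one_smul, zero_smul, zero_add]

/-- Around each point there are arbitrarily small null boxes. -/
theorem exists_nullBox (T : TimeOrientation g) (x : M) {O : Set M} (hO : O ∈ 𝓝 x) :
    ∃ B : NullBox T, x ∈ B.chart.source ∧ B.chart.source ⊆ O := by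
  obtain ⟨κ, hx, hκ0, hκ, hκs, a, b, haa, hbb, hab, hDa, hDb, s, t, hs, ht, hT⟩ :=
    exists_linear_chart T x
  -- `G` is the metric in the coordinates `κ`, and `S w` are the coordinate vector fields
  let S (w : ℝ × ℝ) (p : ℝ × ℝ) : TangentSpace (𝓡 2) (κ.symm p) :=
    mfderiv 𝓘(ℝ, ℝ × ℝ) (𝓡 2) κ.symm p w
  let G (w w' : ℝ × ℝ) (p : ℝ × ℝ) : ℝ := g.val (κ.symm p) (S w p) (S w' p)
  have hG (w w' : ℝ × ℝ) : ContDiffOn ℝ ∞ (G w w') κ.target := fun p hp ↦ by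
    have h1 := hκs.contMDiffAt (κ.open_target.mem_nhds hp)
    exact (contMDiffAt_metric_apply g (contMDiffAt_mfderiv_const_vector h1 w)
      (contMDiffAt_mfderiv_const_vector h1 w')).contDiffAt.contDiffWithinAt
  have hGeq (p : ℝ × ℝ) (hp : p ∈ κ.target) (v v' : TangentSpace (𝓡 2) (κ.symm p)) :
      g.val (κ.symm p) v v' = G (mfderiv (𝓡 2) 𝓘(ℝ, ℝ × ℝ) κ (κ.symm p) v)
        (mfderiv (𝓡 2) 𝓘(ℝ, ℝ × ℝ) κ (κ.symm p) v') p := by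
    simp only [G, S, mfderiv_symm_mfderiv hκ hκs hp]
  have hGlin (w w' : ℝ × ℝ) (p : ℝ × ℝ) : G w w' p = G (1, 0) (1, 0) p * (w.1 * w'.1) +
      G (1, 0) (0, 1) p * (w.1 * w'.2 + w.2 * w'.1) + G (0, 1) (0, 1) p * (w.2 * w'.2) := by
    have h1 (w : ℝ × ℝ) : S w p = w.1 • S (1, 0) p + w.2 • S (0, 1) p := by
      have : w = w.1 • ((1 : ℝ), (0 : ℝ)) + w.2 • ((0 : ℝ), (1 : ℝ)) := by ext <;> simp
      conv_lhs => rw [this]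
      exact (map_add (mfderiv 𝓘(ℝ, ℝ × ℝ) (𝓡 2) κ.symm p) _ _).trans
        (congrArg₂ _ (map_smul _ _ _) (map_smul _ _ _))
    simp only [G, h1 w, h1 w', map_add, map_smul, add_apply, smul_apply, smul_eq_mul,
      g.symm _ (S (0, 1) p) (S (1, 0) p)]
    ring
  have h0t : (0 : ℝ × ℝ) ∈ κ.target := hκ0 ▸ κ.map_source hx
  have hsx : κ.symm 0 = x := by rw [← hκ0, κ.left_inv hx]
  have hG0 (v v' : TangentSpace (𝓡 2) x) : g.val x v v' =
      G (mfderiv (𝓡 2) 𝓘(ℝ, ℝ × ℝ) κ x v) (mfderiv (𝓡 2) 𝓘(ℝ, ℝ × ℝ) κ x v') 0 := by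
    have := hGeq 0 h0t
    rw [hsx] at this
    exact this v v'
  rw [hG0, hDa] at haa
  rw [hG0, hDb] at hbb
  rw [hG0, hDa, hDb] at hab
  obtain ⟨Φ, h0Φ, hΦt, hΦ, hΦs, hΦT, hΦG⟩ := exists_planar_null_coordinates κ.open_target h0t
    (hG (1, 0) (1, 0)) (hG (1, 0) (0, 1)) (hG (0, 1) (0, 1)) haa hbb hab
  let e := κ.trans Φ
  have hes : e.source ⊆ κ.source := fun y hy ↦ by
    rw [OpenPartialHomeomorph.trans_source] at hy; exact hy.1
  have hesΦ : ∀ y ∈ e.source, κ y ∈ Φ.source := fun y hy ↦ by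
    rw [OpenPartialHomeomorph.trans_source] at hy; exact hy.2
  have hxe : x ∈ e.source := by
    rw [OpenPartialHomeomorph.trans_source]
    exact ⟨hx, by rwa [mem_preimage, hκ0]⟩
  have he : ContMDiffOn (𝓡 2) 𝓘(ℝ, ℝ × ℝ) ∞ e e.source :=
    hΦ.contMDiffOn.comp (hκ.mono hes) hesΦ
  have hesm : ContMDiffOn 𝓘(ℝ, ℝ × ℝ) (𝓡 2) ∞ e.symm e.target := by
    rw [OpenPartialHomeomorph.coe_trans_symm, OpenPartialHomeomorph.trans_target]
    exact hκs.comp (hΦs.contMDiffOn.mono inter_subset_left) fun p hp ↦ hp.2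
  have hed (y : M) (hy : y ∈ e.source) (v : TangentSpace (𝓡 2) y) :
      (mfderiv (𝓡 2) 𝓘(ℝ, ℝ × ℝ) e y v : ℝ × ℝ) =
        fderiv ℝ Φ (κ y) (mfderiv (𝓡 2) 𝓘(ℝ, ℝ × ℝ) κ y v) := by
    have h1 := ((hκ.contMDiffAt (κ.open_source.mem_nhds (hes hy))).mdifferentiableAt
      (by simp)).hasMFDerivAt
    have h2 := ((hΦ.contDiffAt (Φ.open_source.mem_nhds (hesΦ y hy))).differentiableAt
      (by simp)).hasFDerivAt.hasMFDerivAt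
    have h3 : mfderiv (𝓡 2) 𝓘(ℝ, ℝ × ℝ) (Φ ∘ κ) y = _ := (h2.comp y h1).mfderiv
    exact congrArg (fun L ↦ L v) h3
  have hTc : ContinuousAt (fun y ↦ (mfderiv (𝓡 2) 𝓘(ℝ, ℝ × ℝ) e y (T.field y) : ℝ × ℝ)) x :=
    (contMDiffAt_mfderiv_apply (b := id) (he.contMDiffAt (e.open_source.mem_nhds hxe))
      T.contMDiff.contMDiffAt).continuousAt
  have hT0 : 0 < (mfderiv (𝓡 2) 𝓘(ℝ, ℝ × ℝ) e x (T.field x) : ℝ × ℝ).1 ∧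
      0 < (mfderiv (𝓡 2) 𝓘(ℝ, ℝ × ℝ) e x (T.field x) : ℝ × ℝ).2 := by
    have h1 : (mfderiv (𝓡 2) 𝓘(ℝ, ℝ × ℝ) κ x (T.field x) : ℝ × ℝ) = (s, t) := by
      rw [hT, map_add, map_smul, map_smul]
      exact (congrArg₂ (fun p q : ℝ × ℝ ↦ s • p + t • q) hDa hDb).trans (by simp)
    rw [hed x hxe, h1, hκ0]
    exact hΦT _ hs ht
  have hev := (hTc.fst.eventually (lt_mem_nhds hT0.1)).and
    (hTc.snd.eventually (lt_mem_nhds hT0.2))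
  have hmet : ∀ y ∈ e.source, ∃ k > 0, ∀ v w : TangentSpace (𝓡 2) y, g.val y v w =
      -k * ((mfderiv (𝓡 2) 𝓘(ℝ, ℝ × ℝ) e y v : ℝ × ℝ).1 *
          (mfderiv (𝓡 2) 𝓘(ℝ, ℝ × ℝ) e y w : ℝ × ℝ).2 +
        (mfderiv (𝓡 2) 𝓘(ℝ, ℝ × ℝ) e y v : ℝ × ℝ).2 *
          (mfderiv (𝓡 2) 𝓘(ℝ, ℝ × ℝ) e y w : ℝ × ℝ).1) := fun y hye ↦ by
    obtain ⟨k, hk, hk'⟩ := hΦG (κ y) (hesΦ y hye)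
    refine ⟨k, hk, fun v w ↦ ?_⟩
    have h1 := hGeq (κ y) (κ.map_source (hes hye))
    rw [κ.left_inv (hes hye)] at h1
    rw [hed y hye, hed y hye]
    exact (h1 v w).trans ((hGlin _ _ _).trans (hk' _ _))
  obtain ⟨B, -, hxB, hBO, -⟩ := exists_nullBox_of_chart (T := T) e he
    hesm hxe (inter_mem hO hev) fun y hy hye ↦ ⟨hmet y hye, hy.2⟩
  exact ⟨B, hxB, hBO.trans inter_subset_left⟩

end NullBoxes

end Spacetime

/-! ### Pairs of transverse foliations of a surface -/

/-- The topological structure that the two null foliations of an oriented Lorentzian surface carry: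
a collection of boxes, i.e. homeomorphisms `(u, v)` of open sets onto open squares, for any two of
which the first components define the same preorder near each common point, and likewise the second
components. The leaves of the first foliation are locally given by `u = const`, and `v` orders each
of these leaves. -/
structure NullAtlas (M : Type*) [TopologicalSpace M] where
  /-- The boxes. -/
  boxes : Set (OpenPartialHomeomorph M (ℝ × ℝ))
  square : ∀ B ∈ boxes, ∃ p r, B.target = Metric.ball p r
  exists_mem : ∀ x, ∃ B ∈ boxes, x ∈ B.source
  exists_restrict : ∀ B ∈ boxes, ∀ x ∈ B.source, ∀ O ∈ 𝓝 x, ∃ B' ∈ boxes,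
    x ∈ B'.source ∧ B'.source ⊆ O ∧ B'.source ⊆ B.source ∧ ∀ y, B' y = B y
  compat_fst : ∀ B ∈ boxes, ∀ B' ∈ boxes, ∀ x ∈ B.source, x ∈ B'.source →
    ∃ W ∈ 𝓝 x, ∀ y ∈ W, ∀ z ∈ W, ((B y).1 ≤ (B z).1 ↔ (B' y).1 ≤ (B' z).1)
  compat_snd : ∀ B ∈ boxes, ∀ B' ∈ boxes, ∀ x ∈ B.source, x ∈ B'.source →
    ∃ W ∈ 𝓝 x, ∀ y ∈ W, ∀ z ∈ W, ((B y).2 ≤ (B z).2 ↔ (B' y).2 ≤ (B' z).2)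

namespace NullAtlas

variable {M : Type*} [TopologicalSpace M] (A : NullAtlas M)
  {B B' : OpenPartialHomeomorph M (ℝ × ℝ)} {x y z : M}

/-- The atlas in which the two foliations are interchanged. -/
def swap : NullAtlas M where
  boxes := (fun B ↦ B.transHomeomorph (Homeomorph.prodComm ℝ ℝ)) '' A.boxes
  square := by
    rintro _ ⟨B, hB, rfl⟩
    obtain ⟨p, r, h⟩ := A.square B hB
    refine ⟨p.swap, r, ?_⟩
    ext q
    change q.swap ∈ B.target ↔ _
    rw [h, ← ball_prod_same, ← ball_prod_same]
    exact and_comm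
  exists_mem x := by
    obtain ⟨B, hB, hx⟩ := A.exists_mem x
    exact ⟨_, mem_image_of_mem _ hB, hx⟩
  exists_restrict := by
    rintro _ ⟨B, hB, rfl⟩ x hx O hO
    obtain ⟨B', hB', h1, h2, h3, h4⟩ := A.exists_restrict B hB x hx O hO
    exact ⟨_, mem_image_of_mem _ hB', h1, h2, h3, fun y ↦ congrArg Prod.swap (h4 y)⟩
  compat_fst := by
    rintro _ ⟨B, hB, rfl⟩ _ ⟨B', hB', rfl⟩
    exact A.compat_snd B hB B' hB'
  compat_snd := by
    rintro _ ⟨B, hB, rfl⟩ _ ⟨B', hB', rfl⟩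
    exact A.compat_fst B hB B' hB'

/-- The atlas in which the orders of both foliations are reversed. -/
def neg : NullAtlas M where
  boxes := (fun B ↦ B.transHomeomorph (Homeomorph.neg (ℝ × ℝ))) '' A.boxes
  square := by
    rintro _ ⟨B, hB, rfl⟩
    obtain ⟨p, r, h⟩ := A.square B hB
    refine ⟨-p, r, ?_⟩
    ext q
    change -q ∈ B.target ↔ _
    rw [h, Metric.mem_ball, Metric.mem_ball, ← dist_neg_neg, neg_neg]
  exists_mem x := by
    obtain ⟨B, hB, hx⟩ := A.exists_mem x
    exact ⟨_, mem_image_of_mem _ hB, hx⟩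
  exists_restrict := by
    rintro _ ⟨B, hB, rfl⟩ x hx O hO
    obtain ⟨B', hB', h1, h2, h3, h4⟩ := A.exists_restrict B hB x hx O hO
    exact ⟨_, mem_image_of_mem _ hB', h1, h2, h3, fun y ↦ congrArg Neg.neg (h4 y)⟩
  compat_fst := by
    rintro _ ⟨B, hB, rfl⟩ _ ⟨B', hB', rfl⟩ x hx hx'
    obtain ⟨W, hW, h⟩ := A.compat_fst B hB B' hB' x hx hx'
    exact ⟨W, hW, fun y hy z hz ↦ neg_le_neg_iff.trans ((h z hz y hy).trans neg_le_neg_iff.symm)⟩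
  compat_snd := by
    rintro _ ⟨B, hB, rfl⟩ _ ⟨B', hB', rfl⟩ x hx hx'
    obtain ⟨W, hW, h⟩ := A.compat_snd B hB B' hB' x hx hx'
    exact ⟨W, hW, fun y hy z hz ↦ neg_le_neg_iff.trans ((h z hz y hy).trans neg_le_neg_iff.symm)⟩

variable {A}

theorem target_eq (hB : B ∈ A.boxes) : ∃ a b c d : ℝ, B.target = Ioo a b ×ˢ Ioo c d := by
  obtain ⟨p, r, h⟩ := A.square B hB
  refine ⟨p.1 - r, p.1 + r, p.2 - r, p.2 + r, ?_⟩
  rw [h, ← ball_prod_same, Real.ball_eq_Ioo, Real.ball_eq_Ioo]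

theorem mk_mem_target (hB : B ∈ A.boxes) {p q : ℝ × ℝ} (hp : p ∈ B.target) (hq : q ∈ B.target) :
    (p.1, q.2) ∈ B.target := by
  obtain ⟨a, b, c, d, h⟩ := target_eq hB
  rw [h] at hp hq ⊢
  exact ⟨hp.1, hq.2⟩

theorem ordConnected_target (hB : B ∈ A.boxes) : B.target.OrdConnected := by
  obtain ⟨a, b, c, d, h⟩ := target_eq hB
  rw [h]
  exact ⟨fun p hp q hq w hw ↦ ⟨⟨hp.1.1.trans_le hw.1.1, hw.2.1.trans_lt hq.1.2⟩,
    ⟨hp.2.1.trans_le hw.1.2, hw.2.2.trans_lt hq.2.2⟩⟩⟩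

theorem isPreconnected_source (hB : B ∈ A.boxes) : IsPreconnected B.source := by
  obtain ⟨a, b, c, d, h⟩ := target_eq hB
  rw [← B.symm_image_target_eq_source]
  refine IsPreconnected.image ?_ _ B.continuousOn_symm
  rw [h]
  exact isPreconnected_Ioo.prod isPreconnected_Ioo

variable (A)

/-- `x` precedes `y` on a piece, contained in a box, of a leaf of the first foliation. -/
def Step (x y : M) : Prop :=
  ∃ B ∈ A.boxes, x ∈ B.source ∧ y ∈ B.source ∧ (B x).1 = (B y).1 ∧ (B x).2 ≤ (B y).2

/-- `x` precedes `y` on a leaf of the first foliation. -/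
abbrev Le : M → M → Prop := Relation.ReflTransGen A.Step

/-- `x` and `y` lie in a box and have the same first coordinate. -/
def Plaque (x y : M) : Prop :=
  ∃ B ∈ A.boxes, x ∈ B.source ∧ y ∈ B.source ∧ (B x).1 = (B y).1

variable {A}

theorem Step.plaque (h : A.Step x y) : A.Plaque x y :=
  let ⟨B, hB, hx, hy, h1, _⟩ := h
  ⟨B, hB, hx, hy, h1⟩

theorem Plaque.symm (h : A.Plaque x y) : A.Plaque y x :=
  let ⟨B, hB, hx, hy, h1⟩ := h
  ⟨B, hB, hy, hx, h1.symm⟩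

theorem Plaque.step_or_step (h : A.Plaque x y) : A.Step x y ∨ A.Step y x :=
  let ⟨B, hB, hx, hy, h1⟩ := h
  (le_total (B x).2 (B y).2).imp (fun h2 ↦ ⟨B, hB, hx, hy, h1, h2⟩)
    fun h2 ↦ ⟨B, hB, hy, hx, h1.symm, h2⟩

variable (A)

/-- The equivalence relation of lying on the same leaf of the first foliation. -/
def leafSetoid : Setoid M where
  r := Relation.ReflTransGen A.Plaque
  iseqv := ⟨fun _ ↦ .refl, fun h ↦
    have : Std.Symm A.Plaque := ⟨fun _ _ ↦ Plaque.symm⟩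
    Relation.ReflTransGen.stdSymm.symm _ _ h,
    Relation.ReflTransGen.trans⟩

/-- `x` and `y` lie on the same leaf of the first foliation. -/
abbrev Leaf (x y : M) : Prop := A.leafSetoid x y

variable {A}

theorem Plaque.leaf (h : A.Plaque x y) : A.Leaf x y := Relation.ReflTransGen.single h

theorem Le.leaf (h : A.Le x y) : A.Leaf x y := Relation.ReflTransGen.mono (fun _ _ ↦ Step.plaque) _ _ h

theorem step_neg : A.neg.Step x y ↔ A.Step y x := by
  constructor
  · rintro ⟨_, ⟨B, hB, rfl⟩, hx, hy, h1, h2⟩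
    exact ⟨B, hB, hy, hx, (neg_inj.1 h1).symm, neg_le_neg_iff.1 h2⟩
  · rintro ⟨B, hB, hx, hy, h1, h2⟩
    exact ⟨_, mem_image_of_mem _ hB, hy, hx, (neg_inj.2 h1).symm, neg_le_neg_iff.2 h2⟩

theorem le_neg : A.neg.Le x y ↔ A.Le y x := by
  rw [Le, show A.neg.Step = Function.swap A.Step from funext₂ fun _ _ ↦ propext step_neg]
  exact Relation.reflTransGen_swap

theorem continuousOn_line (B : OpenPartialHomeomorph M (ℝ × ℝ)) (a : ℝ) :
    ContinuousOn (fun t ↦ B.symm (a, t)) {t | (a, t) ∈ B.target} :=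
  B.continuousOn_symm.comp (by fun_prop) fun _ ht ↦ ht

theorem mk_mem_target_of_mem_Icc (hB : B ∈ A.boxes) (hx : x ∈ B.source) (hy : y ∈ B.source)
    (h : (B x).1 = (B y).1) {t : ℝ} (ht : t ∈ Icc (B x).2 (B y).2) : ((B x).1, t) ∈ B.target :=
  (ordConnected_target hB).out (B.map_source hx) (B.map_source hy) ⟨⟨le_rfl, ht.1⟩, ⟨h.le, ht.2⟩⟩

/-- Two points that follow `x` on its leaf, one of them in the same plaque of `x`, are comparable:
the two pieces of the leaf that start at `x` agree as long as none of them ends. -/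
theorem Step.le_or_mem [T2Space M] (hB : B ∈ A.boxes) (hx : x ∈ B.source) (hy : y ∈ B.source)
    (hu : (B x).1 = (B y).1) (hv : (B x).2 ≤ (B y).2) (hz : A.Step x z) :
    A.Step y z ∨ (z ∈ B.source ∧ (B x).1 = (B z).1 ∧ (B z).2 ≤ (B y).2) := by
  obtain ⟨B', hB', hx', hz', hu', hv'⟩ := hz
  let α (t : ℝ) : M := B.symm ((B x).1, t)
  -- the closed piece of the leaf from `x` to `z` in the box `B'`
  let K : Set M := B'.symm '' ({(B' x).1} ×ˢ Icc (B' x).2 (B' z).2)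
  have hmem : ∀ t ∈ Icc (B x).2 (B y).2, ((B x).1, t) ∈ B.target :=
    fun t ht ↦ mk_mem_target_of_mem_Icc hB hx hy hu ht
  have hmem' : ({(B' x).1} ×ˢ Icc (B' x).2 (B' z).2 : Set (ℝ × ℝ)) ⊆ B'.target := by
    rintro ⟨a, t⟩ ⟨rfl, ht⟩
    exact mk_mem_target_of_mem_Icc hB' hx' hz' hu' ht
  have hαc : ContinuousOn α (Icc (B x).2 (B y).2) := (continuousOn_line B _).mono hmem
  by_cases hzα : ∃ t ∈ Icc (B x).2 (B y).2, α t = z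
  · obtain ⟨t, ht, rfl⟩ := hzα
    refine .inr ⟨B.map_target (hmem t ht), ?_⟩
    rw [B.right_inv (hmem t ht)]
    exact ⟨rfl, ht.2⟩
  have hK : IsClosed K := ((isCompact_singleton.prod isCompact_Icc).image_of_continuousOn
    (B'.continuousOn_symm.mono hmem')).isClosed
  have hKmem {m : M} : m ∈ K ↔ m ∈ B'.source ∧ (B' m).1 = (B' x).1 ∧ (B' x).2 ≤ (B' m).2 ∧
      (B' m).2 ≤ (B' z).2 := by
    constructor
    · rintro ⟨p, hp, rfl⟩
      rw [B'.right_inv (hmem' hp)]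
      exact ⟨B'.map_target (hmem' hp), hp.1, hp.2.1, hp.2.2⟩
    · rintro ⟨hm, h1, h2⟩
      exact ⟨B' m, ⟨h1, h2⟩, B'.left_inv hm⟩
  -- the curve `α` from `x` to `y` stays in `K`, for it could leave `K` only at `z`
  have hsub : Icc (B x).2 (B y).2 ⊆ α ⁻¹' K := by
    refine IsClosed.Icc_subset_of_forall_mem_nhdsWithin ?_ ?_ ?_
    · rw [inter_comm]
      exact hαc.preimage_isClosed_of_isClosed isClosed_Icc hK
    · refine hKmem.2 ?_
      rw [show α (B x).2 = x from B.left_inv hx]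
      exact ⟨hx', rfl, le_rfl, hv'⟩
    · rintro t ⟨htK, ht⟩
      have htI := Ico_subset_Icc_self ht
      obtain ⟨h1, h2, h3, h4⟩ := hKmem.1 htK
      have h5 : (B' (α t)).2 < (B' z).2 := by
        refine lt_of_le_of_ne h4 fun h ↦ hzα ⟨t, htI, ?_⟩
        exact B'.injOn h1 hz' (Prod.ext (h2.trans hu') h)
      have hm := B.map_target (hmem t htI)
      obtain ⟨W, hW, hWu⟩ := A.compat_fst B hB B' hB' (α t) hm h1
      obtain ⟨W', hW', hWv⟩ := A.compat_snd B hB B' hB' (α t) hm h1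
      have h6 : ∀ᶠ w in 𝓝 (α t), w ∈ W ∧ w ∈ W' ∧ w ∈ B'.source ∧ (B' w).2 < (B' z).2 := by
        filter_upwards [hW, hW', B'.open_source.mem_nhds h1,
          (B'.continuousAt h1).snd.eventually (gt_mem_nhds h5)] with w a b c d using ⟨a, b, c, d⟩
      have h7 : ContinuousWithinAt α (Ioo t (B y).2) t :=
        (hαc t htI).mono fun s hs ↦ ⟨ht.1.trans hs.1.le, hs.2.le⟩
      have h8 := (Ioo_mem_nhdsGT ht.2)
      rw [ContinuousWithinAt, nhdsWithin_Ioo_eq_nhdsGT ht.2] at h7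
      filter_upwards [h7.eventually h6, h8] with s hs hst
      have hsI : s ∈ Icc (B x).2 (B y).2 := ⟨ht.1.trans hst.1.le, hst.2.le⟩
      have e1 : (B (α t)) = ((B x).1, t) := B.right_inv (hmem t htI)
      have e2 : (B (α s)) = ((B x).1, s) := B.right_inv (hmem s hsI)
      have hWt := mem_of_mem_nhds hW
      have hWt' := mem_of_mem_nhds hW'
      refine hKmem.2 ⟨hs.2.2.1, le_antisymm ?_ ?_, h3.trans ?_, hs.2.2.2.le⟩
      · rw [← h2]
        exact (hWu _ hs.1 _ hWt).1 (by rw [e1, e2])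
      · rw [← h2]
        exact (hWu _ hWt _ hs.1).1 (by rw [e1, e2])
      · exact (hWv _ hWt' _ hs.2.1).1 (by rw [e1, e2]; exact hst.1.le)
  have hyK := hKmem.1 (hsub (right_mem_Icc.2 hv))
  have hαy : α (B y).2 = y := by simp only [α, hu]; exact B.left_inv hy
  rw [hαy] at hyK
  exact .inl ⟨B', hB', hyK.1, hz', hyK.2.1.trans hu', hyK.2.2.2⟩

/-- The points that follow `x` on its leaf either follow `y` or lie in the plaque between `x` and
`y`. -/
theorem Le.le_or_mem [T2Space M] (hB : B ∈ A.boxes) (hx : x ∈ B.source) (hy : y ∈ B.source)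
    (hu : (B x).1 = (B y).1) (hv : (B x).2 ≤ (B y).2) (hz : A.Le x z) :
    A.Le y z ∨ (z ∈ B.source ∧ (B z).1 = (B y).1 ∧ (B z).2 ≤ (B y).2) := by
  induction hz using Relation.ReflTransGen.head_induction_on with
  | refl => exact .inr ⟨hx, hu, hv⟩
  | head h1 h2 ih =>
    rcases Step.le_or_mem hB hx hy hu hv h1 with h | ⟨h, h3, h4⟩
    · exact .inl (.head h h2)
    · exact ih h (h3.symm.trans hu) h4

theorem Le.total_of_le [T2Space M] (hy : A.Le x y) (hz : A.Le x z) : A.Le y z ∨ A.Le z y := by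
  induction hy using Relation.ReflTransGen.head_induction_on with
  | refl => exact .inl hz
  | head h1 h2 ih =>
    obtain ⟨B, hB, hx, hw, hu, hv⟩ := h1
    rcases Le.le_or_mem hB hx hw hu hv hz with h | ⟨h, h3, h4⟩
    · exact ih h
    · exact .inr (.head ⟨B, hB, h, hw, h3, h4⟩ h2)

/-- Each leaf is totally preordered. -/
theorem Leaf.total [T2Space M] (h : A.Leaf x y) : A.Le x y ∨ A.Le y x := by
  induction h with
  | refl => exact .inl .refl
  | @tail y z h1 h2 ih =>
    rcases ih, h2.step_or_step with ⟨h | h, h' | h'⟩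
    · exact .inl (.tail h h')
    · exact (Le.total_of_le (le_neg.2 h) (.single (step_neg.2 h'))).symm.imp le_neg.1 le_neg.1
    · exact Le.total_of_le h (.single h')
    · exact .inr (.head h' h)

/-! ### Saturated sets -/

variable (A)

/-- The union of the leaves that meet `S`. -/
def saturation (S : Set M) : Set M := {y | ∃ x ∈ S, A.Leaf x y}

theorem isOpen_saturation {S : Set M} (hS : IsOpen S) : IsOpen (A.saturation S) := by
  refine isOpen_iff_mem_nhds.2 fun y hy ↦ ?_
  obtain ⟨x, hx, hxy⟩ := hy
  induction hxy with
  | refl => exact mem_of_superset (hS.mem_nhds hx) fun z hz ↦ ⟨z, hz, .refl⟩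
  | @tail y z _ h2 ih =>
    obtain ⟨B, hB, hy, hz, hu⟩ := h2
    have h3 : ((B z).1, (B y).2) ∈ B.target := hu ▸ B.map_source hy
    have h4 : ContinuousAt (fun w ↦ B.symm ((B w).1, (B y).2)) z :=
      ContinuousAt.comp (f := fun w ↦ ((B w).1, (B y).2)) (B.continuousAt_symm h3)
        ((B.continuousAt hz).fst.prodMk continuousAt_const)
    have h5 : B.symm ((B z).1, (B y).2) = y := by rw [← hu]; exact B.left_inv hy
    rw [ContinuousAt, h5] at h4
    filter_upwards [h4 ih, B.open_source.mem_nhds hz] with w hw hwB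
    obtain ⟨x', hx', h6⟩ := hw
    have h7 := mk_mem_target hB (B.map_source hwB) (B.map_source hy)
    refine ⟨x', hx', h6.tail ⟨B, hB, B.map_target h7, hwB, ?_⟩⟩
    rw [B.right_inv h7]

theorem isOpenQuotientMap_mk : IsOpenQuotientMap (Quotient.mk A.leafSetoid) := by
  refine ⟨Quotient.mk_surjective, continuous_quotient_mk', fun S hS ↦ ?_⟩
  rw [← isQuotientMap_quotient_mk'.isOpen_preimage]
  convert! A.isOpen_saturation hS using 1
  ext y
  exact exists_congr fun x ↦ and_congr_right fun _ ↦ Quotient.eq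

end NullAtlas

namespace NullAtlas

/-! ### A function that is constant on the leaves -/

section Height

open MeasureTheory

variable {M : Type*} [TopologicalSpace M] (A : NullAtlas M)
  {B B' : OpenPartialHomeomorph M (ℝ × ℝ)} {x y z : M}

/-- A box is simple if each leaf meets it in at most one plaque. -/
def IsSimple (B : OpenPartialHomeomorph M (ℝ × ℝ)) : Prop :=
  B ∈ A.boxes ∧ ∀ y ∈ B.source, ∀ z ∈ B.source, A.Leaf y z → (B y).1 = (B z).1

/-- The foliation is locally simple if there are simple boxes around all points. -/
def LocallySimple : Prop := ∀ x, ∃ B, A.IsSimple B ∧ x ∈ B.source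

/-- A continuous function that locally defines the same preorder as the first coordinate of the
boxes; in particular it is constant on the leaves. -/
structure IsHeight (f : M → ℝ) : Prop where
  continuous : Continuous f
  le_iff : ∀ B ∈ A.boxes, ∀ x ∈ B.source,
    ∃ W ∈ 𝓝 x, ∀ y ∈ W, ∀ z ∈ W, (f y ≤ f z ↔ (B y).1 ≤ (B z).1)

variable {A}

/-- Countably many curves transverse to the leaves, one in each box of a countable cover by simple
boxes, meet all leaves. Lebesgue measure on their disjoint union, replaced by an equivalent finite
measure, is a transverse measure with full support for which single leaves are null sets. -/
theorem LocallySimple.exists_transverse_measure [SecondCountableTopology M]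
    (hA : A.LocallySimple) [Nonempty M] :
    ∃ (μ : Measure (ℕ × ℝ)) (c : ℕ × ℝ → M), IsFiniteMeasure μ ∧ Continuous c ∧
      (∀ S, IsOpen S → S.Nonempty → 0 < μ (c ⁻¹' A.saturation S)) ∧
      ∀ x, μ {q | A.Leaf x (c q)} = 0 := by
  choose b hb hxb using hA
  obtain ⟨s, hs, hsU⟩ := TopologicalSpace.countable_cover_nhds
    fun x ↦ (b x).open_source.mem_nhds (hxb x)
  have hsne : s.Nonempty := by
    by_contra h
    rw [not_nonempty_iff_eq_empty.1 h] at hsU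
    simp at hsU
    exact not_isEmpty_of_nonempty M (univ_eq_empty_iff.1 hsU.symm)
  obtain ⟨e, rfl⟩ := hs.exists_eq_range hsne
  choose! p r hpr using A.square
  let C (k : ℕ) := b (e k)
  have hC (k : ℕ) : A.IsSimple (C k) := hb _
  have hr (k : ℕ) : 0 < r (C k) := by
    have h1 : (C k) (e k) ∈ (C k).target := (C k).map_source (hxb _)
    rw [hpr _ (hC k).1] at h1
    exact dist_nonneg.trans_lt h1
  let h (k : ℕ) : OpenPartialHomeomorph ℝ ℝ := .univBall (p (C k)).1 (r (C k))
  have hmem (k : ℕ) (t : ℝ) : (h k t, (p (C k)).2) ∈ (C k).target := by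
    have h1 : h k t ∈ (h k).target := (h k).map_source (by simp [h])
    rw [OpenPartialHomeomorph.univBall_target _ (hr k)] at h1
    rw [hpr _ (hC k).1, ← ball_prod_same]
    exact ⟨h1, Metric.mem_ball_self (hr k)⟩
  let c (q : ℕ × ℝ) : M := (C q.1).symm (h q.1 q.2, (p (C q.1)).2)
  have hcu (q : ℕ × ℝ) : C q.1 (c q) = (h q.1 q.2, (p (C q.1)).2) :=
    (C q.1).right_inv (hmem _ _)
  have hcm (q : ℕ × ℝ) : c q ∈ (C q.1).source := (C q.1).map_target (hmem _ _)
  have hc : Continuous c := by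
    refine continuous_prod_of_discrete_left.2 fun k ↦ ?_
    refine (C k).continuousOn_symm.comp_continuous ?_ fun t ↦ hmem k t
    exact Continuous.prodMk (f := h k) (OpenPartialHomeomorph.continuous_univBall _ _)
      (continuous_const (y := (p (C k)).2))
  have : (Measure.count : Measure ℕ).IsOpenPosMeasure :=
    ⟨fun U _ hU ↦ Measure.count_ne_zero hU⟩
  let ν : Measure (ℕ × ℝ) := Measure.count.prod volume
  refine ⟨ν.toFinite, c, inferInstance, hc, fun S hS hSne ↦ ?_, fun x ↦ ?_⟩
  · have hopen := (A.isOpen_saturation hS).preimage hc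
    refine pos_iff_ne_zero.2 fun h0 ↦ ?_
    refine (hopen.measure_pos ν ?_).ne' (absolutelyContinuous_toFinite ν h0)
    obtain ⟨m, hm⟩ := hSne
    obtain ⟨k, hk⟩ : ∃ k, m ∈ (C k).source := by
      have : m ∈ ⋃ x ∈ range e, (b x).source := hsU ▸ mem_univ m
      simpa [C] using this
    have h2 := (C k).map_source hk
    rw [hpr _ (hC k).1, ← ball_prod_same] at h2
    rw [← OpenPartialHomeomorph.univBall_target _ (hr k)] at h2
    refine ⟨(k, (h k).symm (C k m).1), m, hm, Plaque.leaf ⟨C k, (hC k).1, hk, hcm (k, _), ?_⟩⟩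
    rw [hcu (k, _)]
    exact ((h k).right_inv h2.1).symm
  · refine toFinite_absolutelyContinuous ν (Set.Countable.measure_zero ?_ ν)
    have h1 : {q | A.Leaf x (c q)} = ⋃ k : ℕ, Prod.mk k '' {t | A.Leaf x (c (k, t))} := by
      ext ⟨k, t⟩
      simp
    rw [h1]
    refine countable_iUnion fun k ↦ (Set.Subsingleton.countable ?_).image _
    intro t ht t' ht'
    have h2 := (hC k).2 _ (hcm (k, t)) _ (hcm (k, t')) (A.leafSetoid.trans
      (A.leafSetoid.symm ht) ht')
    rw [hcu (k, t), hcu (k, t')] at h2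
    exact (h k).injOn (by simp [h]) (by simp [h]) h2

/-- The leaves that meet a box between the plaques of `y` and `z` already meet any connected subset
of the box that contains `y` and `z`. -/
theorem saturation_strip (hB : B ∈ A.boxes) {C : Set M} (hC : IsPreconnected C)
    (hCB : C ⊆ B.source) (hy : y ∈ C) (hz : z ∈ C) :
    A.saturation {w | w ∈ B.source ∧ (B y).1 ≤ (B w).1 ∧ (B w).1 < (B z).1} =
      A.saturation {w | w ∈ C ∧ (B y).1 ≤ (B w).1 ∧ (B w).1 < (B z).1} := by
  refine Subset.antisymm ?_ fun m ⟨w, hw, hm⟩ ↦ ⟨w, ⟨hCB hw.1, hw.2⟩, hm⟩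
  rintro m ⟨w, ⟨hwB, h1, h2⟩, hm⟩
  obtain ⟨w', hw', h3⟩ := hC.intermediate_value hy hz
    (continuous_fst.comp_continuousOn (B.continuousOn.mono hCB)) ⟨h1, h2.le⟩
  simp only [Function.comp_apply] at h3
  exact ⟨w', ⟨hw', h3 ▸ h1, h3 ▸ h2⟩, A.leafSetoid.trans
    (Plaque.leaf ⟨B, hB, hCB hw', hwB, h3⟩) hm⟩

/-- If the leaf space of a foliation of a simply connected surface is locally Euclidean, then there
is a function on the surface which locally distinguishes the leaves. In a simple box such a
function is the transverse measure of the set of leaves below a given one, and any two of these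
local functions differ by a locally constant one. -/
theorem LocallySimple.exists_isHeight [SecondCountableTopology M] [SimplyConnectedSpace M]
    [LocallyPathConnectedSpace M] (hA : A.LocallySimple) : ∃ f, A.IsHeight f := by
  have : Nonempty M := inferInstance
  obtain ⟨μ, c, hμ, hc, hpos, hnull⟩ := hA.exists_transverse_measure
  -- `L B x` is the union of the leaves that pass the box `B` below `x`, and `F B x` its measure
  let L (B : OpenPartialHomeomorph M (ℝ × ℝ)) (x : M) : Set M :=
    A.saturation {w | w ∈ B.source ∧ (B w).1 < (B x).1}
  let S (B : OpenPartialHomeomorph M (ℝ × ℝ)) (y z : M) : Set M :=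
    A.saturation {w | w ∈ B.source ∧ (B y).1 ≤ (B w).1 ∧ (B w).1 < (B z).1}
  let F (B : OpenPartialHomeomorph M (ℝ × ℝ)) (x : M) : ℝ := μ.real (c ⁻¹' L B x)
  have hLo (B : OpenPartialHomeomorph M (ℝ × ℝ)) (x : M) : IsOpen (L B x) :=
    A.isOpen_saturation (B.continuousOn.fst.isOpen_inter_preimage B.open_source isOpen_Iio)
  have hLm (B : OpenPartialHomeomorph M (ℝ × ℝ)) (x : M) : MeasurableSet (c ⁻¹' L B x) :=
    ((hLo B x).preimage hc).measurableSet
  have hadd {B : OpenPartialHomeomorph M (ℝ × ℝ)} (hB : A.IsSimple B) (y z : M)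
      (hyz : (B y).1 ≤ (B z).1) : F B z = F B y + μ.real (c ⁻¹' S B y z) := by
    have h1 : L B z = L B y ∪ S B y z := by
      ext m
      constructor
      · rintro ⟨w, ⟨hw, h1⟩, hm⟩
        rcases lt_or_ge (B w).1 (B y).1 with h | h
        · exact .inl ⟨w, ⟨hw, h⟩, hm⟩
        · exact .inr ⟨w, ⟨hw, h, h1⟩, hm⟩
      · rintro (⟨w, ⟨hw, h1⟩, hm⟩ | ⟨w, ⟨hw, h1, h2⟩, hm⟩)
        · exact ⟨w, ⟨hw, h1.trans_le hyz⟩, hm⟩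
        · exact ⟨w, ⟨hw, h2⟩, hm⟩
    have h2 : Disjoint (L B y) (S B y z) := by
      refine disjoint_left.2 ?_
      rintro m ⟨w, ⟨hw, h1⟩, hm⟩ ⟨w', ⟨hw', h1', -⟩, hm'⟩
      exact absurd (hB.2 w hw w' hw' (A.leafSetoid.trans hm (A.leafSetoid.symm hm')))
        (h1.trans_le h1').ne
    simp only [F]
    rw [h1, preimage_union, measureReal_union' (h2.preimage c) (hLm B y)]
  have hmono {B : OpenPartialHomeomorph M (ℝ × ℝ)} (hB : A.IsSimple B) {y z : M}
      (hyz : (B y).1 ≤ (B z).1) : F B y ≤ F B z := by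
    rw [hadd hB y z hyz]
    exact le_add_of_nonneg_right measureReal_nonneg
  have hlt {B : OpenPartialHomeomorph M (ℝ × ℝ)} (hB : A.IsSimple B) {y z : M}
      (hy : y ∈ B.source) (hz : z ∈ B.source) (hyz : (B y).1 < (B z).1) : F B y < F B z := by
    rw [hadd hB y z hyz.le]
    refine lt_add_of_pos_right _ (ENNReal.toReal_pos (ne_of_gt ?_) (measure_ne_top _ _))
    let V : Set M := B.source ∩ (fun w ↦ (B w).1) ⁻¹' Ioo (B y).1 (B z).1
    have hV : IsOpen V := B.continuousOn.fst.isOpen_inter_preimage B.open_source isOpen_Ioo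
    have hVne : V.Nonempty := by
      obtain ⟨t, ht⟩ := exists_between hyz
      have h1 : (t, (B z).2) ∈ B.target := (ordConnected_target hB.1).out
        (mk_mem_target hB.1 (B.map_source hy) (B.map_source hz)) (B.map_source hz)
        ⟨⟨ht.1.le, le_rfl⟩, ⟨ht.2.le, le_rfl⟩⟩
      refine ⟨B.symm (t, (B z).2), B.map_target h1, ?_⟩
      rw [mem_preimage, B.right_inv h1]
      exact ht
    refine (hpos V hV hVne).trans_le (measure_mono (preimage_mono ?_))
    rintro m ⟨w, ⟨hw, h1, h2⟩, hm⟩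
    exact ⟨w, ⟨hw, h1.le, h2⟩, hm⟩
  have hle {B : OpenPartialHomeomorph M (ℝ × ℝ)} (hB : A.IsSimple B) {y z : M}
      (hy : y ∈ B.source) (hz : z ∈ B.source) : F B y ≤ F B z ↔ (B y).1 ≤ (B z).1 :=
    ⟨fun h ↦ not_lt.1 fun h' ↦ (hlt hB hz hy h').not_ge h, hmono hB⟩
  -- continuity follows from dominated convergence, because the leaf of `x` is a null set
  have hcont {B : OpenPartialHomeomorph M (ℝ × ℝ)} (hB : A.IsSimple B) {x : M}
      (hx : x ∈ B.source) : ContinuousAt (F B) x := by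
    refine (ENNReal.tendsto_toReal (measure_ne_top μ _)).comp ?_
    refine tendsto_measure_of_ae_tendsto_indicator_of_isFiniteMeasure (𝓝 x) (hLm B x)
      (fun y ↦ hLm B y) ?_
    have hae : ∀ᵐ q ∂μ, ¬ A.Leaf x (c q) := by
      rw [ae_iff]
      simpa using hnull x
    filter_upwards [hae] with q hq
    by_cases hm : ∃ z ∈ B.source, A.Leaf z (c q)
    · obtain ⟨z, hz, hzq⟩ := hm
      have key (y : M) : q ∈ c ⁻¹' L B y ↔ (B z).1 < (B y).1 := by
        constructor
        · rintro ⟨w, ⟨hw, h1⟩, hwq⟩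
          rwa [hB.2 z hz w hw (A.leafSetoid.trans hzq (A.leafSetoid.symm hwq))]
        · exact fun h ↦ ⟨z, ⟨hz, h⟩, hzq⟩
      have hne : (B z).1 ≠ (B x).1 := fun h ↦
        hq (A.leafSetoid.trans (Plaque.leaf ⟨B, hB.1, hx, hz, h.symm⟩) hzq)
      simp only [key]
      rcases hne.lt_or_gt with h | h
      · filter_upwards [(B.continuousAt hx).fst.eventually (lt_mem_nhds h)] with y hy
        exact iff_of_true hy h
      · filter_upwards [(B.continuousAt hx).fst.eventually (gt_mem_nhds h)] with y hy
        exact iff_of_false hy.not_gt h.not_gt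
    · have key (y : M) : q ∉ c ⁻¹' L B y := fun ⟨w, ⟨hw, _⟩, hwq⟩ ↦ hm ⟨w, hw, hwq⟩
      exact .of_forall fun y ↦ iff_of_false (key y) (key x)
  choose b hb hxb using hA
  -- the measures of the strips between two nearby points do not depend on the box
  have hglue : ∀ i j, ∀ x ∈ (b i).source ∩ (b j).source, ∀ᶠ y in 𝓝 x,
      F (b i) y - F (b j) y = F (b i) x - F (b j) x := by
    rintro i j x ⟨hi, hj⟩
    obtain ⟨W, hW, hWij⟩ := A.compat_fst _ (hb i).1 _ (hb j).1 x hi hj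
    obtain ⟨C, hC, hxC, hCO, hCi, -⟩ := A.exists_restrict _ (hb i).1 x hi _
      (inter_mem hW ((b j).open_source.mem_nhds hj))
    have hlt' : ∀ y ∈ C.source, ∀ z ∈ C.source,
        ((b i y).1 < (b i z).1 ↔ (b j y).1 < (b j z).1) := fun y hy z hz ↦
      not_le.symm.trans ((hWij z (hCO hz).1 y (hCO hy).1).not.trans not_le)
    have key : ∀ y ∈ C.source, ∀ z ∈ C.source, (b i y).1 ≤ (b i z).1 →
        F (b i) z - F (b j) z = F (b i) y - F (b j) y := by
      intro y hy z hz hyz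
      have hyz' := (hWij y (hCO hy).1 z (hCO hz).1).1 hyz
      have hS : S (b i) y z = S (b j) y z := by
        simp only [S]
        rw [saturation_strip (hb i).1 (isPreconnected_source hC) hCi hy hz,
          saturation_strip (hb j).1 (isPreconnected_source hC) (fun w hw ↦ (hCO hw).2) hy hz]
        congr 1
        ext w
        exact and_congr_right fun hw ↦ and_congr (hWij y (hCO hy).1 w (hCO hw).1) (hlt' w hw z hz)
      rw [hadd (hb i) y z hyz, hadd (hb j) y z hyz', hS]
      ring
    filter_upwards [C.open_source.mem_nhds hxC] with y hy
    rcases le_total (b i x).1 (b i y).1 with h | h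
    · exact key x hxC y hy h
    · exact (key y hy x hxC h).symm
  obtain ⟨f, hf⟩ := exists_glue_of_simplyConnected (fun i ↦ (b i).source)
    (fun i ↦ (b i).open_source) (fun x ↦ ⟨x, hxb x⟩) (fun i ↦ F (b i)) hglue
  refine ⟨f, continuous_iff_continuousAt.2 fun x ↦ ?_, fun B hB x hx ↦ ?_⟩
  · have h1 := (hcont (hb x) (hxb x)).add_const (f x - F (b x) x)
    refine h1.congr ?_
    filter_upwards [hf x x (hxb x)] with y hy
    linarith
  · obtain ⟨W, hW, h⟩ := A.compat_fst _ (hb x).1 B hB x (hxb x) hx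
    refine ⟨W ∩ {y | f y - F (b x) y = f x - F (b x) x} ∩ (b x).source,
      inter_mem (inter_mem hW (hf x x (hxb x))) ((b x).open_source.mem_nhds (hxb x)), ?_⟩
    rintro y ⟨⟨hyW, hy⟩, hyb⟩ z ⟨⟨hzW, hz⟩, hzb⟩
    rw [← h y hyW z hzW, ← hle (hb x) hyb hzb]
    simp only [mem_ofPred_eq] at hy hz
    constructor <;> intro h' <;> linarith

end Height

end NullAtlas

/-- A preorder on an interval that holds locally holds globally. -/
theorem rel_of_locally_rel_Icc {ρ : ℝ → ℝ → Prop} {a b : ℝ} (hrefl : ∀ t, ρ t t)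
    (htrans : ∀ r s t, ρ r s → ρ s t → ρ r t) (hab : a ≤ b)
    (h : ∀ t ∈ Icc a b, ∃ N ∈ 𝓝[Icc a b] t, ∀ s ∈ N, ∀ s' ∈ N, s ≤ s' → ρ s s') : ρ a b := by
  replace h : ∀ t ∈ Icc a b, ∃ ε > 0, ∀ s ∈ Icc a b, ∀ s' ∈ Icc a b, |s - t| < ε → |s' - t| < ε →
      s ≤ s' → ρ s s' := fun t ht ↦ by
    obtain ⟨N, hN, h⟩ := h t ht
    obtain ⟨ε, hε, hεN⟩ := Metric.mem_nhdsWithin_iff.1 hN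
    exact ⟨ε, hε, fun s hs s' hs' h1 h2 ↦ h s (hεN ⟨h1, hs⟩) s' (hεN ⟨h2, hs'⟩)⟩
  have hsub : Icc a b ⊆ {t | ∀ r ∈ Icc a t, ρ a r} := by
    refine IsClosed.Icc_subset_of_forall_mem_nhdsWithin ?_ ?_ ?_
    · refine isClosed_of_closure_subset fun t ht ↦ ?_
      have htI : t ∈ Icc a b := closure_minimal inter_subset_right isClosed_Icc ht
      obtain ⟨ε, hε, h⟩ := h t htI
      obtain ⟨t', ⟨ht', htI'⟩, h1⟩ := Metric.mem_closure_iff.1 ht ε hε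
      refine ⟨fun r hr ↦ ?_, htI⟩
      rcases le_or_gt r t' with h2 | h2
      · exact ht' r ⟨hr.1, h2⟩
      · rw [Real.dist_eq, abs_sub_comm] at h1
        refine htrans _ _ _ (ht' t' ⟨htI'.1, le_rfl⟩) (h t' htI' r ⟨hr.1, hr.2.trans htI.2⟩ h1 ?_
          h2.le)
        rw [abs_lt] at h1 ⊢
        constructor <;> linarith [hr.2]
    · intro r hr
      rw [Icc_self] at hr
      rw [hr]
      exact hrefl a
    · rintro t ⟨htS, ht⟩
      obtain ⟨ε, hε, h⟩ := h t (Ico_subset_Icc_self ht)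
      filter_upwards [Ioo_mem_nhdsGT (lt_min ht.2 (lt_add_of_pos_right t hε))] with t' ht' r hr
      rcases le_or_gt r t with h2 | h2
      · exact htS r ⟨hr.1, h2⟩
      · have h3 := hr.2.trans_lt ht'.2
        refine htrans _ _ _ (htS t ⟨ht.1, le_rfl⟩) (h t (Ico_subset_Icc_self ht) r
          ⟨hr.1, (h3.trans_le (min_le_left _ _)).le⟩ (by simpa) ?_ h2.le)
        rw [abs_lt]
        constructor <;> linarith [h3.trans_le (min_le_right _ _)]
  exact hsub (right_mem_Icc.2 hab) b (right_mem_Icc.2 hab)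

namespace NullAtlas

/-! ### Causal curves -/

section Causal

variable {M : Type*} [TopologicalSpace M] {A : NullAtlas M}
  {B B' : OpenPartialHomeomorph M (ℝ × ℝ)} {x y z : M} {f f' : M → ℝ} {R : M → M → Prop}

variable (A) in
/-- A continuous curve along which both coordinates of the boxes are locally nondecreasing, and not
both of them constant. -/
structure IsCausalCurve (γ : ℝ → M) : Prop where
  continuousOn : ContinuousOn γ (Icc 0 1)
  exists_lt : ∀ t ∈ Icc (0 : ℝ) 1, ∀ B ∈ A.boxes, γ t ∈ B.source →
    ∃ N ∈ 𝓝[Icc 0 1] t, ∀ s ∈ N, ∀ s' ∈ N, s < s' → B (γ s) < B (γ s')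

variable (A) in
/-- The properties of the causal relation on which the causal theory of the atlas rests: inside a
box it contains the order of the coordinates, and related points are joined by causal curves. -/
structure IsCausalRel (R : M → M → Prop) : Prop where
  of_lt : ∀ B ∈ A.boxes, ∀ x ∈ B.source, ∀ y ∈ B.source, B x < B y → R x y
  exists_curve : ∀ x y, R x y → ∃ γ, A.IsCausalCurve γ ∧ γ 0 = x ∧ γ 1 = y

theorem IsCausalCurve.swap {γ : ℝ → M} (h : A.IsCausalCurve γ) : A.swap.IsCausalCurve γ := by
  refine ⟨h.1, ?_⟩
  rintro t ht _ ⟨B, hB, rfl⟩ htB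
  obtain ⟨N, hN, h1⟩ := h.2 t ht B hB htB
  exact ⟨N, hN, fun s hs s' hs' hss ↦ Prod.swap_lt_swap.2 (h1 s hs s' hs' hss)⟩

theorem IsCausalRel.swap (h : A.IsCausalRel R) : A.swap.IsCausalRel R := by
  refine ⟨?_, fun x y hxy ↦ ?_⟩
  · rintro _ ⟨B, hB, rfl⟩ x hx y hy hxy
    exact h.1 B hB x hx y hy (Prod.swap_lt_swap.1 hxy)
  · obtain ⟨γ, hγ, h1⟩ := h.2 x y hxy
    exact ⟨γ, hγ.swap, h1⟩

theorem IsHeight.monotoneOn (hf : A.IsHeight f) {γ : ℝ → M} (hγ : A.IsCausalCurve γ) :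
    MonotoneOn (f ∘ γ) (Icc 0 1) := by
  intro a ha b hb hab
  have hsub : Icc a b ⊆ Icc (0 : ℝ) 1 := Icc_subset_Icc ha.1 hb.2
  refine rel_of_locally_rel_Icc (ρ := fun s t ↦ f (γ s) ≤ f (γ t)) (fun _ ↦ le_rfl)
    (fun _ _ _ ↦ le_trans) hab fun t ht ↦ ?_
  obtain ⟨B, hB, htB⟩ := A.exists_mem (γ t)
  obtain ⟨N, hN, h1⟩ := hγ.2 t (hsub ht) B hB htB
  obtain ⟨W, hW, h2⟩ := hf.2 B hB _ htB
  refine ⟨N ∩ γ ⁻¹' W, nhdsWithin_mono _ hsub (inter_mem hN (hγ.1 t (hsub ht) hW)), ?_⟩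
  intro s hs s' hs' hss
  rcases hss.eq_or_lt with rfl | hss
  · exact le_rfl
  · exact (h2 _ hs.2 _ hs'.2).2 (h1 s hs.1 s' hs'.1 hss).le.1

theorem IsHeight.le (hf : A.IsHeight f) (hR : A.IsCausalRel R) (h : R x y) : f x ≤ f y := by
  obtain ⟨γ, hγ, rfl, rfl⟩ := hR.2 x y h
  exact hf.monotoneOn hγ (by simp) (by simp) zero_le_one

theorem IsHeight.le_of_causal (hf : A.IsHeight f) (hR : A.IsCausalRel R)
    (h : Relation.ReflTransGen R x y) : f x ≤ f y := by
  induction h with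
  | refl => exact le_rfl
  | tail _ h ih => exact ih.trans (hf.le hR h)

theorem IsHeight.eq_on_curve (hf : A.IsHeight f) {γ : ℝ → M} (hγ : A.IsCausalCurve γ)
    (h : f (γ 0) = f (γ 1)) {t : ℝ} (ht : t ∈ Icc (0 : ℝ) 1) : f (γ t) = f (γ 0) :=
  le_antisymm (h ▸ hf.monotoneOn hγ ht (by simp) ht.2) (hf.monotoneOn hγ (by simp) ht ht.1)

/-- A causal curve along which the height is constant runs along a leaf. -/
theorem IsHeight.le_of_eq (hf : A.IsHeight f) (hR : A.IsCausalRel R) (h : R x y)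
    (hxy : f x = f y) : A.Le x y := by
  obtain ⟨γ, hγ, rfl, rfl⟩ := hR.2 x y h
  refine rel_of_locally_rel_Icc (ρ := fun s t ↦ A.Le (γ s) (γ t)) (fun _ ↦ .refl)
    (fun _ _ _ ↦ .trans) zero_le_one fun t ht ↦ ?_
  obtain ⟨B, hB, htB⟩ := A.exists_mem (γ t)
  obtain ⟨N, hN, h1⟩ := hγ.2 t ht B hB htB
  obtain ⟨W, hW, h2⟩ := hf.2 B hB _ htB
  refine ⟨N ∩ γ ⁻¹' (W ∩ B.source) ∩ Icc 0 1, inter_mem (inter_mem hN (hγ.1 t ht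
    (inter_mem hW (B.open_source.mem_nhds htB)))) self_mem_nhdsWithin, ?_⟩
  rintro s ⟨⟨hs, hsW, hsB⟩, hsI⟩ s' ⟨⟨hs', hsW', hsB'⟩, hsI'⟩ hss
  rcases hss.eq_or_lt with rfl | hss
  · exact .refl
  · have h3 := (h1 s hs s' hs' hss).le
    refine .single ⟨B, hB, hsB, hsB', le_antisymm h3.1 ((h2 _ hsW' _ hsW).1 ?_), h3.2⟩
    rw [hf.eq_on_curve hγ hxy hsI, hf.eq_on_curve hγ hxy hsI']

theorem IsHeight.le_of_causal_of_eq (hf : A.IsHeight f) (hR : A.IsCausalRel R)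
    (h : Relation.ReflTransGen R x y) (hxy : f x = f y) : A.Le x y := by
  induction h with
  | refl => exact .refl
  | tail h1 h2 ih =>
    have h3 := hf.le_of_causal hR h1
    have h4 := hf.le hR h2
    exact (ih (h3.antisymm (hxy ▸ h4))).trans (hf.le_of_eq hR h2 (h4.antisymm (hxy ▸ h3)))

/-- At least one of the heights of the two foliations increases strictly along causal curves. -/
theorem IsHeight.ne_of_eq (hf : A.IsHeight f) (hf' : A.swap.IsHeight f') (hR : A.IsCausalRel R)
    (h : R x y) (hxy : f x = f y) : f' x ≠ f' y := by
  intro hxy'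
  obtain ⟨γ, hγ, rfl, rfl⟩ := hR.2 x y h
  obtain ⟨B, hB, h0B⟩ := A.exists_mem (γ 0)
  have h0 : (0 : ℝ) ∈ Icc (0 : ℝ) 1 := by simp
  obtain ⟨N, hN, h1⟩ := hγ.2 0 h0 B hB h0B
  obtain ⟨W, hW, h2⟩ := hf.2 B hB _ h0B
  obtain ⟨W', hW', h2'⟩ := hf'.2 _ (mem_image_of_mem _ hB) _ h0B
  have h3 : Icc (0 : ℝ) 1 ∩ (N ∩ γ ⁻¹' (W ∩ W')) ∈ 𝓝[>] (0 : ℝ) := by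
    have h4 : Icc (0 : ℝ) 1 ∩ (N ∩ γ ⁻¹' (W ∩ W')) ∈ 𝓝[Icc 0 1] (0 : ℝ) :=
      inter_mem self_mem_nhdsWithin (inter_mem hN (hγ.1 0 h0 (inter_mem hW hW')))
    have h5 := nhdsWithin_mono _ Ioo_subset_Icc_self h4
    rwa [nhdsWithin_Ioo_eq_nhdsGT zero_lt_one] at h5
  obtain ⟨t, ⟨htI, htN, htW, htW'⟩, ht⟩ := (Filter.Eventually.and h3
    (self_mem_nhdsWithin (a := (0 : ℝ)) (s := Ioi 0))).exists
  have h6 := h1 0 (mem_of_mem_nhdsWithin h0 hN) t htN ht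
  refine h6.not_ge ⟨(h2 _ htW _ (mem_of_mem_nhds hW)).1 ?_,
    (h2' _ htW' _ (mem_of_mem_nhds hW')).1 ?_⟩
  · exact (hf.eq_on_curve hγ hxy htI).le
  · exact (hf'.eq_on_curve hγ.swap hxy' htI).le

/-- If both foliations have a height, then there are no closed causal curves. -/
theorem IsHeight.not_transGen (hf : A.IsHeight f) (hf' : A.swap.IsHeight f')
    (hR : A.IsCausalRel R) : ¬ Relation.TransGen R x x := by
  intro h
  obtain ⟨y, h1, h2⟩ := Relation.TransGen.tail'_iff.1 h
  exact hf.ne_of_eq hf' hR h2 ((hf.le hR h2).antisymm (hf.le_of_causal hR h1))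
    ((hf'.le hR.swap h2).antisymm (hf'.le_of_causal hR.swap h1))

theorem Step.causal (hR : A.IsCausalRel R) (h : A.Step x y) : Relation.ReflTransGen R x y := by
  obtain ⟨B, hB, hx, hy, h1, h2⟩ := h
  rcases h2.eq_or_lt with h2 | h2
  · rw [B.injOn hx hy (Prod.ext h1 h2)]
  · exact .single (hR.1 B hB x hx y hy (Prod.lt_iff.2 (.inr ⟨h1.le, h2⟩)))

theorem Le.causal (hR : A.IsCausalRel R) (h : A.Le x y) : Relation.ReflTransGen R x y := by
  induction h with
  | refl => exact .refl
  | tail _ h ih => exact ih.trans (h.causal hR)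

/-! ### Causal simplicity makes the leaf spaces Hausdorff manifolds -/

/-- If leaves returned to arbitrarily small boxes around `x` in different plaques, then, in the
limit, the points slightly after `x` on its plaque would causally precede `x`. -/
theorem IsCausalRel.locallySimple [T2Space M] (hR : A.IsCausalRel R)
    (hc : ∀ p, ¬ Relation.TransGen R p p)
    (hJ : IsClosed {z : M × M | Relation.ReflTransGen R z.1 z.2}) : A.LocallySimple := by
  intro x
  obtain ⟨B, hB, hx⟩ := A.exists_mem x
  obtain ⟨a, b, c, d, hT⟩ := target_eq hB
  have hxT := B.map_source hx
  obtain ⟨t, ht⟩ : ∃ t, (B x).2 < t ∧ t < d := exists_between (by rw [hT] at hxT; exact hxT.2.2)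
  have hup : ∀ w ∈ B.source, ((B w).1, t) ∈ B.target := fun w hw ↦ by
    have := B.map_source hw
    rw [hT] at this hxT ⊢
    exact ⟨this.1, hxT.2.1.trans ht.1, ht.2⟩
  -- `P w` is the point of the plaque of `w` at the level `t`, which lies above `x`
  let P (w : M) : M := B.symm ((B w).1, t)
  have hPs : ∀ w ∈ B.source, P w ∈ B.source := fun w hw ↦ B.map_target (hup w hw)
  have hPc : ∀ w ∈ B.source, B (P w) = ((B w).1, t) := fun w hw ↦ B.right_inv (hup w hw)
  have hlt : B x < B (P x) := by
    rw [hPc x hx]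
    exact Prod.lt_iff.2 (.inr ⟨le_rfl, ht.1⟩)
  have hnot : (P x, x) ∉ {z : M × M | Relation.ReflTransGen R z.1 z.2} := fun h ↦
    hc x (.head' (hR.1 B hB x hx _ (hPs x hx) hlt) h)
  have hPcont : ContinuousAt P x :=
    ContinuousAt.comp (f := fun w ↦ ((B w).1, t)) (B.continuousAt_symm (hup x hx))
      ((B.continuousAt hx).fst.prodMk continuousAt_const)
  have hnear : ∀ᶠ p : M × M in 𝓝 (x, x),
      ¬ Relation.ReflTransGen R (P p.1) p.2 ∧ (B p.1).2 < t := by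
    refine Filter.Eventually.and ?_ ?_
    · have h1 : ContinuousAt (fun p : M × M ↦ (P p.1, p.2)) (x, x) :=
        (ContinuousAt.comp (f := Prod.fst) (x := (x, x)) hPcont continuousAt_fst).prodMk
          continuousAt_snd
      exact h1.eventually (hJ.isOpen_compl.mem_nhds hnot)
    · have h1 : ContinuousAt (fun p : M × M ↦ (B p.1).2) (x, x) :=
        ContinuousAt.comp (f := Prod.fst) (x := (x, x)) (B.continuousAt hx).snd continuousAt_fst
      exact h1.eventually (gt_mem_nhds ht.1)
  rw [nhds_prod_eq] at hnear
  obtain ⟨O, hO, hOnear⟩ := (Filter.eventually_prod_self_iff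
    (r := fun a b ↦ ¬ Relation.ReflTransGen R (P a) b ∧ (B a).2 < t)).1 hnear
  obtain ⟨C, hC, hxC, hCO, hCB, hCe⟩ := A.exists_restrict B hB x hx O hO
  have key : ∀ y ∈ C.source, ∀ z ∈ C.source, A.Le y z → (C y).1 = (C z).1 := by
    intro y hy z hz hyz
    have h1 := hOnear y (hCO hy) z (hCO hz)
    have hPy := hPc y (hCB hy)
    rcases Le.le_or_mem hB (hCB hy) (hPs y (hCB hy)) (by rw [hPy]) (by rw [hPy]; exact h1.2.le)
      hyz with h | ⟨-, h, -⟩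
    · exact absurd (h.causal hR) h1.1
    · rw [hPy] at h
      rw [hCe, hCe]
      exact h.symm
  refine ⟨C, ⟨hC, fun y hy z hz hyz ↦ ?_⟩, hxC⟩
  rcases hyz.total with h | h
  · exact key y hy z hz h
  · exact (key z hz y hy h).symm

theorem IsHeight.eq_of_leaf (hf : A.IsHeight f) (h : A.Leaf x y) : f x = f y := by
  induction h with
  | refl => rfl
  | @tail y z _ h ih =>
    refine ih.trans ?_
    have key : ∀ y z, A.Step y z → f y = f z := by
      rintro y z ⟨B, hB, hy, hz, h1, h2⟩
      have hmem : ∀ t ∈ Icc (B y).2 (B z).2, ((B y).1, t) ∈ B.target :=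
        fun t ↦ mk_mem_target_of_mem_Icc hB hy hz h1
      have h3 := rel_of_locally_rel_Icc
        (ρ := fun s t ↦ f (B.symm ((B y).1, s)) = f (B.symm ((B y).1, t))) (fun _ ↦ rfl)
        (fun _ _ _ ↦ Eq.trans) h2 fun t ht ↦ ?_
      · have h4 : B.symm ((B y).1, (B z).2) = z := by rw [h1]; exact B.left_inv hz
        rwa [h4, show B.symm ((B y).1, (B y).2) = y from B.left_inv hy] at h3
      · obtain ⟨W, hW, h4⟩ := hf.2 B hB _ (B.map_target (hmem t ht))
        have h5 := ((continuousOn_line B (B y).1).mono hmem) t ht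
        refine ⟨_, inter_mem (h5 hW) self_mem_nhdsWithin, ?_⟩
        rintro s ⟨hs, hsI⟩ s' ⟨hs', hsI'⟩ -
        refine le_antisymm ((h4 _ hs _ hs').2 ?_) ((h4 _ hs' _ hs).2 ?_) <;>
        rw [B.right_inv (hmem _ hsI), B.right_inv (hmem _ hsI')]
    exact h.step_or_step.elim (key y z) fun h ↦ (key z y h).symm

/-- Distinct leaves can be separated. If the height takes the same value on them, then they are not
causally related, and since the causal relation is closed, neither are nearby points. -/
theorem IsHeight.exists_separation [T2Space M] (hf : A.IsHeight f) (hR : A.IsCausalRel R)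
    (hJ : IsClosed {z : M × M | Relation.ReflTransGen R z.1 z.2}) (h : ¬ A.Leaf x y) :
    ∃ U V : Set M, IsOpen U ∧ IsOpen V ∧ x ∈ U ∧ y ∈ V ∧
      ∀ u ∈ U, ∀ v ∈ V, ¬ A.Leaf u v := by
  by_cases hxy : f x = f y
  · have h1 : ¬ Relation.ReflTransGen R x y := fun h' ↦ h (hf.le_of_causal_of_eq hR h' hxy).leaf
    have h2 : ¬ Relation.ReflTransGen R y x := fun h' ↦
      h (A.leafSetoid.symm (hf.le_of_causal_of_eq hR h' hxy.symm).leaf)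
    obtain ⟨U, V, hU, hV, hxU, hyV, hUV⟩ := isOpen_prod_iff.1
      (hJ.isOpen_compl.inter (hJ.isOpen_compl.preimage continuous_swap)) x y ⟨h1, h2⟩
    refine ⟨U, V, hU, hV, hxU, hyV, fun u hu v hv huv ↦ ?_⟩
    have h3 := hUV (mk_mem_prod hu hv)
    rcases huv.total with h4 | h4
    · exact h3.1 (h4.causal hR)
    · exact h3.2 (h4.causal hR)
  · obtain ⟨U, V, hU, hV, hxU, hyV, hUV⟩ := t2_separation hxy
    exact ⟨f ⁻¹' U, f ⁻¹' V, hU.preimage hf.1, hV.preimage hf.1, hxU, hyV, fun u hu v hv huv ↦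
      disjoint_left.1 hUV hu (hf.eq_of_leaf huv ▸ hv)⟩

end Causal

end NullAtlas

/-! ### Locally injective functions on Hausdorff spaces -/

section Injective

variable {Q : Type*} [TopologicalSpace Q] [T2Space Q] {f : Q → ℝ}

/-- The images of `C` and `D` are intervals, and the image of `C ∩ D` is open and relatively closed
in their intersection, the latter because `Q` is Hausdorff. -/
theorem IsOpenMap.injOn_union (hfc : Continuous f) (hfo : IsOpenMap f) {C D : Set Q}
    (hC : IsOpen C) (hD : IsOpen D) (hCc : IsPreconnected C) (hDc : IsPreconnected D)
    (hCi : InjOn f C) (hDi : InjOn f D) (hne : (C ∩ D).Nonempty) : InjOn f (C ∪ D) := by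
  have hsub : f '' C ∩ f '' D ⊆ f '' (C ∩ D) := by
    refine IsPreconnected.subset_of_closure_inter_subset ?_ (hfo _ (hC.inter hD)) ?_ ?_
    · exact ((hCc.image f hfc.continuousOn).ordConnected.inter
        (hDc.image f hfc.continuousOn).ordConnected).isPreconnected
    · obtain ⟨c, hc⟩ := hne
      exact ⟨f c, ⟨mem_image_of_mem _ hc.1, mem_image_of_mem _ hc.2⟩, mem_image_of_mem _ hc⟩
    · rintro t ⟨ht, ⟨p, hp, rfl⟩, ⟨q, hq, hqp⟩⟩
      rcases eq_or_ne p q with rfl | hpq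
      · exact mem_image_of_mem _ ⟨hp, hq⟩
      obtain ⟨U, V, hU, hV, hpU, hqV, hUV⟩ := t2_separation hpq
      have h1 : f '' (U ∩ C) ∩ f '' (V ∩ D) ∈ 𝓝 (f p) :=
        inter_mem ((hfo _ (hU.inter hC)).mem_nhds (mem_image_of_mem _ ⟨hpU, hp⟩))
          ((hfo _ (hV.inter hD)).mem_nhds (hqp ▸ mem_image_of_mem _ ⟨hqV, hq⟩))
      obtain ⟨-, ⟨⟨a, ha, rfl⟩, ⟨b, hb, hba⟩⟩, ⟨e, he, hea⟩⟩ := mem_closure_iff_nhds.1 ht _ h1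
      have h2 := hCi he.1 ha.2 hea
      have h3 := hDi he.2 hb.2 (hea.trans hba.symm)
      exact absurd (h3 ▸ hb.1) (disjoint_left.1 hUV (h2 ▸ ha.1))
  have key : ∀ a ∈ C, ∀ b ∈ D, f a = f b → a = b := fun a ha b hb hab ↦ by
    obtain ⟨e, he, hea⟩ := hsub ⟨mem_image_of_mem f ha, hab ▸ mem_image_of_mem f hb⟩
    rw [← hCi he.1 ha hea]
    exact hDi he.2 hb (hea.trans hab)
  rintro a (ha | ha) b (hb | hb) hab
  · exact hCi ha hb hab
  · exact key a ha b hb hab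
  · exact (key b hb a ha hab.symm).symm
  · exact hDi ha hb hab

/-- A locally injective, continuous and open function on a connected Hausdorff space is injective,
provided that the sets on which it is injective can be chosen connected. -/
theorem IsOpenMap.injective_of_locally [PreconnectedSpace Q] (hfc : Continuous f)
    (hfo : IsOpenMap f)
    (hf : ∀ q, ∃ C, IsOpen C ∧ IsPreconnected C ∧ q ∈ C ∧ InjOn f C) : Function.Injective f := by
  intro a b hab
  let G : Set (Set Q) := {C | IsOpen C ∧ IsPreconnected C ∧ a ∈ C ∧ InjOn f C}
  have hG : ⋃₀ G = univ := by
    refine IsClopen.eq_univ ⟨isClosed_of_closure_subset fun q hq ↦ ?_,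
      isOpen_sUnion fun C hC ↦ hC.1⟩ ?_
    · obtain ⟨D, hD, hDc, hqD, hDi⟩ := hf q
      obtain ⟨p, hpD, C, hC, hpC⟩ := mem_closure_iff.1 hq D hD hqD
      exact ⟨C ∪ D, ⟨hC.1.union hD, hC.2.1.union p hpC hpD hDc, .inl hC.2.2.1,
        hfo.injOn_union hfc hC.1 hD hC.2.1 hDc hC.2.2.2 hDi ⟨p, hpC, hpD⟩⟩, .inr hqD⟩
    · obtain ⟨C, hC, hCc, haC, hCi⟩ := hf a
      exact ⟨a, C, ⟨hC, hCc, haC, hCi⟩, haC⟩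
  obtain ⟨C, hC, hb⟩ : b ∈ ⋃₀ G := hG ▸ mem_univ b
  exact hC.2.2.2 hC.2.2.1 hb hab

end Injective

namespace NullAtlas

/-! ### Causality when the leaf spaces are Hausdorff -/

section Hausdorff

variable {M : Type*} [TopologicalSpace M] {A : NullAtlas M}
  {B B' : OpenPartialHomeomorph M (ℝ × ℝ)} {x y z p : M} {f f' : M → ℝ} {R : M → M → Prop}

theorem IsHeight.exists_box (hf : A.IsHeight f) (x : M) {O : Set M} (hO : O ∈ 𝓝 x) :
    ∃ B ∈ A.boxes, x ∈ B.source ∧ B.source ⊆ O ∧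
      ∀ y ∈ B.source, ∀ z ∈ B.source, (f y ≤ f z ↔ (B y).1 ≤ (B z).1) := by
  obtain ⟨B, hB, hx⟩ := A.exists_mem x
  obtain ⟨W, hW, h⟩ := hf.2 B hB x hx
  obtain ⟨C, hC, hxC, hCO, -, hCe⟩ := A.exists_restrict B hB x hx _ (inter_mem hO hW)
  refine ⟨C, hC, hxC, fun y hy ↦ (hCO hy).1, fun y hy z hz ↦ ?_⟩
  rw [hCe, hCe]
  exact h y (hCO hy).2 z (hCO hz).2

/-- Near `x` one can move along the leaves of the second foliation to points of greater height
than all points near `x`. -/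
theorem IsHeight.exists_swap_step (hf : A.IsHeight f) (x : M) : ∃ N ∈ 𝓝 x, ∀ y ∈ N, ∀ y' ∈ N,
    ∃ z, A.swap.Step y z ∧ f y' < f z := by
  obtain ⟨B, hB, hx, -, hle⟩ := hf.exists_box x univ_mem
  obtain ⟨a, b, c, d, hT⟩ := target_eq hB
  have hxT := B.map_source hx
  obtain ⟨t, ht⟩ : ∃ t, (B x).1 < t ∧ t < b := exists_between (by rw [hT] at hxT; exact hxT.1.2)
  refine ⟨B.source ∩ {y | (B y).1 < t}, inter_mem (B.open_source.mem_nhds hx)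
    ((B.continuousAt hx).fst.eventually (gt_mem_nhds ht.1)), ?_⟩
  rintro y ⟨hy, hyt⟩ y' ⟨hy', hyt'⟩
  have h1 : (t, (B y).2) ∈ B.target := by
    have := B.map_source hy
    rw [hT] at this hxT ⊢
    exact ⟨⟨hxT.1.1.trans ht.1, ht.2⟩, this.2⟩
  have h2 := B.right_inv h1
  refine ⟨B.symm (t, (B y).2), ⟨_, mem_image_of_mem _ hB, hy, B.map_target h1, ?_, ?_⟩, ?_⟩
  · exact (congrArg Prod.snd h2).symm
  · exact hyt.le.trans_eq (congrArg Prod.fst h2).symm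
  · refine lt_of_not_ge fun h ↦ ?_
    rw [hle _ (B.map_target h1) _ hy', h2] at h
    exact h.not_gt hyt'

/-- The values of a height near `x` cover an interval around its value at `x`. -/
theorem IsHeight.exists_step_lt (hf : A.IsHeight f) (x : M) {O : Set M} (hO : O ∈ 𝓝 x) :
    ∃ y z, f y < f x ∧ f x < f z ∧ Icc (f y) (f z) ⊆ f '' O := by
  obtain ⟨B, hB, hx, hBO, hle⟩ := hf.exists_box x hO
  obtain ⟨a, b, c, d, hT⟩ := target_eq hB
  have hxT := B.map_source hx
  have hxT' := hxT
  rw [hT] at hxT'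
  obtain ⟨s, hs⟩ := exists_between hxT'.1.1
  obtain ⟨t, ht⟩ := exists_between hxT'.1.2
  have h1 : (s, (B x).2) ∈ B.target := by
    rw [hT]; exact ⟨⟨hs.1, hs.2.trans hxT'.1.2⟩, hxT'.2⟩
  have h2 : (t, (B x).2) ∈ B.target := by
    rw [hT]; exact ⟨⟨hxT'.1.1.trans ht.1, ht.2⟩, hxT'.2⟩
  refine ⟨B.symm (s, (B x).2), B.symm (t, (B x).2), lt_of_not_ge fun h ↦ ?_,
    lt_of_not_ge fun h ↦ ?_, ?_⟩
  · rw [hle _ hx _ (B.map_target h1), B.right_inv h1] at h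
    exact h.not_gt hs.2
  · rw [hle _ (B.map_target h2) _ hx, B.right_inv h2] at h
    exact h.not_gt ht.1
  · exact (((isPreconnected_source hB).image f hf.1.continuousOn).ordConnected.out
      (mem_image_of_mem _ (B.map_target h1)) (mem_image_of_mem _ (B.map_target h2))).trans
      (image_mono hBO)

theorem IsHeight.isOpenMap (hf : A.IsHeight f) : IsOpenMap f := by
  refine isOpenMap_iff_nhds_le.2 fun x O hO ↦ ?_
  obtain ⟨y, z, h1, h2, h3⟩ := hf.exists_step_lt x hO
  exact mem_of_superset (Icc_mem_nhds h1 h2) (h3.trans (image_preimage_subset f O))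

/-- If the leaf space is Hausdorff, then a height distinguishes the leaves: it descends to a locally
injective open function on the leaf space. -/
theorem IsHeight.leaf_of_eq [PreconnectedSpace M] [T2Space (Quotient A.leafSetoid)]
    (hf : A.IsHeight f) (h : f x = f y) : A.Leaf x y := by
  let q : M → Quotient A.leafSetoid := Quotient.mk _
  have hq : IsOpenQuotientMap q := A.isOpenQuotientMap_mk
  let F : Quotient A.leafSetoid → ℝ := Quotient.lift f fun a b hab ↦ hf.eq_of_leaf hab
  have hFc : Continuous F := hf.1.quotient_lift _
  have hFo : IsOpenMap F := fun U hU ↦ by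
    have h1 := hf.isOpenMap _ (hU.preimage hq.continuous)
    rwa [show f = F ∘ q from rfl, image_comp, image_preimage_eq _ hq.surjective] at h1
  have : PreconnectedSpace (Quotient A.leafSetoid) :=
    ⟨hq.surjective.range_eq ▸ isPreconnected_range hq.continuous⟩
  refine Quotient.exact (hFo.injective_of_locally hFc (fun a ↦ ?_) (a₁ := q x) (a₂ := q y) h)
  obtain ⟨m, rfl⟩ := hq.surjective a
  obtain ⟨B, hB, hm, -, hle⟩ := hf.exists_box m univ_mem
  refine ⟨q '' B.source, hq.isOpenMap _ B.open_source,
    (isPreconnected_source hB).image _ hq.continuous.continuousOn, mem_image_of_mem _ hm, ?_⟩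
  rintro _ ⟨a, ha, rfl⟩ _ ⟨b, hb, rfl⟩ hab
  exact Quotient.sound (Plaque.leaf ⟨B, hB, ha, hb, le_antisymm
    ((hle a ha b hb).1 hab.le) ((hle b hb a ha).1 hab.ge)⟩)

variable (A) in
/-- `y` is reached from `x` by moving forward along finitely many pieces of leaves of the two
foliations. -/
def Stair : M → M → Prop := Relation.ReflTransGen fun x y ↦ A.Step x y ∨ A.swap.Step x y

theorem Le.stair (h : A.Le x y) : A.Stair x y :=
  Relation.ReflTransGen.mono (fun _ _ ↦ .inl) _ _ h

theorem Le.stair_of_swap (h : A.swap.Le x y) : A.Stair x y :=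
  Relation.ReflTransGen.mono (fun _ _ ↦ .inr) _ _ h

theorem Stair.causal (hR : A.IsCausalRel R) (h : A.Stair x y) : Relation.ReflTransGen R x y := by
  induction h with
  | refl => exact .refl
  | tail _ h ih => exact ih.trans (h.elim (·.causal hR) (·.causal hR.swap))

theorem Step.exists_eq (h : A.Step x z) {g : M → ℝ} (hg : Continuous g) {c : ℝ}
    (hc : c ∈ Icc (g x) (g z)) : ∃ w, A.Step x w ∧ g w = c := by
  obtain ⟨B, hB, hx, hz, h1, h2⟩ := h
  have hmem : ∀ t ∈ Icc (B x).2 (B z).2, ((B x).1, t) ∈ B.target :=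
    fun t ↦ mk_mem_target_of_mem_Icc hB hx hz h1
  have h3 := intermediate_value_Icc h2 (hg.comp_continuousOn
    ((continuousOn_line B (B x).1).mono hmem))
  have h4 : B.symm ((B x).1, (B z).2) = z := by rw [h1]; exact B.left_inv hz
  simp only [Function.comp_apply, h4, show B.symm ((B x).1, (B x).2) = x from B.left_inv hx] at h3
  obtain ⟨t, ht, h5⟩ := h3 hc
  refine ⟨_, ⟨B, hB, hx, B.map_target (hmem t ht), ?_, ?_⟩, h5⟩
  · rw [B.right_inv (hmem t ht)]
  · rw [B.right_inv (hmem t ht)]; exact ht.1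

/-- A staircase that starts below `y`, but does not end strictly below `y`, meets the boundary of
the past of `y`. -/
theorem Stair.exists_crossing (hf : A.IsHeight f) (hf' : A.swap.IsHeight f')
    (h : A.Stair p z) (hp : f p ≤ f y) (hp' : f' p ≤ f' y) (hz : f y ≤ f z ∨ f' y ≤ f' z) :
    ∃ w, A.Stair p w ∧ (f w = f y ∧ f' w ≤ f' y ∨ f' w = f' y ∧ f w ≤ f y) := by
  induction h with
  | refl =>
    rcases hz with hz | hz
    · exact ⟨p, .refl, .inl ⟨hp.antisymm hz, hp'⟩⟩
    · exact ⟨p, .refl, .inr ⟨hp'.antisymm hz, hp⟩⟩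
  | @tail w z h1 h2 ih =>
    by_cases hw : f y ≤ f w ∨ f' y ≤ f' w
    · exact ih hw
    obtain ⟨hw1, hw2⟩ := not_or.1 hw
    rcases h2 with h2 | h2
    · have h3 := hf.eq_of_leaf h2.plaque.leaf
      obtain ⟨m, hm, hmy⟩ := h2.exists_eq hf'.1 (c := f' y)
        ⟨(not_le.1 hw2).le, hz.resolve_left (h3 ▸ hw1)⟩
      exact ⟨m, .tail h1 (.inl hm), .inr ⟨hmy, hf.eq_of_leaf hm.plaque.leaf ▸ (not_le.1 hw1).le⟩⟩
    · have h3 := hf'.eq_of_leaf h2.plaque.leaf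
      obtain ⟨m, hm, hmy⟩ := h2.exists_eq hf.1 (c := f y)
        ⟨(not_le.1 hw1).le, hz.resolve_right (h3 ▸ hw2)⟩
      exact ⟨m, .tail h1 (.inr hm), .inl ⟨hmy, hf'.eq_of_leaf hm.plaque.leaf ▸ (not_le.1 hw2).le⟩⟩

theorem IsHeight.eq_of_causal (hf : A.IsHeight f) (hf' : A.swap.IsHeight f')
    (hR : A.IsCausalRel R) (h : Relation.ReflTransGen R x y) (hxy : f y ≤ f x)
    (hxy' : f' y ≤ f' x) : x = y := by
  rcases h.cases_head with rfl | ⟨z, h1, h2⟩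
  · rfl
  · refine absurd ?_ (hf.ne_of_eq hf' hR h1 ?_)
    · exact (hf'.le hR.swap h1).antisymm ((hf'.le_of_causal hR.swap h2).trans hxy')
    · exact (hf.le hR h1).antisymm ((hf.le_of_causal hR h2).trans hxy)

/-- If both leaf spaces are Hausdorff, then the causal relation is the product order of the two
heights: the set of points above `p` that are reached from `p` by staircases is open and closed. -/
theorem IsHeight.causal_iff [T2Space M] [ConnectedSpace M] [T2Space (Quotient A.leafSetoid)]
    [T2Space (Quotient A.swap.leafSetoid)] (hf : A.IsHeight f) (hf' : A.swap.IsHeight f')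
    (hR : A.IsCausalRel R) : Relation.ReflTransGen R x y ↔ f x ≤ f y ∧ f' x ≤ f' y := by
  refine ⟨fun h ↦ ⟨hf.le_of_causal hR h, hf'.le_of_causal hR.swap h⟩, fun ⟨h1, h2⟩ ↦ ?_⟩
  -- points on a common leaf are joined by a staircase in the direction of the heights
  have hleaf {w y : M} (h : f w = f y ∧ f' w ≤ f' y ∨ f' w = f' y ∧ f w ≤ f y) : A.Stair w y := by
    rcases h with ⟨h1, h2⟩ | ⟨h1, h2⟩
    · rcases (hf.leaf_of_eq h1).total with h | h
      · exact h.stair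
      · rw [hf.eq_of_causal hf' hR (h.causal hR) h1.le h2]
        exact .refl
    · rcases (hf'.leaf_of_eq h1).total with h | h
      · exact h.stair_of_swap
      · rw [hf.eq_of_causal hf' hR (h.causal hR.swap) h2 h1.le]
        exact .refl
  have key {y z : M} (hz : A.Stair x z) (h1 : f x ≤ f y) (h2 : f' x ≤ f' y) (h3 : f y ≤ f z) :
      A.Stair x y := by
    obtain ⟨w, hw, h4⟩ := hz.exists_crossing hf hf' h1 h2 (.inl h3)
    exact hw.trans (hleaf h4)
  let G : Set M := {y | f x ≤ f y → f' x ≤ f' y → A.Stair x y}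
  suffices hG : G = univ from (show y ∈ G from hG ▸ mem_univ y) h1 h2 |>.causal hR
  refine IsClopen.eq_univ ⟨isClosed_of_closure_subset fun z hz h1 h2 ↦ ?_,
    isOpen_iff_mem_nhds.2 fun z hz ↦ ?_⟩ ⟨x, fun _ _ ↦ .refl⟩
  · rcases h1.eq_or_lt with h1 | h1
    · exact hleaf (.inl ⟨h1, h2⟩)
    rcases h2.eq_or_lt with h2 | h2
    · exact hleaf (.inr ⟨h2, h1.le⟩)
    obtain ⟨N, hN, h⟩ := hf.exists_swap_step z
    obtain ⟨y, ⟨hy, hy1, hy2⟩, hyG⟩ := mem_closure_iff_nhds.1 hz _ (inter_mem hN (inter_mem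
      (hf.1.continuousAt.eventually (lt_mem_nhds h1))
      (hf'.1.continuousAt.eventually (lt_mem_nhds h2))))
    obtain ⟨w, hw, hzw⟩ := h y hy z (mem_of_mem_nhds hN)
    exact key (.tail (hyG hy1.le hy2.le) (.inr hw)) h1.le h2.le hzw.le
  · by_cases h1 : f x ≤ f z
    · by_cases h2 : f' x ≤ f' z
      · obtain ⟨N, hN, h⟩ := hf.exists_swap_step z
        filter_upwards [hN] with y hy hy1 hy2
        obtain ⟨w, hw, hyw⟩ := h z (mem_of_mem_nhds hN) y hy
        exact key (.tail (hz h1 h2) (.inr hw)) hy1 hy2 hyw.le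
      · filter_upwards [hf'.1.continuousAt.eventually (gt_mem_nhds (not_le.1 h2))] with y hy _ hy2
        exact absurd hy hy2.not_gt
    · filter_upwards [hf.1.continuousAt.eventually (gt_mem_nhds (not_le.1 h1))] with y hy hy1
      exact absurd hy hy1.not_gt

theorem LocallySimple.isClosed_causal [T2Space M] [SecondCountableTopology M]
    [SimplyConnectedSpace M] [LocallyPathConnectedSpace M] [T2Space (Quotient A.leafSetoid)]
    [T2Space (Quotient A.swap.leafSetoid)] (hA : A.LocallySimple) (hA' : A.swap.LocallySimple)
    (hR : A.IsCausalRel R) :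
    (∀ p, ¬ Relation.TransGen R p p) ∧ IsClosed {z : M × M | Relation.ReflTransGen R z.1 z.2} := by
  obtain ⟨f, hf⟩ := hA.exists_isHeight
  obtain ⟨f', hf'⟩ := hA'.exists_isHeight
  refine ⟨fun p ↦ hf.not_transGen hf' hR, ?_⟩
  simp only [hf.causal_iff hf' hR]
  exact (isClosed_le (hf.1.comp continuous_fst) (hf.1.comp continuous_snd)).inter
    (isClosed_le (hf'.1.comp continuous_fst) (hf'.1.comp continuous_snd))

end Hausdorff

end NullAtlas

namespace Spacetime

/-! ### The differential of null coordinates -/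

section Differential

variable {M : Type*} [TopologicalSpace M]
  [ChartedSpace (EuclideanSpace ℝ (Fin 2)) M] [IsManifold (𝓡 2) ∞ M]
  {g : LorentzianMetric 2 M} {T : TimeOrientation g} {B B' B'' : NullBox T} {x : M}

namespace NullBox

/-- The differential `(du, dv)` of the null coordinates. -/
def diff (B : NullBox T) (x : M) : TangentSpace (𝓡 2) x →L[ℝ] ℝ × ℝ :=
  mfderiv (𝓡 2) 𝓘(ℝ, ℝ × ℝ) B.chart x

/-- The tangent vector at a point of the box with given coordinates. -/
def vec (B : NullBox T) (x : M) (w : ℝ × ℝ) : TangentSpace (𝓡 2) x := (B.diff x).inverse w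

theorem contMDiffAt (B : NullBox T) (hx : x ∈ B.chart.source) :
    ContMDiffAt (𝓡 2) 𝓘(ℝ, ℝ × ℝ) ∞ B.chart x :=
  B.contMDiffOn.contMDiffAt (B.chart.open_source.mem_nhds hx)

theorem contMDiffAt_symm (B : NullBox T) {p : ℝ × ℝ} (hp : p ∈ B.chart.target) :
    ContMDiffAt 𝓘(ℝ, ℝ × ℝ) (𝓡 2) ∞ B.chart.symm p :=
  B.contMDiffOn_symm.contMDiffAt (B.chart.open_target.mem_nhds hp)

theorem hasMFDerivAt (B : NullBox T) (hx : x ∈ B.chart.source) :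
    HasMFDerivAt (𝓡 2) 𝓘(ℝ, ℝ × ℝ) B.chart x (B.diff x) :=
  ((B.contMDiffAt hx).mdifferentiableAt (by simp)).hasMFDerivAt

theorem isInvertible_diff (B : NullBox T) (hx : x ∈ B.chart.source) :
    (B.diff x).IsInvertible := by
  obtain ⟨p, hp, rfl⟩ : ∃ p ∈ B.chart.target, B.chart.symm p = x :=
    ⟨_, B.chart.map_source hx, B.chart.left_inv hx⟩
  let S : ℝ × ℝ →L[ℝ] TangentSpace (𝓡 2) (B.chart.symm p) :=
    mfderiv 𝓘(ℝ, ℝ × ℝ) (𝓡 2) B.chart.symm p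
  exact ⟨ContinuousLinearEquiv.equivOfInverse (B.diff _) S
    (mfderiv_symm_mfderiv B.contMDiffOn B.contMDiffOn_symm hp)
    (mfderiv_mfderiv_symm B.contMDiffOn B.contMDiffOn_symm hp), rfl⟩

theorem diff_vec (B : NullBox T) (hx : x ∈ B.chart.source) (w : ℝ × ℝ) :
    B.diff x (B.vec x w) = w := by
  obtain ⟨e, he⟩ := B.isInvertible_diff hx
  rw [vec, ← he, ContinuousLinearMap.inverse_equiv]
  exact e.apply_symm_apply w

theorem vec_diff (B : NullBox T) (hx : x ∈ B.chart.source) (v : TangentSpace (𝓡 2) x) :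
    B.vec x (B.diff x v) = v := by
  obtain ⟨e, he⟩ := B.isInvertible_diff hx
  rw [vec, ← he, ContinuousLinearMap.inverse_equiv]
  exact e.symm_apply_apply v

theorem vec_add (B : NullBox T) (x : M) (w w' : ℝ × ℝ) :
    B.vec x (w + w') = B.vec x w + B.vec x w' := map_add _ _ _

theorem vec_smul (B : NullBox T) (x : M) (c : ℝ) (w : ℝ × ℝ) :
    B.vec x (c • w) = c • B.vec x w := map_smul _ _ _

theorem diff_injective (B : NullBox T) (hx : x ∈ B.chart.source) :
    Function.Injective (B.diff x) :=
  Function.LeftInverse.injective (B.vec_diff hx)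

theorem mfderiv_chart_symm (B : NullBox T) {p : ℝ × ℝ} (hp : p ∈ B.chart.target) (w : ℝ × ℝ) :
    mfderiv 𝓘(ℝ, ℝ × ℝ) (𝓡 2) B.chart.symm p w = B.vec (B.chart.symm p) w := by
  refine B.diff_injective (B.chart.map_target hp) ?_
  rw [B.diff_vec (B.chart.map_target hp)]
  exact mfderiv_mfderiv_symm B.contMDiffOn B.contMDiffOn_symm hp w

theorem contMDiffAt_vec (B : NullBox T) (hx : x ∈ B.chart.source) (w : ℝ × ℝ) :
    ContMDiffAt (𝓡 2) (𝓡 2).tangent ∞ (fun y ↦ (⟨y, B.vec y w⟩ : TangentBundle (𝓡 2) M)) x := by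
  have h1 := (contMDiffAt_mfderiv_const_vector (B.contMDiffAt_symm (B.chart.map_source hx)) w).comp
    x (B.contMDiffAt hx)
  refine h1.congr_of_eventuallyEq ?_
  filter_upwards [B.chart.open_source.mem_nhds hx] with y hy
  have hp := B.chart.map_source hy
  simp only [Function.comp_apply, B.mfderiv_chart_symm hp]
  rw [B.chart.left_inv hy]

theorem exists_metric_eq (B : NullBox T) (hx : x ∈ B.chart.source) :
    ∃ k > 0, ∀ v w : TangentSpace (𝓡 2) x, g.val x v w =
      -k * ((B.diff x v).1 * (B.diff x w).2 + (B.diff x v).2 * (B.diff x w).1) :=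
  (B.null x hx).1

theorem diff_field_pos (B : NullBox T) (hx : x ∈ B.chart.source) :
    0 < (B.diff x (T.field x)).1 ∧ 0 < (B.diff x (T.field x)).2 :=
  (B.null x hx).2

/-- A vector is future pointing if and only if its null components are nonnegative and do not both
vanish. -/
theorem isFuture_iff (B : NullBox T) (hx : x ∈ B.chart.source) {v : TangentSpace (𝓡 2) x} :
    T.IsFuture v ↔ 0 < B.diff x v := by
  obtain ⟨k, hk, h⟩ := B.exists_metric_eq hx
  obtain ⟨h1, h2⟩ := B.diff_field_pos hx
  rw [TimeOrientation.IsFuture, h, h]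
  generalize (B.diff x (T.field x)).1 = s at *
  generalize (B.diff x (T.field x)).2 = t at *
  have hv : v = 0 ↔ B.diff x v = 0 :=
    ⟨fun h ↦ by rw [h, map_zero], fun h ↦ B.diff_injective hx (h.trans (map_zero _).symm)⟩
  rw [Ne, hv]
  generalize B.diff x v = w
  obtain ⟨a, b⟩ := w
  simp only [neg_mul, neg_nonpos, neg_lt_zero, mul_pos_iff_of_pos_left hk,
    mul_nonneg_iff_of_pos_left hk, Prod.mk_eq_zero, Prod.lt_iff, Prod.fst_zero, Prod.snd_zero]
  constructor
  · rintro ⟨-, h3, h4⟩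
    rcases lt_trichotomy a 0 with ha | rfl | ha
    · have : b ≤ 0 := by nlinarith
      nlinarith
    · exact .inr ⟨le_rfl, by nlinarith⟩
    · exact .inl ⟨ha, by nlinarith⟩
  · rintro (⟨h3, h4⟩ | ⟨h3, h4⟩)
    · exact ⟨fun h ↦ h3.ne' h.1, by positivity, by positivity⟩
    · exact ⟨fun h ↦ h4.ne' h.2, by positivity, by positivity⟩

/-! ### Orientation of null boxes -/

/-- At `x`, the differentials of the respective coordinates of the two boxes are positive multiples
of each other. -/
def SameAt (B B' : NullBox T) (x : M) : Prop :=
  ∃ a > 0, ∃ d > 0, ∀ v, B'.diff x v = (a * (B.diff x v).1, d * (B.diff x v).2)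

/-- At `x`, the differentials of the coordinates of one box are positive multiples of those of the
other box in the opposite order. -/
def CrossAt (B B' : NullBox T) (x : M) : Prop :=
  ∃ a > 0, ∃ d > 0, ∀ v, B'.diff x v = (a * (B.diff x v).2, d * (B.diff x v).1)

theorem SameAt.symm (h : B.SameAt B' x) : B'.SameAt B x := by
  obtain ⟨a, ha, d, hd, h⟩ := h
  refine ⟨a⁻¹, by positivity, d⁻¹, by positivity, fun v ↦ ?_⟩
  rw [h]
  ext <;> simp [ha.ne', hd.ne']

theorem SameAt.trans (h : B.SameAt B' x) (h' : B'.SameAt B'' x) : B.SameAt B'' x := by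
  obtain ⟨a, ha, d, hd, h⟩ := h
  obtain ⟨a', ha', d', hd', h'⟩ := h'
  refine ⟨a' * a, by positivity, d' * d, by positivity, fun v ↦ ?_⟩
  rw [h', h, mul_assoc, mul_assoc]

theorem CrossAt.trans (h : B.CrossAt B' x) (h' : B'.CrossAt B'' x) : B.SameAt B'' x := by
  obtain ⟨a, ha, d, hd, h⟩ := h
  obtain ⟨a', ha', d', hd', h'⟩ := h'
  refine ⟨a' * d, by positivity, d' * a, by positivity, fun v ↦ ?_⟩
  rw [h', h, mul_assoc, mul_assoc]

theorem SameAt.not_crossAt (hx : x ∈ B.chart.source) (h : B.SameAt B' x) : ¬ B.CrossAt B' x := by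
  rintro ⟨a', ha', d', hd', h'⟩
  obtain ⟨a, ha, d, hd, h⟩ := h
  have h1 := (h (B.vec x (1, 0))).symm.trans (h' (B.vec x (1, 0)))
  rw [B.diff_vec hx] at h1
  simp [ha.ne'] at h1

/-- Two null boxes are equally or oppositely oriented: the null cone consists of two lines, and the
time orientation fixes the signs. -/
theorem sameAt_or_crossAt (hx : x ∈ B.chart.source) (hx' : x ∈ B'.chart.source) :
    B.SameAt B' x ∨ B.CrossAt B' x := by
  obtain ⟨k, hk, h⟩ := B.exists_metric_eq hx
  obtain ⟨k', hk', h'⟩ := B'.exists_metric_eq hx'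
  obtain ⟨h1, h2⟩ := B.diff_field_pos hx
  obtain ⟨h1', h2'⟩ := B'.diff_field_pos hx'
  let P := B'.diff x (B.vec x (1, 0))
  let Q := B'.diff x (B.vec x (0, 1))
  have hPQ (v : TangentSpace (𝓡 2) x) : B'.diff x v = (B.diff x v).1 • P + (B.diff x v).2 • Q := by
    conv_lhs => rw [← B.vec_diff hx v]
    have : B.diff x v = (B.diff x v).1 • ((1 : ℝ), (0 : ℝ)) + (B.diff x v).2 • ((0 : ℝ), (1 : ℝ)) := by
      ext <;> simp
    conv_lhs => rw [this]
    rw [vec_add, vec_smul, vec_smul, map_add, map_smul, map_smul]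
  have e11 := (h (B.vec x (1, 0)) (B.vec x (1, 0))).symm.trans
    (h' (B.vec x (1, 0)) (B.vec x (1, 0)))
  have e12 := (h (B.vec x (1, 0)) (B.vec x (0, 1))).symm.trans
    (h' (B.vec x (1, 0)) (B.vec x (0, 1)))
  have e22 := (h (B.vec x (0, 1)) (B.vec x (0, 1))).symm.trans
    (h' (B.vec x (0, 1)) (B.vec x (0, 1)))
  rw [hPQ] at h1' h2'
  rw [SameAt, CrossAt]
  simp only [hPQ]
  simp only [B.diff_vec hx] at e11 e12 e22
  change _ = -k' * (P.1 * P.2 + P.2 * P.1) at e11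
  change _ = -k' * (P.1 * Q.2 + P.2 * Q.1) at e12
  change _ = -k' * (Q.1 * Q.2 + Q.2 * Q.1) at e22
  generalize (B.diff x (T.field x)).1 = s at *
  generalize (B.diff x (T.field x)).2 = t at *
  obtain ⟨a, c⟩ := P
  obtain ⟨b, d⟩ := Q
  simp only [Prod.smul_mk, smul_eq_mul, Prod.mk_add_mk] at *
  have hac : a * c = 0 := by
    have : k' * (a * c) = 0 := by linarith
    exact (mul_eq_zero.1 this).resolve_left hk'.ne'
  have hbd : b * d = 0 := by
    have : k' * (b * d) = 0 := by linarith
    exact (mul_eq_zero.1 this).resolve_left hk'.ne'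
  have hk0 : 0 < k' * (a * d + c * b) := by linarith
  have hpos : 0 < a * d + c * b := pos_of_mul_pos_right hk0 hk'.le
  rcases mul_eq_zero.1 hac with rfl | rfl
  · have hb : b ≠ 0 := by rintro rfl; simp at hpos
    obtain rfl := (mul_eq_zero.1 hbd).resolve_left hb
    refine .inr ⟨b, ?_, c, ?_, fun v ↦ by ext <;> simp [mul_comm]⟩
    · exact pos_of_mul_pos_right (by linarith) h2.le
    · exact pos_of_mul_pos_right (by linarith) h1.le
  · have hd : d ≠ 0 := by rintro rfl; simp at hpos
    obtain rfl := (mul_eq_zero.1 hbd).resolve_right hd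
    refine .inl ⟨a, ?_, d, ?_, fun v ↦ by ext <;> simp [mul_comm]⟩
    · exact pos_of_mul_pos_right (by linarith) h1.le
    · exact pos_of_mul_pos_right (by linarith) h2.le

theorem continuousAt_diff_vec (B' : NullBox T) (hx : x ∈ B.chart.source)
    (hx' : x ∈ B'.chart.source) (w : ℝ × ℝ) :
    ContinuousAt (fun y ↦ B'.diff y (B.vec y w)) x :=
  (contMDiffAt_mfderiv_apply (b := id) (B'.contMDiffAt hx') (B.contMDiffAt_vec hx w)).continuousAt

theorem SameAt.eventually (hx : x ∈ B.chart.source) (hx' : x ∈ B'.chart.source)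
    (h : B.SameAt B' x) : ∀ᶠ y in 𝓝 x, B.SameAt B' y := by
  have h1 : 0 < (B'.diff x (B.vec x (1, 0))).1 := by
    obtain ⟨a, ha, d, hd, h⟩ := h
    rw [h, B.diff_vec hx]
    simpa using ha
  filter_upwards [(continuousAt_diff_vec B' hx hx' (1, 0)).fst.eventually (lt_mem_nhds h1),
    B.chart.open_source.mem_nhds hx, B'.chart.open_source.mem_nhds hx'] with y hy hyB hyB'
  refine (sameAt_or_crossAt hyB hyB').resolve_right fun ⟨a, ha, d, hd, h⟩ ↦ ?_
  rw [h, B.diff_vec hyB] at hy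
  simp at hy

theorem CrossAt.eventually (hx : x ∈ B.chart.source) (hx' : x ∈ B'.chart.source)
    (h : B.CrossAt B' x) : ∀ᶠ y in 𝓝 x, B.CrossAt B' y := by
  have h1 : 0 < (B'.diff x (B.vec x (1, 0))).2 := by
    obtain ⟨a, ha, d, hd, h⟩ := h
    rw [h, B.diff_vec hx]
    simpa using hd
  filter_upwards [(continuousAt_diff_vec B' hx hx' (1, 0)).snd.eventually (lt_mem_nhds h1),
    B.chart.open_source.mem_nhds hx, B'.chart.open_source.mem_nhds hx'] with y hy hyB hyB'
  refine (sameAt_or_crossAt hyB hyB').resolve_left fun ⟨a, ha, d, hd, h⟩ ↦ ?_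
  rw [h, B.diff_vec hyB] at hy
  simp at hy

/-- The box with the coordinates interchanged. -/
def swap (B : NullBox T) : NullBox T where
  chart := B.chart.transHomeomorph (Homeomorph.prodComm ℝ ℝ)
  square := by
    obtain ⟨p, r, h⟩ := B.square
    refine ⟨p.swap, r, ?_⟩
    ext q
    change q.swap ∈ B.chart.target ↔ _
    rw [h, ← ball_prod_same, ← ball_prod_same]
    exact and_comm
  contMDiffOn := (contDiff_snd.prodMk contDiff_fst).contMDiff.comp_contMDiffOn B.contMDiffOn
  contMDiffOn_symm := B.contMDiffOn_symm.comp
    (contDiff_snd.prodMk contDiff_fst).contMDiff.contMDiffOn fun p hp ↦ hp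
  null x hx := by
    have h1 := ((ContinuousLinearEquiv.prodComm ℝ ℝ ℝ).toContinuousLinearMap.hasFDerivAt
      (x := B.chart x)).hasMFDerivAt.comp x (B.hasMFDerivAt hx)
    have h2 (v : TangentSpace (𝓡 2) x) : (mfderiv (𝓡 2) 𝓘(ℝ, ℝ × ℝ)
        (B.chart.transHomeomorph (Homeomorph.prodComm ℝ ℝ)) x v : ℝ × ℝ) = (B.diff x v).swap :=
      congrArg (fun L ↦ L v) h1.mfderiv
    obtain ⟨k, hk, h⟩ := B.exists_metric_eq hx
    refine ⟨⟨k, hk, fun v w ↦ ?_⟩, ?_, ?_⟩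
    · rw [h, h2, h2]
      simp only [Prod.fst_swap, Prod.snd_swap]
      ring
    · rw [h2]
      exact (B.diff_field_pos hx).2
    · rw [h2]
      exact (B.diff_field_pos hx).1

theorem swap_diff (hx : x ∈ B.chart.source) (v : TangentSpace (𝓡 2) x) :
    B.swap.diff x v = (B.diff x v).swap := by
  have h1 := ((ContinuousLinearEquiv.prodComm ℝ ℝ ℝ).toContinuousLinearMap.hasFDerivAt
    (x := B.chart x)).hasMFDerivAt.comp x (B.hasMFDerivAt hx)
  exact congrArg (fun L ↦ L v) h1.mfderiv

theorem crossAt_swap (hx : x ∈ B.chart.source) : B.CrossAt B.swap x :=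
  ⟨1, one_pos, 1, one_pos, fun v ↦ by rw [swap_diff hx]; simp [Prod.swap]⟩

/-- Near a point at which they are equally oriented, the first coordinates of two boxes define the
same preorder, and so do the second coordinates. -/
theorem exists_le_iff (hx : x ∈ B.chart.source) (hx' : x ∈ B'.chart.source)
    (h : ∀ y ∈ B.chart.source, y ∈ B'.chart.source → B.SameAt B' y) :
    ∃ W ∈ 𝓝 x, ∀ y ∈ W, ∀ z ∈ W,
      ((B.chart y).1 ≤ (B.chart z).1 ↔ (B'.chart y).1 ≤ (B'.chart z).1) ∧
      ((B.chart y).2 ≤ (B.chart z).2 ↔ (B'.chart y).2 ≤ (B'.chart z).2) := by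
  have hxT := B.chart.map_source hx
  have h1 : B.chart.target ∩ B.chart.symm ⁻¹' B'.chart.source ∈ 𝓝 (B.chart x) :=
    inter_mem (B.chart.open_target.mem_nhds hxT) ((B.chart.continuousAt_symm hxT)
      (B'.chart.open_source.mem_nhds (by rwa [B.chart.left_inv hx])))
  obtain ⟨r, hr, hball⟩ := Metric.mem_nhds_iff.1 h1
  let Φ (p : ℝ × ℝ) : ℝ × ℝ := B'.chart (B.chart.symm p)
  have hΦ : ∀ p ∈ Metric.ball (B.chart x) r, ∃ L : ℝ × ℝ →L[ℝ] ℝ × ℝ, HasFDerivAt Φ L p ∧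
      ∃ a > 0, ∃ d > 0, ∀ w, L w = (a * w.1, d * w.2) := fun p hp ↦ by
    have hp1 := (hball hp).1
    have hp2 : B.chart.symm p ∈ B'.chart.source := (hball hp).2
    have h2 := (B'.hasMFDerivAt hp2).comp p
      ((B.contMDiffAt_symm hp1).mdifferentiableAt (by simp)).hasMFDerivAt
    obtain ⟨a, ha, d, hd, h3⟩ := h _ (B.chart.map_target hp1) hp2
    refine ⟨_, h2.hasFDerivAt, a, ha, d, hd, fun w ↦ ?_⟩
    have h4 : B.diff (B.chart.symm p) (mfderiv 𝓘(ℝ, ℝ × ℝ) (𝓡 2) B.chart.symm p w) = w := by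
      rw [B.mfderiv_chart_symm hp1, B.diff_vec (B.chart.map_target hp1)]
    exact (h3 _).trans (congrArg (fun w : ℝ × ℝ ↦ (a * w.1, d * w.2)) h4)
  choose! L hL a ha d hd hLad using hΦ
  -- the transition function has a positive diagonal derivative, so the mean value theorem applies
  have hconv := convex_ball (B.chart x) r
  have key : ∀ p ∈ Metric.ball (B.chart x) r, ∀ q ∈ Metric.ball (B.chart x) r,
      (p.1 ≤ q.1 ↔ (Φ p).1 ≤ (Φ q).1) ∧ (p.2 ≤ q.2 ↔ (Φ p).2 ≤ (Φ q).2) := by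
    intro p hp q hq
    obtain ⟨z, hz, h2⟩ := domain_mvt (f := fun p ↦ (Φ p).1)
      (fun z hz ↦ (hL z hz).fst.hasFDerivWithinAt) hconv hp hq
    obtain ⟨z', hz', h3⟩ := domain_mvt (f := fun p ↦ (Φ p).2)
      (fun z hz ↦ (hL z hz).snd.hasFDerivWithinAt) hconv hp hq
    have hz := hconv.segment_subset hp hq hz
    have hz' := hconv.segment_subset hp hq hz'
    simp only [ContinuousLinearMap.comp_apply, hLad _ hz, hLad _ hz', ContinuousLinearMap.coe_fst',
      ContinuousLinearMap.coe_snd', Prod.fst_sub, Prod.snd_sub] at h2 h3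
    rw [← sub_nonneg, ← sub_nonneg (a := (Φ q).1), ← sub_nonneg (b := p.2),
      ← sub_nonneg (a := (Φ q).2), h2, h3, mul_nonneg_iff_of_pos_left (ha z hz),
      mul_nonneg_iff_of_pos_left (hd z' hz')]
    exact ⟨Iff.rfl, Iff.rfl⟩
  refine ⟨B.chart.source ∩ B.chart ⁻¹' Metric.ball (B.chart x) r, inter_mem
    (B.chart.open_source.mem_nhds hx) ((B.chart.continuousAt hx) (Metric.ball_mem_nhds _ hr)), ?_⟩
  rintro y ⟨hy, hyr⟩ z ⟨hz, hzr⟩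
  have h2 := key _ hyr _ hzr
  simp only [Φ, B.chart.left_inv hy, B.chart.left_inv hz] at h2
  exact h2

end NullBox

end Differential

end Spacetime

namespace Spacetime

section Orientation

variable {M : Type*} [TopologicalSpace M]
  [ChartedSpace (EuclideanSpace ℝ (Fin 2)) M] [IsManifold (𝓡 2) ∞ M]
  {g : LorentzianMetric 2 M} {T : TimeOrientation g} {B B' B'' : NullBox T} {x : M}

theorem NullBox.exists_restrict (B : NullBox T) (hx : x ∈ B.chart.source) {O : Set M}
    (hO : O ∈ 𝓝 x) : ∃ B' : NullBox T, x ∈ B'.chart.source ∧ B'.chart.source ⊆ O ∧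
      B'.chart.source ⊆ B.chart.source ∧ ∀ y, B'.chart y = B.chart y := by
  obtain ⟨B', h1, h2, h3, h4⟩ := exists_nullBox_of_chart B.chart B.contMDiffOn B.contMDiffOn_symm
    hx hO fun y _ hy ↦ B.null y hy
  exact ⟨B', h2, h3, h4, h1⟩

theorem NullBox.diff_eq_of_eq (h : ∀ y, B'.chart y = B.chart y) : B'.diff x = B.diff x := by
  have : (B'.chart : M → ℝ × ℝ) = B.chart := funext h
  let D (f : M → ℝ × ℝ) : TangentSpace (𝓡 2) x →L[ℝ] ℝ × ℝ := mfderiv (𝓡 2) 𝓘(ℝ, ℝ × ℝ) f x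
  exact congrArg D this

/-- A choice of equally oriented null boxes around all points; it tells the two null foliations
apart. -/
structure OrientedAtlas (T : TimeOrientation g) where
  /-- The boxes. -/
  boxes : Set (NullBox T)
  exists_mem : ∀ x, ∃ B ∈ boxes, x ∈ B.chart.source
  exists_restrict : ∀ B ∈ boxes, ∀ x ∈ B.chart.source, ∀ O ∈ 𝓝 x, ∃ B' ∈ boxes,
    x ∈ B'.chart.source ∧ B'.chart.source ⊆ O ∧ B'.chart.source ⊆ B.chart.source ∧
      ∀ y, B'.chart y = B.chart y
  same : ∀ B ∈ boxes, ∀ B' ∈ boxes, ∀ x ∈ B.chart.source, x ∈ B'.chart.source → B.SameAt B' x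

/-- Simply connected Lorentzian surfaces are orientable: the two possible orientations of a box
form a double cover. -/
theorem exists_orientedAtlas [SimplyConnectedSpace M] (T : TimeOrientation g) :
    Nonempty (OrientedAtlas T) := by
  classical
  have := ChartedSpace.locallyPathConnectedSpace (EuclideanSpace ℝ (Fin 2)) M
  have hbox (x : M) : ∃ B : NullBox T, x ∈ B.chart.source :=
    let ⟨B, hB, _⟩ := exists_nullBox T x univ_mem
    ⟨B, hB⟩
  choose ref hxref using hbox
  -- the orientation of a box, relative to an arbitrary choice of orientations of all tangent planes
  let f (B : NullBox T) (x : M) : ZMod 2 := if (ref x).SameAt B x then 0 else 1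
  have hsame {B B' : NullBox T} {y : M} (h : B.SameAt B' y) : f B y = f B' y := by
    have : (ref y).SameAt B y ↔ (ref y).SameAt B' y := ⟨fun h' ↦ h'.trans h, fun h' ↦ h'.trans h.symm⟩
    simp only [f, this]
  have hcross {B B' : NullBox T} {y : M} (hy : y ∈ B.chart.source) (hy' : y ∈ B'.chart.source)
      (h : B.CrossAt B' y) : f B y = f B' y + 1 := by
    rcases NullBox.sameAt_or_crossAt (hxref y) hy with h1 | h1
    · have h2 : ¬ (ref y).SameAt B' y := fun h2 ↦ (h1.symm.trans h2).not_crossAt hy h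
      simp only [f, if_pos h1, if_neg h2]
      decide
    · have h2 : ¬ (ref y).SameAt B y := fun h2 ↦ h2.not_crossAt (hxref y) h1
      simp only [f, if_pos (h1.trans h), if_neg h2, zero_add]
  have hglue : ∀ i j : NullBox T, ∀ x ∈ i.chart.source ∩ j.chart.source, ∀ᶠ y in 𝓝 x,
      f i y - f j y = f i x - f j x := by
    rintro i j x ⟨hi, hj⟩
    rcases NullBox.sameAt_or_crossAt hi hj with h | h
    · filter_upwards [h.eventually hi hj] with y hy
      rw [hsame hy, hsame h, sub_self, sub_self]
    · filter_upwards [h.eventually hi hj, i.chart.open_source.mem_nhds hi,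
        j.chart.open_source.mem_nhds hj] with y hy hyi hyj
      rw [hcross hyi hyj hy, hcross hi hj h]
      ring
  obtain ⟨F, hF⟩ := exists_glue_of_simplyConnected (fun B : NullBox T ↦ B.chart.source)
    (fun B ↦ B.chart.open_source) (fun x ↦ ⟨ref x, hxref x⟩) f hglue
  have hres {B B' : NullBox T} (h : ∀ y, B'.chart y = B.chart y) (y : M) : f B' y = f B y :=
    hsame ⟨1, one_pos, 1, one_pos, fun v ↦ by rw [NullBox.diff_eq_of_eq h]; simp⟩
  -- `F` is an orientation that is continuous, and the atlas consists of the boxes that agree with it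
  refine ⟨{B | ∀ x ∈ B.chart.source, F x = f B x}, fun x ↦ ?_, fun B hB x hx O hO ↦ ?_,
    fun B hB B' hB' x hx hx' ↦ ?_⟩
  · obtain ⟨B, hxB, hBF, -, hBe⟩ := (ref x).exists_restrict (hxref x) (hF (ref x) x (hxref x))
    have h2 : F x - f (ref x) x = 0 ∨ F x - f (ref x) x = 1 := by
      generalize F x - f (ref x) x = a
      revert a
      decide
    rcases h2 with h2 | h2
    · refine ⟨B, fun y hy ↦ ?_, hxB⟩
      rw [hres hBe]
      exact sub_eq_zero.1 ((hBF hy).trans h2)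
    · refine ⟨B.swap, fun y hy ↦ ?_, hxB⟩
      have h3 := hcross (B := B) (B' := B.swap) hy hy (NullBox.crossAt_swap hy)
      have h4 : F y - f (ref x) y = 1 := (hBF hy).trans h2
      rw [hres hBe] at h3
      rw [← sub_add_cancel (F y) (f (ref x) y), h4, h3]
      generalize f B.swap y = a
      revert a
      decide
  · obtain ⟨B', h1, h2, h3, h4⟩ := B.exists_restrict hx hO
    exact ⟨B', fun y hy ↦ (hB y (h3 hy)).trans (hres h4 y).symm, h1, h2, h3, h4⟩
  · refine (NullBox.sameAt_or_crossAt hx hx').resolve_right fun h ↦ ?_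
    have h1 := hcross hx hx' h
    rw [← hB x hx, ← hB' x hx'] at h1
    simp at h1

end Orientation

section OrientedAtlas

variable {M : Type*} [TopologicalSpace M]
  [ChartedSpace (EuclideanSpace ℝ (Fin 2)) M] [IsManifold (𝓡 2) ∞ M]
  {g : LorentzianMetric 2 M} {T : TimeOrientation g} {B B' B'' : NullBox T} {x y : M}

namespace OrientedAtlas

/-- The atlas with the other orientation. -/
def swap (𝒜 : OrientedAtlas T) : OrientedAtlas T where
  boxes := NullBox.swap '' 𝒜.boxes
  exists_mem x := by
    obtain ⟨B, hB, hx⟩ := 𝒜.exists_mem x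
    exact ⟨_, mem_image_of_mem _ hB, hx⟩
  exists_restrict := by
    rintro _ ⟨B, hB, rfl⟩ x hx O hO
    obtain ⟨B', hB', h1, h2, h3, h4⟩ := 𝒜.exists_restrict B hB x hx O hO
    exact ⟨_, mem_image_of_mem _ hB', h1, h2, h3, fun y ↦ congrArg Prod.swap (h4 y)⟩
  same := by
    rintro _ ⟨B, hB, rfl⟩ _ ⟨B', hB', rfl⟩ x hx hx'
    have h1 := NullBox.crossAt_swap (B := B) hx
    have h2 := NullBox.crossAt_swap (B := B') hx'
    obtain ⟨a, ha, d, hd, h⟩ := 𝒜.same B hB B' hB' x hx hx'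
    refine ⟨d, hd, a, ha, fun v ↦ ?_⟩
    rw [NullBox.swap_diff (B := B') hx', NullBox.swap_diff (B := B) hx, h]
    rfl

/-- The pair of transverse foliations given by an oriented atlas. -/
def toNullAtlas (𝒜 : OrientedAtlas T) : NullAtlas M where
  boxes := NullBox.chart '' 𝒜.boxes
  square := by
    rintro _ ⟨B, hB, rfl⟩
    exact B.square
  exists_mem x := by
    obtain ⟨B, hB, hx⟩ := 𝒜.exists_mem x
    exact ⟨_, mem_image_of_mem _ hB, hx⟩
  exists_restrict := by
    rintro _ ⟨B, hB, rfl⟩ x hx O hO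
    obtain ⟨B', hB', h⟩ := 𝒜.exists_restrict B hB x hx O hO
    exact ⟨_, mem_image_of_mem _ hB', h⟩
  compat_fst := by
    rintro _ ⟨B, hB, rfl⟩ _ ⟨B', hB', rfl⟩ x hx hx'
    obtain ⟨W, hW, h⟩ := NullBox.exists_le_iff hx hx' (𝒜.same B hB B' hB')
    exact ⟨W, hW, fun y hy z hz ↦ (h y hy z hz).1⟩
  compat_snd := by
    rintro _ ⟨B, hB, rfl⟩ _ ⟨B', hB', rfl⟩ x hx hx'
    obtain ⟨W, hW, h⟩ := NullBox.exists_le_iff hx hx' (𝒜.same B hB B' hB')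
    exact ⟨W, hW, fun y hy z hz ↦ (h y hy z hz).2⟩

theorem swap_toNullAtlas (𝒜 : OrientedAtlas T) : 𝒜.swap.toNullAtlas = 𝒜.toNullAtlas.swap := by
  have : 𝒜.swap.toNullAtlas.boxes = 𝒜.toNullAtlas.swap.boxes := by
    change NullBox.chart '' (NullBox.swap '' 𝒜.boxes) = _ '' (NullBox.chart '' 𝒜.boxes)
    rw [image_image, image_image]
    rfl
  generalize 𝒜.swap.toNullAtlas = A at *
  generalize 𝒜.toNullAtlas.swap = A' at *
  cases A
  cases A'
  cases this
  rfl

end OrientedAtlas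

/-- In a null box, the straight line between two points is a future pointing causal curve if the
coordinates of the second point are not smaller than those of the first. -/
theorem NullBox.causalStep (B : NullBox T) (hx : x ∈ B.chart.source) (hy : y ∈ B.chart.source)
    (h : B.chart x < B.chart y) : T.CausalStep x y := by
  let c (t : ℝ) : ℝ × ℝ := B.chart x + t • (B.chart y - B.chart x)
  have hc : ∀ t ∈ Icc (0 : ℝ) 1, c t ∈ B.chart.target := fun t ht ↦ by
    obtain ⟨p, r, hpr⟩ := B.square
    have h1 := B.chart.map_source hx
    have h2 := B.chart.map_source hy
    rw [hpr] at h1 h2 ⊢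
    exact (convex_ball p r).add_smul_sub_mem h1 h2 ht
  have hcd (t : ℝ) : HasDerivAt c (B.chart y - B.chart x) t := by
    have := ((hasDerivAt_id t).smul_const (B.chart y - B.chart x)).const_add (B.chart x)
    rwa [one_smul] at this
  have hcs : ContDiff ℝ ∞ c := contDiff_const.add (contDiff_id.smul contDiff_const)
  refine ⟨fun t ↦ B.chart.symm (c t), ?_, ?_, ?_, fun t ht ↦ ?_⟩
  · simp [c, B.chart.left_inv hx]
  · simp [c, B.chart.left_inv hy]
  · exact B.contMDiffOn_symm.comp hcs.contMDiff.contMDiffOn hc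
  · have h1 := ((B.contMDiffAt_symm (hc t ht)).mdifferentiableAt (by simp)).hasMFDerivAt.comp t
      (hcd t).hasFDerivAt.hasMFDerivAt
    have h2 := (h1.hasMFDerivWithinAt (s := Icc 0 1)).mfderivWithin
      ((uniqueDiffOn_Icc zero_lt_one).uniqueMDiffOn t ht)
    have h3 : (mfderivWithin 𝓘(ℝ, ℝ) (𝓡 2) (fun t ↦ B.chart.symm (c t)) (Icc 0 1) t (1 : ℝ) :
        TangentSpace (𝓡 2) (B.chart.symm (c t))) =
        B.vec (B.chart.symm (c t)) (B.chart y - B.chart x) := by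
      refine (congrArg (fun L ↦ L (1 : ℝ)) h2).trans ?_
      rw [← B.mfderiv_chart_symm (hc t ht)]
      exact congrArg (mfderiv 𝓘(ℝ, ℝ × ℝ) (𝓡 2) B.chart.symm (c t)) (one_smul ℝ _)
    rw [h3, B.isFuture_iff (B.chart.map_target (hc t ht)),
      B.diff_vec (B.chart.map_target (hc t ht))]
    exact sub_pos.2 h

/-- Along a future pointing causal curve the coordinates of a null box are nondecreasing and not
both constant. -/
theorem NullBox.exists_lt (B : NullBox T) {γ : ℝ → M}
    (hγ : ContMDiffOn 𝓘(ℝ, ℝ) (𝓡 2) ∞ γ (Icc 0 1))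
    (hγT : ∀ t ∈ Icc (0 : ℝ) 1, T.IsFuture
      (mfderivWithin 𝓘(ℝ, ℝ) (𝓡 2) γ (Icc 0 1) t (1 : ℝ) : TangentSpace (𝓡 2) (γ t)))
    {t : ℝ} (ht : t ∈ Icc (0 : ℝ) 1) (htB : γ t ∈ B.chart.source) :
    ∃ N ∈ 𝓝[Icc 0 1] t, ∀ s ∈ N, ∀ s' ∈ N, s < s' → B.chart (γ s) < B.chart (γ s') := by
  obtain ⟨ε, hε, hsub⟩ := Metric.mem_nhdsWithin_iff.1
    ((hγ.continuousOn t ht) (B.chart.open_source.mem_nhds htB))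
  let N := Metric.ball t ε ∩ Icc (0 : ℝ) 1
  have hNI : interior N ⊆ N := interior_subset
  have hconv : Convex ℝ N := (convex_ball t ε).inter (convex_Icc 0 1)
  have hd : ∀ s ∈ N, ∃ w : ℝ × ℝ, HasDerivWithinAt (fun s ↦ B.chart (γ s)) w N s ∧ 0 < w := by
    intro s hs
    have hsB : γ s ∈ B.chart.source := hsub hs
    have h1 := (B.hasMFDerivAt hsB).comp_hasMFDerivWithinAt s
      ((hγ s hs.2).mdifferentiableWithinAt (by simp)).hasMFDerivWithinAt
    let L : ℝ →L[ℝ] ℝ × ℝ :=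
      (B.diff (γ s)).comp (mfderivWithin 𝓘(ℝ, ℝ) (𝓡 2) γ (Icc 0 1) s)
    have h2 : HasFDerivWithinAt (fun s ↦ B.chart (γ s)) L (Icc 0 1) s := h1.hasFDerivWithinAt
    refine ⟨L 1, h2.hasDerivWithinAt.mono inter_subset_right, ?_⟩
    exact (B.isFuture_iff hsB).1 (hγT s hs.2)
  choose! w hw hwpos using hd
  have hc : ContinuousOn (fun s ↦ B.chart (γ s)) N := fun s hs ↦ (hw s hs).continuousWithinAt
  have hw' : ∀ s ∈ interior N, HasDerivWithinAt (fun s ↦ B.chart (γ s)) (w s) (interior N) s :=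
    fun s hs ↦ (hw s (hNI hs)).mono hNI
  have hw1 : ∀ s ∈ interior N,
      HasDerivWithinAt (fun s ↦ (B.chart (γ s)).1) (w s).1 (interior N) s := fun s hs ↦
    (ContinuousLinearMap.fst ℝ ℝ ℝ).hasFDerivAt.comp_hasDerivWithinAt s (hw' s hs)
  have hw2 : ∀ s ∈ interior N,
      HasDerivWithinAt (fun s ↦ (B.chart (γ s)).2) (w s).2 (interior N) s := fun s hs ↦
    (ContinuousLinearMap.snd ℝ ℝ ℝ).hasFDerivAt.comp_hasDerivWithinAt s (hw' s hs)
  have hm1 : MonotoneOn (fun s ↦ (B.chart (γ s)).1) N :=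
    monotoneOn_of_hasDerivWithinAt_nonneg hconv hc.fst hw1
      fun s hs ↦ (hwpos s (hNI hs)).le.1
  have hm2 : MonotoneOn (fun s ↦ (B.chart (γ s)).2) N :=
    monotoneOn_of_hasDerivWithinAt_nonneg hconv hc.snd hw2
      fun s hs ↦ (hwpos s (hNI hs)).le.2
  have hm : StrictMonoOn (fun s ↦ (B.chart (γ s)).1 + (B.chart (γ s)).2) N := by
    refine strictMonoOn_of_hasDerivWithinAt_pos hconv (hc.fst.add hc.snd)
      (fun s hs ↦ (hw1 s hs).add (hw2 s hs)) fun s hs ↦ ?_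
    rcases Prod.lt_iff.1 (hwpos s (hNI hs)) with h | h
    · exact add_pos_of_pos_of_nonneg h.1 h.2
    · exact add_pos_of_nonneg_of_pos h.1 h.2
  refine ⟨N, Metric.mem_nhdsWithin_iff.2 ⟨ε, hε, Subset.rfl⟩, fun s hs s' hs' hss ↦ ?_⟩
  refine lt_of_le_not_ge ⟨hm1 hs hs' hss.le, hm2 hs hs' hss.le⟩ fun h ↦ ?_
  exact (hm hs hs' hss).not_ge (add_le_add h.1 h.2)

theorem OrientedAtlas.isCausalRel (𝒜 : OrientedAtlas T) :
    𝒜.toNullAtlas.IsCausalRel T.CausalStep := by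
  refine ⟨?_, fun x y ⟨γ, h0, h1, hγ, hγT⟩ ↦ ⟨γ, ⟨hγ.continuousOn, ?_⟩, h0, h1⟩⟩
  · rintro _ ⟨B, hB, rfl⟩ x hx y hy h
    exact B.causalStep hx hy h
  · rintro t ht _ ⟨B, hB, rfl⟩ htB
    exact B.exists_lt hγ hγT ht htB

end OrientedAtlas

end Spacetime

namespace Spacetime

/-! ### Calculus on the cotangent bundle -/

section CotangentCalculus

variable {n : ℕ} {M : Type*} [TopologicalSpace M]
  [ChartedSpace (EuclideanSpace ℝ (Fin n)) M] [IsManifold (𝓡 n) ∞ M]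

theorem extChartAt_cotangent (α β : Cotangent n M) :
    extChartAt (cotangentModel n) α β = (extChartAt (𝓡 n) α.proj β.proj, β.snd.comp
      ((trivializationAt (EuclideanSpace ℝ (Fin n)) (TangentSpace (𝓡 n)) α.proj).symmL ℝ
        β.proj)) := by
  rw [FiberBundle.extChartAt]
  refine Prod.ext rfl ?_
  change ContinuousLinearMap.inCoordinates (EuclideanSpace ℝ (Fin n)) (TangentSpace (𝓡 n)) ℝ
    (Bundle.Trivial M ℝ) α.proj β.proj α.proj β.proj β.snd = _
  ext v
  simp [ContinuousLinearMap.inCoordinates]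

theorem symmL_trivializationAt_self (x : M) :
    (trivializationAt (EuclideanSpace ℝ (Fin n)) (TangentSpace (𝓡 n)) x).symmL ℝ x =
      ContinuousLinearMap.id ℝ (EuclideanSpace ℝ (Fin n)) := by
  rw [TangentBundle.symmL_trivializationAt_eq_core (mem_chart_source _ x)]
  ext1 v
  exact (tangentBundleCore (𝓡 n) M).coordChange_self (achart _ x) x (mem_chart_source _ x) v

/-- The velocity of a straight line in a cotangent space, in the preferred chart. -/
theorem hasMFDerivAt_vertical (x : M) (φ ψ : EuclideanSpace ℝ (Fin n) →L[ℝ] ℝ) :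
    HasMFDerivAt 𝓘(ℝ, ℝ) (cotangentModel n) (fun t : ℝ ↦ (⟨x, φ + t • ψ⟩ : Cotangent n M)) 0
      ((1 : ℝ →L[ℝ] ℝ).smulRight
        ((0, ψ) : EuclideanSpace ℝ (Fin n) × (EuclideanSpace ℝ (Fin n) →L[ℝ] ℝ))) := by
  refine ⟨?_, ?_⟩
  · exact ((FiberBundle.continuous_totalSpaceMk (EuclideanSpace ℝ (Fin n) →L[ℝ] ℝ)
      (fun x : M ↦ TangentSpace (𝓡 n) x →L[ℝ] ℝ) x).comp
      (f := fun t : ℝ ↦ φ + t • ψ) (by fun_prop)).continuousAt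
  · have h1 : writtenInExtChartAt 𝓘(ℝ, ℝ) (cotangentModel n) 0
        (fun t : ℝ ↦ (⟨x, φ + t • ψ⟩ : Cotangent n M)) =
        fun t ↦ (extChartAt (𝓡 n) x x, φ + t • ψ) := by
      funext t
      refine (extChartAt_cotangent _ _).trans ?_
      exact congrArg (fun L ↦ (extChartAt (𝓡 n) x x, (φ + t • ψ).comp L))
        (symmL_trivializationAt_self x)
    rw [h1]
    refine HasFDerivAt.hasFDerivWithinAt ?_
    have h2 : HasDerivAt (fun t : ℝ ↦ φ + t • ψ) ((1 : ℝ) • ψ) 0 :=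
      ((hasDerivAt_id (0 : ℝ)).smul_const ψ).const_add φ
    rw [one_smul] at h2
    exact ((hasDerivAt_const (0 : ℝ) (extChartAt (𝓡 n) x x)).prodMk h2).hasFDerivAt

/-- The derivative of the section `df`, in the preferred chart: its vertical part is the second
derivative of `f` in a chart, hence symmetric. -/
theorem exists_hasMFDerivAt_differential {f : M → ℝ} {x : M}
    (hf : ContMDiffAt (𝓡 n) 𝓘(ℝ, ℝ) ∞ f x) :
    ∃ D : EuclideanSpace ℝ (Fin n) →L[ℝ] EuclideanSpace ℝ (Fin n) →L[ℝ] ℝ,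
      (∀ v w, D v w = D w v) ∧ HasMFDerivAt (𝓡 n) (cotangentModel n)
        (fun y ↦ (⟨y, mfderiv (𝓡 n) 𝓘(ℝ, ℝ) f y⟩ : Cotangent n M)) x
        ((ContinuousLinearMap.id ℝ (EuclideanSpace ℝ (Fin n))).prod D) := by
  let c := extChartAt (𝓡 n) x
  let h : EuclideanSpace ℝ (Fin n) → ℝ := f ∘ c.symm
  have hcx : c.target ∈ 𝓝 (c x) := extChartAt_target_mem_nhds x
  have hcs : ContMDiffAt 𝓘(ℝ, EuclideanSpace ℝ (Fin n)) (𝓡 n) ∞ c.symm (c x) :=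
    (contMDiffOn_extChartAt_symm x).contMDiffAt hcx
  have hh : ContDiffAt ℝ ∞ h (c x) := by
    have hf' : ContMDiffAt (𝓡 n) 𝓘(ℝ, ℝ) ∞ f (c.symm (c x)) := by
      rwa [extChartAt_to_inv x]
    exact (hf'.comp (c x) hcs).contDiffAt
  refine ⟨fderiv ℝ (fderiv ℝ h) (c x), fun v w ↦ ?_, (contMDiffAt_differential hf).continuousAt, ?_⟩
  · exact (hh.isSymmSndFDerivAt (by
      simpa using (WithTop.coe_le_coe.2 le_top : ((2 : ℕ∞) : ℕ∞ω) ≤ ∞))).eq v w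
  · have h1 : HasFDerivAt (fun z ↦ (z, fderiv ℝ h z)) ((ContinuousLinearMap.id ℝ
        (EuclideanSpace ℝ (Fin n))).prod (fderiv ℝ (fderiv ℝ h) (c x))) (c x) := by
      refine (hasFDerivAt_id _).prodMk (DifferentiableAt.hasFDerivAt ?_)
      exact (hh.fderiv_right (m := 1) (by norm_cast)).differentiableAt (by simp)
    refine (h1.congr_of_eventuallyEq ?_).hasFDerivWithinAt
    have h2 : ∀ᶠ y in 𝓝 x, ContMDiffAt (𝓡 n) 𝓘(ℝ, ℝ) 1 f y := by
      have h4 : ContMDiffAt (𝓡 n) 𝓘(ℝ, ℝ) 1 f x := hf.of_le (by norm_cast)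
      exact (contMDiffAt_iff_contMDiffAt_nhds (by simp)).1 h4
    have h3 : Tendsto c.symm (𝓝 (c x)) (𝓝 x) := by
      have := hcs.continuousAt
      rwa [ContinuousAt, extChartAt_to_inv x] at this
    filter_upwards [h3.eventually h2, hcx] with z hz hzt
    have hzs : c.symm z ∈ (chartAt (EuclideanSpace ℝ (Fin n)) x).source := by
      rw [← extChartAt_source (𝓡 n)]
      exact c.map_target hzt
    refine (extChartAt_cotangent _ _).trans (Prod.ext (c.right_inv hzt) ?_)
    have h4 := TangentBundle.symmL_trivializationAt (I := 𝓡 n) hzs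
    refine (congrArg (fun L ↦ (mfderiv (𝓡 n) 𝓘(ℝ, ℝ) f (c.symm z)).comp L) h4).trans ?_
    have h5 : extChartAt (𝓡 n) x (c.symm z) = z := c.right_inv hzt
    have h6 : MDifferentiableAt 𝓘(ℝ, EuclideanSpace ℝ (Fin n)) (𝓡 n) c.symm z :=
      ((contMDiffOn_extChartAt_symm (n := ∞) x).contMDiffAt
        (extChartAt_target_mem_nhds' hzt)).mdifferentiableAt (by simp)
    have h7 := (hz.mdifferentiableAt (by simp)).hasMFDerivAt.comp z h6.hasMFDerivAt
    have h8 : (mfderiv (𝓡 n) 𝓘(ℝ, ℝ) f (c.symm z)).comp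
        (mfderiv 𝓘(ℝ, EuclideanSpace ℝ (Fin n)) (𝓡 n) c.symm z) = fderiv ℝ h z :=
      h7.mfderiv.symm.trans mfderiv_eq_fderiv
    rw [h5, ModelWithCorners.range_eq_univ, mfderivWithin_univ]
    exact h8

/-- In the preferred charts, the projection of the cotangent bundle is the projection to the first
factor. -/
theorem hasMFDerivAt_proj (α : Cotangent n M) :
    HasMFDerivAt (cotangentModel n) (𝓡 n) (TotalSpace.proj : Cotangent n M → M) α
      (ContinuousLinearMap.fst ℝ (EuclideanSpace ℝ (Fin n))
        (EuclideanSpace ℝ (Fin n) →L[ℝ] ℝ)) := by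
  refine ⟨(FiberBundle.continuous_proj _ _).continuousAt, HasFDerivAt.hasFDerivWithinAt ?_⟩
  refine (ContinuousLinearMap.hasFDerivAt _).congr_of_eventuallyEq ?_
  have h1 : (extChartAt (cotangentModel n) α).target ∈ 𝓝 (extChartAt (cotangentModel n) α α) :=
    extChartAt_target_mem_nhds α
  filter_upwards [h1] with z hz
  have h2 := (extChartAt (cotangentModel n) α).right_inv hz
  rw [extChartAt_cotangent] at h2
  exact congrArg Prod.fst h2

end CotangentCalculus

end Spacetime

namespace Spacetime

section Hamiltonian

variable {M : Type*} [TopologicalSpace M]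
  [ChartedSpace (EuclideanSpace ℝ (Fin 2)) M] [IsManifold (𝓡 2) ∞ M]
  {g : LorentzianMetric 2 M} {T : TimeOrientation g} {B : NullBox T} {x : M}
  {α : Cotangent 2 M}

/-! ### The dual metric in null coordinates -/

namespace NullBox

/-- The conformal factor `k` in `g = -k (du dv + dv du)`. -/
def factor (B : NullBox T) (x : M) : ℝ := -g.val x (B.vec x (1, 0)) (B.vec x (0, 1))

theorem factor_spec (B : NullBox T) (hx : x ∈ B.chart.source) :
    0 < B.factor x ∧ ∀ v w : TangentSpace (𝓡 2) x, g.val x v w =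
      -B.factor x * ((B.diff x v).1 * (B.diff x w).2 + (B.diff x v).2 * (B.diff x w).1) := by
  obtain ⟨k, hk, h⟩ := B.exists_metric_eq hx
  have : B.factor x = k := by
    rw [factor, h, B.diff_vec hx, B.diff_vec hx]
    ring
  rw [this]
  exact ⟨hk, h⟩

theorem contMDiffAt_factor (B : NullBox T) (hx : x ∈ B.chart.source) :
    ContMDiffAt (𝓡 2) 𝓘(ℝ, ℝ) ∞ B.factor x :=
  (contMDiffAt_metric_apply g (b := id) (B.contMDiffAt_vec hx _) (B.contMDiffAt_vec hx _)).neg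

/-- The first component `α(∂/∂u)` of a covector, in null coordinates. -/
def compU (B : NullBox T) (α : Cotangent 2 M) : ℝ := α.snd (B.vec α.proj (1, 0))

/-- The second component `α(∂/∂v)` of a covector, in null coordinates. -/
def compV (B : NullBox T) (α : Cotangent 2 M) : ℝ := α.snd (B.vec α.proj (0, 1))

theorem snd_apply (B : NullBox T) (hx : α.proj ∈ B.chart.source)
    (v : TangentSpace (𝓡 2) α.proj) : α.snd v =
      (B.diff α.proj v).1 * B.compU α + (B.diff α.proj v).2 * B.compV α := by
  conv_lhs => rw [← B.vec_diff hx v]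
  have : B.diff α.proj v = (B.diff α.proj v).1 • ((1 : ℝ), (0 : ℝ)) +
      (B.diff α.proj v).2 • ((0 : ℝ), (1 : ℝ)) := by
    ext <;> simp
  conv_lhs => rw [this]
  rw [vec_add, vec_smul, vec_smul, map_add, map_smul, map_smul]
  rfl

theorem contMDiffAt_comp (B : NullBox T) (hx : α.proj ∈ B.chart.source) (w : ℝ × ℝ) :
    ContMDiffAt (cotangentModel 2) 𝓘(ℝ, ℝ) ∞
      (fun α : Cotangent 2 M ↦ α.snd (B.vec α.proj w)) α :=
  contMDiffAt_covector_apply (b := TotalSpace.proj) contMDiffAt_id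
    ((B.contMDiffAt_vec hx w).comp α (contMDiff_proj _ α))

end NullBox

theorem isInvertible_val (T : TimeOrientation g) (x : M) : (g.val x).IsInvertible := by
  obtain ⟨B, hx, -⟩ := exists_nullBox T x univ_mem
  obtain ⟨hk, h⟩ := B.factor_spec hx
  have hfin : FiniteDimensional ℝ (TangentSpace (𝓡 2) x) :=
    inferInstanceAs (FiniteDimensional ℝ (EuclideanSpace ℝ (Fin 2)))
  have hT2 : T2Space (TangentSpace (𝓡 2) x) :=
    inferInstanceAs (T2Space (EuclideanSpace ℝ (Fin 2)))
  have hsmul : ContinuousSMul ℝ (TangentSpace (𝓡 2) x) :=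
    inferInstanceAs (ContinuousSMul ℝ (EuclideanSpace ℝ (Fin 2)))
  have hT2' : T2Space (TangentSpace (𝓡 2) x →L[ℝ] ℝ) :=
    inferInstanceAs (T2Space (EuclideanSpace ℝ (Fin 2) →L[ℝ] ℝ))
  have hinj : Function.Injective (g.val x).toLinearMap := by
    refine (injective_iff_map_eq_zero _).2 fun v hv ↦ ?_
    have h1 : g.val x v (B.vec x (1, 0)) = 0 := congrArg (fun φ ↦ φ (B.vec x (1, 0))) hv
    have h2 : g.val x v (B.vec x (0, 1)) = 0 := congrArg (fun φ ↦ φ (B.vec x (0, 1))) hv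
    rw [h, B.diff_vec hx] at h1 h2
    simp only [mul_zero, mul_one, zero_add, add_zero, mul_eq_zero, neg_eq_zero, hk.ne',
      false_or] at h1 h2
    exact B.diff_injective hx ((Prod.ext h2 h1).trans (map_zero _).symm)
  have hsurj : Function.Surjective (g.val x).toLinearMap := fun φ ↦ by
    let α : Cotangent 2 M := ⟨x, φ⟩
    refine ⟨B.vec x (-B.compV α / B.factor x, -B.compU α / B.factor x), ?_⟩
    ext v
    refine (h _ _).trans ?_
    rw [B.diff_vec hx]
    refine Eq.trans ?_ (B.snd_apply (α := α) hx v).symm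
    field_simp
    ring
  exact ⟨(LinearEquiv.ofBijective _ ⟨hinj, hsurj⟩).toContinuousLinearEquiv, rfl⟩

theorem val_sharp (T : TimeOrientation g) (α : Cotangent 2 M) :
    g.val α.proj (g.sharp α) = α.snd := by
  obtain ⟨e, he⟩ := isInvertible_val T α.proj
  rw [LorentzianMetric.sharp, ← he, ContinuousLinearMap.inverse_equiv]
  exact e.apply_symm_apply α.snd

theorem sharp_add_smul (g : LorentzianMetric 2 M) (x : M) (φ ψ : TangentSpace (𝓡 2) x →L[ℝ] ℝ)
    (t : ℝ) : g.sharp ⟨x, φ + t • ψ⟩ = g.sharp ⟨x, φ⟩ + t • g.sharp ⟨x, ψ⟩ := by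
  simp only [LorentzianMetric.sharp, map_add, map_smul]

theorem energy_eq_apply (T : TimeOrientation g) (α : Cotangent 2 M) :
    g.energy α = α.snd (g.sharp α) := by
  rw [LorentzianMetric.energy, val_sharp T]

namespace NullBox

theorem diff_sharp (B : NullBox T) (hx : α.proj ∈ B.chart.source) :
    B.diff α.proj (g.sharp α) = (-B.compV α / B.factor α.proj, -B.compU α / B.factor α.proj) := by
  obtain ⟨hk, h⟩ := B.factor_spec hx
  have h1 : B.compU α = _ := (congrArg (fun φ ↦ φ (B.vec α.proj (1, 0)))
    (val_sharp T α)).symm.trans (h _ _)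
  have h2 : B.compV α = _ := (congrArg (fun φ ↦ φ (B.vec α.proj (0, 1)))
    (val_sharp T α)).symm.trans (h _ _)
  rw [B.diff_vec hx] at h1 h2
  rw [h1, h2]
  ext <;> field_simp <;> ring

theorem energy_eq (B : NullBox T) (hx : α.proj ∈ B.chart.source) :
    g.energy α = -2 * B.compU α * B.compV α / B.factor α.proj := by
  rw [energy_eq_apply T, B.snd_apply hx, B.diff_sharp hx]
  ring

/-- The two components of the cone bundle: one of the null components of a covector of the cone
vanishes, and the other one is negative. -/
theorem mem_nullCone_iff (B : NullBox T) (hx : α.proj ∈ B.chart.source) :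
    α ∈ T.nullCone ↔ B.compU α < 0 ∧ B.compV α = 0 ∨ B.compU α = 0 ∧ B.compV α < 0 := by
  obtain ⟨hk, -⟩ := B.factor_spec hx
  have h0 : α.snd = 0 ↔ B.compU α = 0 ∧ B.compV α = 0 := by
    refine ⟨fun h ↦ by rw [compU, compV, h]; exact ⟨rfl, rfl⟩, fun h ↦ ?_⟩
    ext v
    rw [B.snd_apply hx, h.1, h.2]
    simp
  have h1 : -2 * B.compU α * B.compV α / B.factor α.proj = 0 ↔ B.compU α = 0 ∨ B.compV α = 0 := by
    simp [hk.ne']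
  rw [TimeOrientation.nullCone, mem_ofPred_eq, B.energy_eq hx, B.isFuture_iff hx, B.diff_sharp hx,
    Ne, h0, h1, Prod.lt_iff]
  have h2 (a : ℝ) : 0 < -a / B.factor α.proj ↔ a < 0 := by
    rw [div_pos_iff_of_pos_right hk, neg_pos]
  have h3 (a : ℝ) : 0 ≤ -a / B.factor α.proj ↔ a ≤ 0 := by
    rw [le_div_iff₀ hk, zero_mul, neg_nonneg]
  simp only [Prod.fst_zero, Prod.snd_zero, h2, h3]
  constructor
  · rintro ⟨h4 | h4, h5, h6⟩
    · exact .inr ⟨h4, h6.elim (·.1) fun h ↦ absurd h4 h.2.ne⟩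
    · exact .inl ⟨h6.elim (fun h ↦ absurd h4 h.1.ne) (·.2), h4⟩
  · rintro (⟨h4, h5⟩ | ⟨h4, h5⟩)
    · exact ⟨.inr h5, fun h ↦ h4.ne h.1, .inr ⟨h5.le, h4⟩⟩
    · exact ⟨.inl h4, fun h ↦ h5.ne h.2, .inl ⟨h5, h4.le⟩⟩

end NullBox

/-! ### The symplectic gradient of the energy -/

theorem mdifferentiableAt_energy (T : TimeOrientation g) (α : Cotangent 2 M) :
    MDifferentiableAt (cotangentModel 2) 𝓘(ℝ, ℝ) g.energy α := by
  obtain ⟨B, hx, -⟩ := exists_nullBox T α.proj univ_mem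
  have h1 : ContMDiffAt (cotangentModel 2) 𝓘(ℝ, ℝ) ∞
      (fun α ↦ -2 * B.compU α * B.compV α / B.factor α.proj) α :=
    ((contMDiffAt_const.mul (B.contMDiffAt_comp hx _)).mul (B.contMDiffAt_comp hx _)).div₀
      ((B.contMDiffAt_factor hx).comp α (contMDiff_proj _ α)) (B.factor_spec hx).1.ne'
  have h2 : ContMDiffAt (cotangentModel 2) 𝓘(ℝ, ℝ) ∞ g.energy α := by
    refine h1.congr_of_eventuallyEq ?_
    filter_upwards [(FiberBundle.continuous_proj _ _).continuousAt
      (B.chart.open_source.mem_nhds hx)] with β hβ using B.energy_eq hβ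
  exact h2.mdifferentiableAt (by simp)

/-- The derivative of the energy in the direction of the fibres. -/
theorem mfderiv_energy_vertical (T : TimeOrientation g) (x : M)
    (φ ψ : EuclideanSpace ℝ (Fin 2) →L[ℝ] ℝ) :
    (mfderiv (cotangentModel 2) 𝓘(ℝ, ℝ) g.energy (⟨x, φ⟩ : Cotangent 2 M)
      ((0, ψ) : EuclideanSpace ℝ (Fin 2) × (EuclideanSpace ℝ (Fin 2) →L[ℝ] ℝ)) : ℝ) =
      2 * ψ (g.sharp ⟨x, φ⟩) := by
  have h0 : φ + (0 : ℝ) • ψ = φ := by rw [zero_smul, add_zero]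
  have h1 := (mdifferentiableAt_energy T (⟨x, φ + (0 : ℝ) • ψ⟩ : Cotangent 2 M)).hasMFDerivAt.comp
    (0 : ℝ) (hasMFDerivAt_vertical x φ ψ)
  let a : ℝ := φ (g.sharp ⟨x, φ⟩)
  let b : ℝ := ψ (g.sharp ⟨x, φ⟩)
  let c : ℝ := ψ (g.sharp ⟨x, ψ⟩)
  have hsymm : φ (g.sharp ⟨x, ψ⟩) = b := by
    have e1 : φ (g.sharp ⟨x, ψ⟩) = g.val x (g.sharp ⟨x, φ⟩) (g.sharp ⟨x, ψ⟩) :=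
      (congrArg (fun L ↦ L (g.sharp ⟨x, ψ⟩)) (val_sharp T ⟨x, φ⟩)).symm
    have e2 : ψ (g.sharp ⟨x, φ⟩) = g.val x (g.sharp ⟨x, ψ⟩) (g.sharp ⟨x, φ⟩) :=
      (congrArg (fun L ↦ L (g.sharp ⟨x, φ⟩)) (val_sharp T ⟨x, ψ⟩)).symm
    rw [e1, g.symm]
    exact e2.symm
  have h2 (t : ℝ) : g.energy (⟨x, φ + t • ψ⟩ : Cotangent 2 M) = a + t * (2 * b) + t ^ 2 * c := by
    have e1 := energy_eq_apply T (⟨x, φ + t • ψ⟩ : Cotangent 2 M)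
    have e2 := sharp_add_smul g x φ ψ t
    have e3 : (φ + t • ψ) (g.sharp ⟨x, φ⟩ + t • g.sharp ⟨x, ψ⟩) =
        a + t * (2 * b) + t ^ 2 * c := by
      have e4 : (φ + t • ψ) (g.sharp ⟨x, φ⟩ + t • g.sharp ⟨x, ψ⟩) =
          (φ (g.sharp ⟨x, φ⟩) + t * φ (g.sharp ⟨x, ψ⟩)) +
            t * (ψ (g.sharp ⟨x, φ⟩) + t * ψ (g.sharp ⟨x, ψ⟩)) := by
        have e5 (L : EuclideanSpace ℝ (Fin 2) →L[ℝ] ℝ) (v w : EuclideanSpace ℝ (Fin 2)) :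
            L (v + t • w) = L v + t * L w := by simp
        exact congrArg₂ (fun p q ↦ p + t * q) (e5 φ _ _) (e5 ψ _ _)
      rw [e4, hsymm]
      ring
    exact e1.trans ((congrArg (φ + t • ψ) e2).trans e3)
  have h3 : HasDerivAt (fun t : ℝ ↦ a + t * (2 * b) + t ^ 2 * c) (2 * b) 0 := by
    have e1 : HasDerivAt (fun t : ℝ ↦ a + t * (2 * b)) (1 * (2 * b)) 0 :=
      ((hasDerivAt_id (0 : ℝ)).mul_const (2 * b)).const_add a
    have e2 : HasDerivAt (fun t : ℝ ↦ t ^ 2 * c) (((2 : ℕ) : ℝ) * 0 ^ (2 - 1) * 1 * c) 0 :=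
      ((hasDerivAt_id (0 : ℝ)).pow 2).mul_const c
    exact (e1.add e2).congr_deriv (by simp)
  have h4 : g.energy ∘ (fun t : ℝ ↦ (⟨x, φ + t • ψ⟩ : Cotangent 2 M)) =
      fun t : ℝ ↦ a + t * (2 * b) + t ^ 2 * c := funext h2
  rw [h4] at h1
  have h5 := congrArg (fun L ↦ L (1 : ℝ)) (hasMFDerivAt_unique h1 h3.hasFDerivAt.hasMFDerivAt)
  let dE (χ : EuclideanSpace ℝ (Fin 2) →L[ℝ] ℝ) :
      (EuclideanSpace ℝ (Fin 2) × (EuclideanSpace ℝ (Fin 2) →L[ℝ] ℝ)) →L[ℝ] ℝ :=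
    mfderiv (cotangentModel 2) 𝓘(ℝ, ℝ) g.energy (⟨x, χ⟩ : Cotangent 2 M)
  have h6 : dE (φ + (0 : ℝ) • ψ) (0, ψ) = 2 * b :=
    (congrArg (dE (φ + (0 : ℝ) • ψ)) (one_smul ℝ ((0 : EuclideanSpace ℝ (Fin 2)), ψ)).symm).trans
      (h5.trans (one_smul ℝ (2 * b)))
  rw [h0] at h6
  exact h6

/-- The first Hamiltonian equation: the base component of the symplectic gradient at `α` is twice
the vector dual to `α`. -/
theorem fst_of_isSympGradient (T : TimeOrientation g)
    {V : EuclideanSpace ℝ (Fin 2) × (EuclideanSpace ℝ (Fin 2) →L[ℝ] ℝ)}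
    (hV : g.IsSympGradient α V) : V.1 = (2 : ℝ) • g.sharp α := by
  have h1 (ψ : EuclideanSpace ℝ (Fin 2) →L[ℝ] ℝ) :
      ψ V.1 = 2 * ψ (g.sharp α) := by
    have h2 := (hV (0, ψ)).trans (mfderiv_energy_vertical T α.proj α.snd ψ)
    have h3 : symplecticForm α V ((0, ψ) :
      EuclideanSpace ℝ (Fin 2) × (EuclideanSpace ℝ (Fin 2) →L[ℝ] ℝ)) = ψ V.1 - V.2 0 := rfl
    rw [h3, map_zero, sub_zero] at h2
    exact h2
  let s : EuclideanSpace ℝ (Fin 2) := g.sharp α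
  have h4 : V.1 - (2 : ℝ) • s = 0 := by
    refine inner_self_eq_zero (𝕜 := ℝ).1 ?_
    have h5 := h1 (innerSL ℝ (V.1 - (2 : ℝ) • s))
    have h6 : (innerSL ℝ (V.1 - (2 : ℝ) • s)) (V.1 - (2 : ℝ) • s) =
        (innerSL ℝ (V.1 - (2 : ℝ) • s)) V.1 - 2 * (innerSL ℝ (V.1 - (2 : ℝ) • s)) s := by
      rw [map_sub, map_smul, smul_eq_mul]
    refine Eq.trans h6 (sub_eq_zero.2 h5)
  exact sub_eq_zero.1 h4

/-- The method of Hamilton and Jacobi: if `df` is null near `x`, then the section `df` maps the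
vector `2 (df)^♯` to the symplectic gradient of the energy. -/
theorem isSympGradient_differential (T : TimeOrientation g) {f : M → ℝ}
    (hf : ContMDiffAt (𝓡 2) 𝓘(ℝ, ℝ) ∞ f x)
    (hE : ∀ᶠ y in 𝓝 x, g.energy (⟨y, mfderiv (𝓡 2) 𝓘(ℝ, ℝ) f y⟩ : Cotangent 2 M) = 0) :
    g.IsSympGradient (⟨x, mfderiv (𝓡 2) 𝓘(ℝ, ℝ) f x⟩ : Cotangent 2 M)
      (mfderiv (𝓡 2) (cotangentModel 2)
        (fun y ↦ (⟨y, mfderiv (𝓡 2) 𝓘(ℝ, ℝ) f y⟩ : Cotangent 2 M)) x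
        ((2 : ℝ) • g.sharp (⟨x, mfderiv (𝓡 2) 𝓘(ℝ, ℝ) f x⟩ : Cotangent 2 M))) := by
  obtain ⟨D, hD, h1⟩ := exists_hasMFDerivAt_differential hf
  let α : Cotangent 2 M := ⟨x, mfderiv (𝓡 2) 𝓘(ℝ, ℝ) f x⟩
  let s : EuclideanSpace ℝ (Fin 2) := g.sharp α
  let dE : (EuclideanSpace ℝ (Fin 2) × (EuclideanSpace ℝ (Fin 2) →L[ℝ] ℝ)) →L[ℝ] ℝ :=
    mfderiv (cotangentModel 2) 𝓘(ℝ, ℝ) g.energy α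
  rw [h1.mfderiv]
  intro W
  let W' : EuclideanSpace ℝ (Fin 2) × (EuclideanSpace ℝ (Fin 2) →L[ℝ] ℝ) := W
  -- `W` is the sum of a vector tangent to the section and a vertical one
  have h2 : dE (W'.1, D W'.1) = 0 := by
    have h3 := (mdifferentiableAt_energy T α).hasMFDerivAt.comp x h1
    have h4 : HasMFDerivAt (𝓡 2) 𝓘(ℝ, ℝ) (g.energy ∘
        fun y ↦ (⟨y, mfderiv (𝓡 2) 𝓘(ℝ, ℝ) f y⟩ : Cotangent 2 M)) x
        (0 : TangentSpace (𝓡 2) x →L[ℝ] ℝ) :=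
      (hasMFDerivAt_const (0 : ℝ) x).congr_of_eventuallyEq hE
    exact congrArg (fun L ↦ L W'.1) (hasMFDerivAt_unique h3 h4)
  have h5 : dE (0, W'.2 - D W'.1) = 2 * (W'.2 - D W'.1) s := mfderiv_energy_vertical T x _ _
  have h6 : dE W' = 2 * (W'.2 - D W'.1) s := by
    have h8 : W' = (W'.1, D W'.1) + (0, W'.2 - D W'.1) := by ext1 <;> simp
    rw [← h5, h8, map_add, h2, zero_add]
    simp
  have h7 : symplecticForm α (((ContinuousLinearMap.id ℝ (EuclideanSpace ℝ (Fin 2))).prod D)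
      ((2 : ℝ) • s)) W = W'.2 ((2 : ℝ) • s) - D ((2 : ℝ) • s) W'.1 := rfl
  refine h7.trans (Eq.trans ?_ h6.symm)
  rw [hD ((2 : ℝ) • s) W'.1, map_smul, map_smul, sub_apply, smul_eq_mul, smul_eq_mul]
  ring

end Hamiltonian

end Spacetime

namespace Spacetime

section Leaves

variable {M : Type*} [TopologicalSpace M]
  [ChartedSpace (EuclideanSpace ℝ (Fin 2)) M] [IsManifold (𝓡 2) ∞ M]
  {g : LorentzianMetric 2 M} {T : TimeOrientation g} {B B' : NullBox T} {x y : M}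
  {α β : Cotangent 2 M}

/-! ### Null geodesics over the plaques of a null box -/

namespace NullBox

theorem swap_compV (hx : α.proj ∈ B.chart.source) : B.swap.compV α = B.compU α := by
  have h1 : B.swap.vec α.proj (0, 1) = B.vec α.proj (1, 0) := by
    refine B.diff_injective hx ?_
    have h2 := B.swap.diff_vec (x := α.proj) hx (0, 1)
    rw [swap_diff hx] at h2
    rw [B.diff_vec hx]
    exact congrArg Prod.swap h2
  rw [compV, h1, compU]

theorem SameAt.compV_eq_zero (hx : α.proj ∈ B.chart.source) (h : B.SameAt B' α.proj)
    (h0 : B'.compV α = 0) (hx' : α.proj ∈ B'.chart.source) : B.compV α = 0 := by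
  obtain ⟨a, ha, d, hd, h⟩ := h
  rw [compV, B'.snd_apply hx', h, B.diff_vec hx, h0]
  simp

/-- The value at `x` of the section `-c du` of the cotangent bundle. For `c > 0` these are the
covectors of the cone bundle whose null geodesics run along the plaques `u = const`. -/
def covector (B : NullBox T) (c : ℝ) (x : M) : Cotangent 2 M :=
  ⟨x, mfderiv (𝓡 2) 𝓘(ℝ, ℝ) (fun y ↦ -c * (B.chart y).1) x⟩

theorem covector_apply (B : NullBox T) (c : ℝ) (hx : x ∈ B.chart.source)
    (v : TangentSpace (𝓡 2) x) : (B.covector c x).snd v = -c * (B.diff x v).1 := by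
  have h1 := ((((ContinuousLinearMap.fst ℝ ℝ ℝ).hasFDerivAt (x := B.chart x)).const_mul
    (-c)).hasMFDerivAt).comp x (B.hasMFDerivAt hx)
  exact congrArg (fun L ↦ L v) h1.mfderiv

theorem contMDiffAt_covector (B : NullBox T) (c : ℝ) (hx : x ∈ B.chart.source) :
    ContMDiffAt (𝓡 2) (cotangentModel 2) ∞ (B.covector c) x :=
  contMDiffAt_differential
    ((contDiff_const.mul contDiff_fst).contMDiff.contMDiffAt.comp x (B.contMDiffAt hx))

theorem compU_covector (B : NullBox T) (c : ℝ) (hx : x ∈ B.chart.source) :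
    B.compU (B.covector c x) = -c := by
  exact (B.covector_apply c hx _).trans
    ((congrArg (fun w : ℝ × ℝ ↦ -c * w.1) (B.diff_vec hx (1, 0))).trans (mul_one _))

theorem compV_covector (B : NullBox T) (c : ℝ) (hx : x ∈ B.chart.source) :
    B.compV (B.covector c x) = 0 := by
  exact (B.covector_apply c hx _).trans
    ((congrArg (fun w : ℝ × ℝ ↦ -c * w.1) (B.diff_vec hx (0, 1))).trans (mul_zero _))

theorem covector_mem (B : NullBox T) {c : ℝ} (hc : 0 < c) (hx : x ∈ B.chart.source) :
    B.covector c x ∈ T.nullCone :=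
  (B.mem_nullCone_iff (α := B.covector c x) hx).2
    (.inl ⟨by rw [B.compU_covector c hx]; linarith, B.compV_covector c hx⟩)

theorem eq_covector (B : NullBox T) (hx : α.proj ∈ B.chart.source) (hV : B.compV α = 0) :
    α = B.covector (-B.compU α) α.proj := by
  obtain ⟨x, φ⟩ := α
  have h1 : φ = (B.covector (-B.compU ⟨x, φ⟩) x).snd := by
    ext v
    refine ((B.snd_apply (α := ⟨x, φ⟩) hx v).trans ?_).trans (B.covector_apply _ hx v).symm
    rw [hV]
    ring
  conv_lhs => rw [h1]
  rfl

/-- The integral curve of the symplectic gradient through a covector `-du` is, for a short time,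
a section `-du` over the plaque of its base point. -/
theorem eventually_flowStep (B : NullBox T) (hx : x ∈ B.chart.source) :
    ∀ᶠ t in 𝓝 (B.chart x).2, ∃ (h : B.covector 1 x ∈ T.nullCone)
      (h' : B.covector 1 (B.chart.symm ((B.chart x).1, t)) ∈ T.nullCone),
        T.FlowStep ⟨_, h⟩ ⟨_, h'⟩ := by
  let a := (B.chart x).1
  let b := (B.chart x).2
  have hab : (a, b) ∈ B.chart.target := B.chart.map_source hx
  have hsymm : B.chart.symm (a, b) = x := B.chart.left_inv hx
  -- on the plaque, with parameter `v`, the flow is the one of the vector field `2 / k`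
  let G (t : ℝ) : ℝ := 2 / B.factor (B.chart.symm (a, t))
  have hG : ContDiffAt ℝ 1 G b := by
    have h1 : ContMDiffAt 𝓘(ℝ, ℝ × ℝ) 𝓘(ℝ, ℝ) ∞ (fun p ↦ B.factor (B.chart.symm p)) (a, b) :=
      (B.contMDiffAt_factor (B.chart.map_target hab)).comp _ (B.contMDiffAt_symm hab)
    have h2 : ContDiffAt ℝ ∞ (fun t ↦ B.factor (B.chart.symm (a, t))) b :=
      h1.contDiffAt.comp b (contDiffAt_const.prodMk contDiffAt_id)
    exact (contDiffAt_const.div h2 (B.factor_spec (B.chart.map_target hab)).1.ne').of_le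
      (by norm_cast)
  obtain ⟨f, hf0, ε, hε, hf⟩ :=
    hG.exists_forall_mem_closedBall_exists_eq_forall_mem_Ioo_hasDerivAt₀ 0
  simp only [zero_sub, zero_add] at hf
  -- a smaller interval of times is mapped into the box
  obtain ⟨δ, hδ, hδε, hδt⟩ : ∃ δ > 0, δ ≤ ε ∧ ∀ t ∈ Ioo (-δ) δ, (a, f t) ∈ B.chart.target := by
    have h1 : ContinuousAt (fun t ↦ (a, f t)) 0 :=
      continuousAt_const.prodMk (hf 0 ⟨by linarith, hε⟩).continuousAt
    have h2 : B.chart.target ∈ 𝓝 (a, f 0) := B.chart.open_target.mem_nhds (by rwa [hf0])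
    obtain ⟨δ, hδ, h3⟩ := Metric.mem_nhds_iff.1 (h1 h2)
    refine ⟨min δ ε, lt_min hδ hε, min_le_right _ _, fun t ht ↦ h3 ?_⟩
    rw [Real.ball_eq_Ioo]
    exact ⟨by linarith [ht.1, min_le_left δ ε], by linarith [ht.2, min_le_left δ ε]⟩
  have hf' : ∀ t ∈ Ioo (-δ) δ, HasDerivAt f (G (f t)) t := fun t ht ↦
    hf t ⟨by linarith [ht.1], by linarith [ht.2]⟩
  have hmono : StrictMonoOn f (Ioo (-δ) δ) := by
    refine strictMonoOn_of_deriv_pos (convex_Ioo _ _)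
      (fun t ht ↦ (hf' t ht).continuousAt.continuousWithinAt) fun t ht ↦ ?_
    rw [interior_Ioo] at ht
    rw [(hf' t ht).deriv]
    exact div_pos two_pos (B.factor_spec (B.chart.map_target (hδt t ht))).1
  have h0δ : (0 : ℝ) ∈ Ioo (-δ) δ := ⟨by linarith, hδ⟩
  have h1δ : -(δ / 2) ∈ Ioo (-δ) δ := ⟨by linarith, by linarith⟩
  have h2δ : δ / 2 ∈ Ioo (-δ) δ := ⟨by linarith, by linarith⟩
  have hnhds : Icc (f (-(δ / 2))) (f (δ / 2)) ∈ 𝓝 b :=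
    Icc_mem_nhds (hf0 ▸ hmono h1δ h0δ (by linarith)) (hf0 ▸ hmono h0δ h2δ (by linarith))
  have hivt := intermediate_value_Icc (by linarith : -(δ / 2) ≤ δ / 2) (f := f)
    fun t ht ↦ (hf' t ⟨by linarith [ht.1], by linarith [ht.2]⟩).continuousAt.continuousWithinAt
  filter_upwards [hnhds] with s hs
  obtain ⟨t, ht, rfl⟩ := hivt hs
  have htδ : t ∈ Ioo (-δ) δ := ⟨by linarith [ht.1], by linarith [ht.2]⟩
  refine ⟨B.covector_mem one_pos hx, B.covector_mem one_pos (B.chart.map_target (hδt t htδ)), -δ, δ,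
    fun t ↦ B.covector 1 (B.chart.symm (a, f t)), fun r hr ↦ ?_, ⟨0, h0δ, ?_⟩, t, htδ, rfl⟩
  · have hr' := B.chart.map_target (hδt r hr)
    let z := B.chart.symm (a, f r)
    have hsharp : mfderiv 𝓘(ℝ, ℝ × ℝ) (𝓡 2) B.chart.symm (a, f r) ((0, G (f r)) : ℝ × ℝ) =
        (2 : ℝ) • g.sharp (B.covector 1 z) := by
      refine (B.mfderiv_chart_symm (hδt r hr) _).trans (B.diff_injective hr' ?_)
      rw [B.diff_vec hr']
      refine Eq.trans ?_ ((map_smul (B.diff z) (2 : ℝ) (g.sharp (B.covector 1 z))).trans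
        (congrArg ((2 : ℝ) • ·) (B.diff_sharp (α := B.covector 1 z) hr'))).symm
      rw [B.compU_covector 1 hr', B.compV_covector 1 hr']
      have h1 : B.factor (B.covector 1 z).proj = B.factor (B.chart.symm (a, f r)) := rfl
      rw [h1]
      ext
      · simp
      · simp [G, div_eq_mul_inv]
    refine ⟨B.covector_mem one_pos hr', mfderiv (𝓡 2) (cotangentModel 2) (B.covector 1) z
      ((2 : ℝ) • g.sharp (B.covector 1 z)), ?_, ?_⟩
    · exact isSympGradient_differential T
        ((contDiff_const.mul contDiff_fst).contMDiff.contMDiffAt.comp _ (B.contMDiffAt hr')) <| by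
          filter_upwards [B.chart.open_source.mem_nhds hr'] with z hz
          exact (B.covector_mem one_pos hz).1
    · have h1 : HasDerivAt (fun t ↦ (a, f t)) (0, G (f r)) r :=
        (hasDerivAt_const r a).prodMk (hf' r hr)
      have h2 := ((B.contMDiffAt_symm (hδt r hr)).mdifferentiableAt (by simp)).hasMFDerivAt.comp r
        h1.hasFDerivAt.hasMFDerivAt
      have h3 := ((B.contMDiffAt_covector 1 hr').mdifferentiableAt (by simp)).hasMFDerivAt.comp r h2
      refine h3.congr_mfderiv (ContinuousLinearMap.ext_ring ?_)
      have h4 : mfderiv 𝓘(ℝ, ℝ × ℝ) (𝓡 2) B.chart.symm (a, f r)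
          ((1 : ℝ) • ((0, G (f r)) : ℝ × ℝ) : ℝ × ℝ) = (2 : ℝ) • g.sharp (B.covector 1 z) := by
        rw [one_smul]
        exact hsharp
      exact (congrArg (mfderiv (𝓡 2) (cotangentModel 2) (B.covector 1) z) h4).trans
        (one_smul ℝ _).symm
  · simp only [hf0]
    rw [hsymm]

/-- All covectors `-c du` with `c > 0` over a plaque belong to the same null geodesic. -/
theorem toLeaf_covector (B : NullBox T) (hx : x ∈ B.chart.source) (hy : y ∈ B.chart.source)
    (hu : (B.chart x).1 = (B.chart y).1) {c d : ℝ} (hc : 0 < c) (hd : 0 < d) :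
    T.toLeaf ⟨_, B.covector_mem hc hx⟩ = T.toLeaf ⟨_, B.covector_mem hd hy⟩ := by
  have heuler {z : M} (hz : z ∈ B.chart.source) {c d : ℝ} (hc : 0 < c) (hd : 0 < d) :
      T.toLeaf ⟨_, B.covector_mem hc hz⟩ = T.toLeaf ⟨_, B.covector_mem hd hz⟩ := by
    refine Quotient.sound (Relation.EqvGen.rel _ _ (.inr ⟨d / c, by positivity, ?_⟩))
    have h1 : (B.covector d z).snd = (d / c) • (B.covector c z).snd := by
      ext v
      refine ((B.covector_apply d hz v).trans ?_).trans
        (congrArg ((d / c) * ·) (B.covector_apply c hz v)).symm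
      field_simp
    exact congrArg (fun φ ↦ (⟨z, φ⟩ : Cotangent 2 M)) h1
  suffices h : T.toLeaf ⟨_, B.covector_mem one_pos hx⟩ = T.toLeaf ⟨_, B.covector_mem one_pos hy⟩ from
    (heuler hx hc one_pos).trans (h.trans (heuler hy one_pos hd))
  clear hc hd
  wlog hv : (B.chart x).2 ≤ (B.chart y).2 generalizing x y
  · exact (this hy hx hu.symm (le_of_not_ge hv)).symm
  -- stated in terms of sets, since membership in the cone is not known for junk values of the chart
  let C (t : ℝ) : Set T.nullCone := {β | ∃ h : B.covector 1 (B.chart.symm ((B.chart x).1, t)) ∈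
    T.nullCone, T.toLeaf ⟨_, h⟩ = T.toLeaf β}
  have hmem : ∀ t ∈ Icc (B.chart x).2 (B.chart y).2, ((B.chart x).1, t) ∈ B.chart.target := by
    obtain ⟨p, r, h⟩ := B.square
    have h1 := B.chart.map_source hx
    have h2 := B.chart.map_source hy
    intro t ht
    rw [h, ← ball_prod_same, Real.ball_eq_Ioo, Real.ball_eq_Ioo] at h1 h2 ⊢
    exact ⟨h1.1, h1.2.1.trans_le ht.1, ht.2.trans_lt h2.2.2⟩
  have hC : C (B.chart x).2 = C (B.chart y).2 := by
    refine rel_of_locally_rel_Icc (ρ := fun s t ↦ C s = C t) (fun _ ↦ rfl) (fun _ _ _ ↦ Eq.trans)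
      hv fun t ht ↦ ?_
    have h1 := B.eventually_flowStep (B.chart.map_target (hmem t ht))
    rw [B.chart.right_inv (hmem t ht)] at h1
    have h2 : ∀ᶠ s in 𝓝 t, C t = C s := by
      filter_upwards [h1] with s ⟨h3, h4, h5⟩
      have h6 : T.toLeaf ⟨_, h3⟩ = T.toLeaf ⟨_, h4⟩ :=
        Quotient.sound (Relation.EqvGen.rel _ _ (.inl h5))
      ext β
      exact ⟨fun ⟨_, h⟩ ↦ ⟨h4, h6.symm.trans h⟩, fun ⟨_, h⟩ ↦ ⟨h3, h6.trans h⟩⟩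
    exact ⟨_, mem_nhdsWithin_of_mem_nhds h2, fun s hs s' hs' _ ↦ hs.symm.trans hs'⟩
  have hy' : B.chart.symm ((B.chart x).1, (B.chart y).2) = y := by
    rw [hu]; exact B.chart.left_inv hy
  have h7 : (⟨_, B.covector_mem one_pos hy⟩ : T.nullCone) ∈ C (B.chart y).2 := by
    have h8 : ∀ z, z = y → ∃ h : B.covector 1 z ∈ T.nullCone, T.toLeaf ⟨_, h⟩ =
        T.toLeaf ⟨_, B.covector_mem one_pos hy⟩ := by
      rintro _ rfl
      exact ⟨_, rfl⟩
    exact h8 _ hy'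
  rw [← hC] at h7
  have h8 : ∀ z, z = x → (∃ h : B.covector 1 z ∈ T.nullCone, T.toLeaf ⟨_, h⟩ =
      T.toLeaf ⟨_, B.covector_mem one_pos hy⟩) → T.toLeaf ⟨_, B.covector_mem one_pos hx⟩ =
      T.toLeaf ⟨_, B.covector_mem one_pos hy⟩ := by
    rintro _ rfl ⟨_, h⟩
    exact h
  exact h8 _ (B.chart.left_inv hx) h7

end NullBox

end Leaves

end Spacetime

namespace Spacetime

section Geodesics

variable {M : Type*} [TopologicalSpace M]
  [ChartedSpace (EuclideanSpace ℝ (Fin 2)) M] [IsManifold (𝓡 2) ∞ M]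
  {g : LorentzianMetric 2 M} {T : TimeOrientation g} {B B' : NullBox T} {x y : M}
  {α β : Cotangent 2 M}

/-! ### Null geodesics and the leaves of the null foliations -/

namespace OrientedAtlas

variable {𝒜 : OrientedAtlas T}

/-- The condition that the covector `α` annihilates the first null foliation; in the cone bundle,
this means that `α` is the covector of a null geodesic that runs along this foliation. -/
def Along (𝒜 : OrientedAtlas T) (α : Cotangent 2 M) : Prop :=
  ∀ B ∈ 𝒜.boxes, α.proj ∈ B.chart.source → B.compV α = 0

theorem along_iff (hB : B ∈ 𝒜.boxes) (hx : α.proj ∈ B.chart.source) :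
    𝒜.Along α ↔ B.compV α = 0 :=
  ⟨fun h ↦ h B hB hx, fun h B' hB' hx' ↦
    NullBox.SameAt.compV_eq_zero hx' (𝒜.same B' hB' B hB _ hx' hx) h hx⟩

theorem along_swap_iff (hB : B ∈ 𝒜.boxes) (hx : α.proj ∈ B.chart.source) :
    𝒜.swap.Along α ↔ B.compU α = 0 := by
  rw [along_iff (𝒜 := 𝒜.swap) (mem_image_of_mem _ hB) hx, NullBox.swap_compV hx]

theorem along_iff_compU_neg (hα : α ∈ T.nullCone) (hB : B ∈ 𝒜.boxes)
    (hx : α.proj ∈ B.chart.source) : 𝒜.Along α ↔ B.compU α < 0 := by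
  rw [along_iff hB hx]
  rcases (B.mem_nullCone_iff hx).1 hα with ⟨h1, h2⟩ | ⟨h1, h2⟩
  · exact ⟨fun _ ↦ h1, fun _ ↦ h2⟩
  · exact ⟨fun h ↦ absurd h h2.ne, fun h ↦ absurd h1 h.ne⟩

theorem not_along_iff_compV_neg (hα : α ∈ T.nullCone) (hB : B ∈ 𝒜.boxes)
    (hx : α.proj ∈ B.chart.source) : ¬ 𝒜.Along α ↔ B.compV α < 0 := by
  rw [along_iff hB hx]
  rcases (B.mem_nullCone_iff hx).1 hα with ⟨h1, h2⟩ | ⟨h1, h2⟩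
  · exact ⟨fun h ↦ absurd h2 h, fun h ↦ absurd h2 h.ne⟩
  · exact ⟨fun _ ↦ h2, fun _ ↦ h2.ne⟩

theorem along_swap_iff_not (hα : α ∈ T.nullCone) : 𝒜.swap.Along α ↔ ¬ 𝒜.Along α := by
  obtain ⟨B, hB, hx⟩ := 𝒜.exists_mem α.proj
  rw [along_swap_iff hB hx, along_iff hB hx]
  rcases (B.mem_nullCone_iff hx).1 hα with ⟨h1, h2⟩ | ⟨h1, h2⟩
  · exact ⟨fun h ↦ absurd h h1.ne, fun h ↦ absurd h2 h⟩
  · exact ⟨fun _ ↦ h2.ne, fun _ ↦ h1⟩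

theorem along_covector (hB : B ∈ 𝒜.boxes) (c : ℝ) (hx : x ∈ B.chart.source) :
    𝒜.Along (B.covector c x) :=
  (along_iff (α := B.covector c x) hB hx).2 (B.compV_covector c hx)

theorem plaque_iff : 𝒜.toNullAtlas.Plaque x y ↔ ∃ B ∈ 𝒜.boxes, x ∈ B.chart.source ∧
    y ∈ B.chart.source ∧ (B.chart x).1 = (B.chart y).1 := by
  constructor
  · rintro ⟨_, ⟨B, hB, rfl⟩, h⟩
    exact ⟨B, hB, h⟩
  · rintro ⟨B, hB, h⟩
    exact ⟨_, mem_image_of_mem _ hB, h⟩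

/-- An integral curve of the symplectic gradient in the cone bundle projects to a leaf of one of the
null foliations. -/
theorem along_flow {Γ : ℝ → Cotangent 2 M} {a b s t : ℝ}
    (hΓ : ∀ t ∈ Ioo a b, Γ t ∈ T.nullCone ∧
      ∃ V : TangentSpace (cotangentModel 2) (Γ t), g.IsSympGradient (Γ t) V ∧
        HasMFDerivAt 𝓘(ℝ, ℝ) (cotangentModel 2) Γ t ((1 : ℝ →L[ℝ] ℝ).smulRight V))
    (hs : s ∈ Ioo a b) (ht : t ∈ Ioo a b) (hst : s ≤ t) :
    (𝒜.Along (Γ s) ↔ 𝒜.Along (Γ t)) ∧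
      (𝒜.Along (Γ s) → 𝒜.toNullAtlas.Leaf (Γ s).proj (Γ t).proj) := by
  refine rel_of_locally_rel_Icc (ρ := fun s t ↦ (𝒜.Along (Γ s) ↔ 𝒜.Along (Γ t)) ∧
      (𝒜.Along (Γ s) → 𝒜.toNullAtlas.Leaf (Γ s).proj (Γ t).proj))
    (fun _ ↦ ⟨.rfl, fun _ ↦ .refl⟩)
    (fun _ _ _ h h' ↦ ⟨h.1.trans h'.1, fun h1 ↦ (h.2 h1).trans (h'.2 (h.1.1 h1))⟩) hst
    fun t₀ ht₀ ↦ ?_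
  have ht₀' : t₀ ∈ Ioo a b := ⟨hs.1.trans_le ht₀.1, ht₀.2.trans_lt ht.2⟩
  obtain ⟨B, hB, hx⟩ := 𝒜.exists_mem (Γ t₀).proj
  obtain ⟨h1, V, -, h2⟩ := hΓ t₀ ht₀'
  have hc : ContinuousAt Γ t₀ := h2.continuousAt
  have hsource : ∀ᶠ r in 𝓝 t₀, (Γ r).proj ∈ B.chart.source :=
    ((FiberBundle.continuous_proj _ _).continuousAt.comp hc).eventually
      (B.chart.open_source.mem_nhds hx)
  have hcU : ContinuousAt (fun r ↦ B.compU (Γ r)) t₀ :=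
    ContinuousAt.comp (f := Γ) (B.contMDiffAt_comp hx (1, 0)).continuousAt hc
  have hcV : ContinuousAt (fun r ↦ B.compV (Γ r)) t₀ :=
    ContinuousAt.comp (f := Γ) (B.contMDiffAt_comp hx (0, 1)).continuousAt hc
  by_cases hA : 𝒜.Along (Γ t₀)
  · have h3 := (along_iff_compU_neg h1 hB hx).1 hA
    obtain ⟨ε, hε, h4⟩ := Metric.eventually_nhds_iff_ball.1
      ((hsource.and (hcU.eventually (gt_mem_nhds h3))).and (Ioo_mem_nhds ht₀'.1 ht₀'.2))
    have h5 : ∀ r ∈ Metric.ball t₀ ε, 𝒜.Along (Γ r) := fun r hr ↦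
      (along_iff_compU_neg (hΓ r (h4 r hr).2).1 hB (h4 r hr).1.1).2 (h4 r hr).1.2
    -- the first coordinate is constant along the curve
    have h6 : ∀ r ∈ Metric.ball t₀ ε, HasDerivAt (fun r ↦ (B.chart (Γ r).proj).1) 0 r := by
      intro r hr
      obtain ⟨⟨hr1, hr2⟩, hr3⟩ := h4 r hr
      obtain ⟨-, V, hV, h7⟩ := hΓ r hr3
      have h8 := ((B.hasMFDerivAt hr1).comp r ((hasMFDerivAt_proj (Γ r)).comp r h7)).hasFDerivAt
      refine (HasFDerivAt.hasDerivAt (h8.fst (𝕜 := ℝ))).congr_deriv ?_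
      have h10 : B.diff (Γ r).proj ((1 : ℝ) • V).1 = (2 : ℝ) •
          (-B.compV (Γ r) / B.factor (Γ r).proj, -B.compU (Γ r) / B.factor (Γ r).proj) := by
        rw [one_smul]
        refine (congrArg (B.diff (Γ r).proj) (fst_of_isSympGradient T hV)).trans ?_
        exact (map_smul _ _ _).trans (congrArg _ (B.diff_sharp hr1))
      refine (congrArg Prod.fst h10).trans ?_
      rw [(along_iff hB hr1).1 (h5 r hr)]
      simp
    refine ⟨Metric.ball t₀ ε, mem_nhdsWithin_of_mem_nhds (Metric.ball_mem_nhds _ hε),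
      fun r hr r' hr' _ ↦ ⟨iff_of_true (h5 r hr) (h5 r' hr'), fun _ ↦ ?_⟩⟩
    refine (plaque_iff.2 ⟨B, hB, (h4 r hr).1.1, (h4 r' hr').1.1, ?_⟩).leaf
    exact Metric.isOpen_ball.is_const_of_deriv_eq_zero (convex_ball t₀ ε).isPreconnected
      (fun r hr ↦ (h6 r hr).differentiableAt.differentiableWithinAt)
      (fun r hr ↦ (h6 r hr).deriv) hr hr'
  · have h3 := (not_along_iff_compV_neg h1 hB hx).1 hA
    have h4 : ∀ᶠ r in 𝓝 t₀, ¬ 𝒜.Along (Γ r) := by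
      filter_upwards [hsource, hcV.eventually (gt_mem_nhds h3), Ioo_mem_nhds ht₀'.1 ht₀'.2]
        with r h5 h6 h7
      exact (not_along_iff_compV_neg (hΓ r h7).1 hB h5).2 h6
    exact ⟨_, mem_nhdsWithin_of_mem_nhds h4, fun r hr r' hr' _ ↦
      ⟨iff_of_false hr hr', fun h ↦ absurd h hr⟩⟩

/-- Null geodesics that are equal run along the same foliation, and along the same leaf of it. -/
theorem along_of_toLeaf_eq {α β : T.nullCone} (h : T.toLeaf α = T.toLeaf β) :
    (𝒜.Along α.1 ↔ 𝒜.Along β.1) ∧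
      (𝒜.Along α.1 → 𝒜.toNullAtlas.Leaf α.1.proj β.1.proj) := by
  have h1 : Relation.EqvGen (fun α β ↦ T.FlowStep α β ∨ T.EulerStep α β) α β := Quotient.exact h
  induction h1 with
  | refl => exact ⟨.rfl, fun _ ↦ .refl⟩
  | symm α β h1 ih => exact
    have ih := ih (Quotient.sound h1)
    ⟨ih.1.symm, fun h2 ↦ 𝒜.toNullAtlas.leafSetoid.symm (ih.2 (ih.1.2 h2))⟩
  | trans α β γ h1 h2 ih1 ih2 => exact
    have ih1 := ih1 (Quotient.sound h1)
    have ih2 := ih2 (Quotient.sound h2)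
    ⟨ih1.1.trans ih2.1, fun h3 ↦ (ih1.2 h3).trans (ih2.2 (ih1.1.1 h3))⟩
  | rel α β h1 =>
    rcases h1 with ⟨a, b, Γ, hΓ, ⟨s, hs, hsα⟩, t, ht, htβ⟩ | ⟨c, hc, h1⟩
    · rw [← hsα, ← htβ]
      rcases le_total s t with hst | hst
      · exact along_flow hΓ hs ht hst
      · have h1 := along_flow (𝒜 := 𝒜) hΓ ht hs hst
        exact ⟨h1.1.symm, fun h2 ↦ 𝒜.toNullAtlas.leafSetoid.symm (h1.2 (h1.1.2 h2))⟩
    · rw [h1]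
      obtain ⟨B, hB, hx⟩ := 𝒜.exists_mem α.1.proj
      refine ⟨?_, fun _ ↦ .refl⟩
      rw [along_iff hB hx, along_iff (α := ⟨α.1.proj, c • α.1.snd⟩) hB hx]
      change _ ↔ c * B.compV α.1 = 0
      rw [mul_eq_zero, or_iff_right hc.ne']

/-- Two null geodesics along the same null foliation are equal if they project to the same leaf. -/
theorem toLeaf_eq_of_leaf {α β : T.nullCone} (hα : 𝒜.Along α.1) (hβ : 𝒜.Along β.1)
    (h : 𝒜.toNullAtlas.Leaf α.1.proj β.1.proj) : T.toLeaf α = T.toLeaf β := by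
  have hplaque {B : NullBox T} {α β : T.nullCone} (hα : 𝒜.Along α.1) (hβ : 𝒜.Along β.1) (hB : B ∈ 𝒜.boxes)
      (hx : α.1.proj ∈ B.chart.source) (hy : β.1.proj ∈ B.chart.source)
      (hu : (B.chart α.1.proj).1 = (B.chart β.1.proj).1) : T.toLeaf α = T.toLeaf β := by
    have h1 := (along_iff_compU_neg α.2 hB hx).1 hα
    have h2 := (along_iff_compU_neg β.2 hB hy).1 hβ
    have h3 : α = ⟨_, B.covector_mem (neg_pos.2 h1) hx⟩ :=
      Subtype.ext (B.eq_covector hx ((along_iff hB hx).1 hα))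
    have h4 : β = ⟨_, B.covector_mem (neg_pos.2 h2) hy⟩ :=
      Subtype.ext (B.eq_covector hy ((along_iff hB hy).1 hβ))
    exact ((congrArg T.toLeaf h3).trans (B.toLeaf_covector hx hy hu (neg_pos.2 h1)
      (neg_pos.2 h2))).trans (congrArg T.toLeaf h4.symm)
  generalize hy : β.1.proj = y at h
  induction h generalizing β with
  | refl =>
    obtain ⟨B, hB, hx⟩ := 𝒜.exists_mem α.1.proj
    exact hplaque hα hβ hB hx (hy ▸ hx) (by rw [hy])
  | @tail y z _ h2 ih =>
    obtain ⟨B, hB, hyB, hzB, hu⟩ := plaque_iff.1 h2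
    exact (ih (β := ⟨_, B.covector_mem one_pos hyB⟩) (along_covector hB 1 hyB) rfl).trans
      (hplaque (along_covector hB 1 hyB) hβ hB hyB (hy ▸ hzB) (by rw [hy]; exact hu))

/-- The null geodesic through `x` that runs along the first null foliation. -/
def geodesic (𝒜 : OrientedAtlas T) (x : M) : T.NullGeodesics :=
  T.toLeaf ⟨_, (𝒜.exists_mem x).choose.covector_mem one_pos (𝒜.exists_mem x).choose_spec.2⟩

theorem toLeaf_eq_geodesic {α : T.nullCone} (hα : 𝒜.Along α.1) :
    T.toLeaf α = 𝒜.geodesic α.1.proj :=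
  toLeaf_eq_of_leaf hα (along_covector (𝒜.exists_mem _).choose_spec.1 1
    (𝒜.exists_mem _).choose_spec.2) .refl

theorem geodesic_eq_iff : 𝒜.geodesic x = 𝒜.geodesic y ↔ 𝒜.toNullAtlas.Leaf x y :=
  ⟨fun h ↦ (along_of_toLeaf_eq h).2 (along_covector (𝒜.exists_mem x).choose_spec.1 1
    (𝒜.exists_mem x).choose_spec.2), fun h ↦ toLeaf_eq_of_leaf
      (along_covector (𝒜.exists_mem x).choose_spec.1 1 (𝒜.exists_mem x).choose_spec.2)
      (along_covector (𝒜.exists_mem y).choose_spec.1 1 (𝒜.exists_mem y).choose_spec.2) h⟩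

theorem toLeaf_ne_geodesic {α : T.nullCone} (hα : ¬ 𝒜.Along α.1) : T.toLeaf α ≠ 𝒜.geodesic x :=
  fun h ↦ hα ((along_of_toLeaf_eq h).1.2 (along_covector (𝒜.exists_mem x).choose_spec.1 1
    (𝒜.exists_mem x).choose_spec.2))

theorem geodesic_swap_ne : 𝒜.swap.geodesic x ≠ 𝒜.geodesic y := by
  refine toLeaf_ne_geodesic ((along_swap_iff_not (NullBox.covector_mem _ one_pos
    (𝒜.swap.exists_mem x).choose_spec.2)).1 ?_)
  exact along_covector (𝒜.swap.exists_mem x).choose_spec.1 1 (𝒜.swap.exists_mem x).choose_spec.2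

theorem exists_eq_geodesic (𝒜 : OrientedAtlas T) (κ : T.NullGeodesics) :
    (∃ x, κ = 𝒜.geodesic x) ∨ ∃ x, κ = 𝒜.swap.geodesic x := by
  obtain ⟨α, rfl⟩ := Quotient.exists_rep κ
  by_cases h : 𝒜.Along α.1
  · exact .inl ⟨_, toLeaf_eq_geodesic h⟩
  · exact .inr ⟨_, toLeaf_eq_geodesic ((along_swap_iff_not α.2).2 h)⟩

theorem continuous_geodesic (𝒜 : OrientedAtlas T) : Continuous 𝒜.geodesic := by
  refine continuous_iff_continuousAt.2 fun x ↦ ?_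
  obtain ⟨B, hB, hx⟩ := 𝒜.exists_mem x
  have h1 : ContinuousOn 𝒜.geodesic B.chart.source := by
    rw [continuousOn_iff_continuous_domRestrict]
    have h2 : Continuous fun y : B.chart.source ↦
        (⟨_, B.covector_mem one_pos y.2⟩ : T.nullCone) := by
      refine Continuous.subtype_mk (continuousOn_iff_continuous_domRestrict.1 fun y hy ↦
        (B.contMDiffAt_covector 1 hy).continuousAt.continuousWithinAt) _
    refine (continuous_quotient_mk'.comp h2).congr fun y ↦ ?_
    exact toLeaf_eq_geodesic (along_covector hB 1 y.2)
  exact h1.continuousAt (B.chart.open_source.mem_nhds hx)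

theorem isOpen_along (𝒜 : OrientedAtlas T) : IsOpen {α : T.nullCone | 𝒜.Along α.1} := by
  refine isOpen_iff_mem_nhds.2 fun α hα ↦ ?_
  obtain ⟨B, hB, hx⟩ := 𝒜.exists_mem α.1.proj
  have h1 : ContinuousAt (fun β : T.nullCone ↦ β.1.proj) α :=
    ((FiberBundle.continuous_proj _ _).comp continuous_subtype_val).continuousAt
  have h2 : ContinuousAt (fun β : T.nullCone ↦ B.compU β.1) α :=
    ContinuousAt.comp (f := Subtype.val) (B.contMDiffAt_comp hx (1, 0)).continuousAt
      continuous_subtype_val.continuousAt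
  filter_upwards [h1.eventually (B.chart.open_source.mem_nhds hx),
    h2.eventually (gt_mem_nhds ((along_iff_compU_neg α.2 hB hx).1 hα))] with β h3 h4
  exact (along_iff_compU_neg β.2 hB h3).2 h4

theorem isOpenMap_geodesic (𝒜 : OrientedAtlas T) : IsOpenMap 𝒜.geodesic := fun O hO ↦ by
  have h1 : T.toLeaf ⁻¹' (𝒜.geodesic '' O) = {α | 𝒜.Along α.1} ∩
      (fun α ↦ α.1.proj) ⁻¹' 𝒜.toNullAtlas.saturation O := by
    ext α
    constructor
    · rintro ⟨x, hx, h⟩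
      have h2 : 𝒜.Along α.1 := by
        by_contra h2
        exact toLeaf_ne_geodesic h2 h.symm
      exact ⟨h2, x, hx, geodesic_eq_iff.1 (h.trans (toLeaf_eq_geodesic h2))⟩
    · rintro ⟨h2, x, hx, h⟩
      exact ⟨x, hx, (geodesic_eq_iff.2 h).trans (toLeaf_eq_geodesic h2).symm⟩
  refine (isQuotientMap_quotient_mk' (s := T.leafSetoid)).isOpen_preimage.1 ?_
  refine h1.symm ▸ ?_
  exact 𝒜.isOpen_along.inter ((𝒜.toNullAtlas.isOpen_saturation hO).preimage
    ((FiberBundle.continuous_proj _ _).comp continuous_subtype_val))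

end OrientedAtlas

end Geodesics

end Spacetime

/-! ### A smooth space of null geodesics forces causal simplicity -/

theorem image_mem_nhds_of_continuousOn_injOn {r : ℝ → ℝ} {t : ℝ} {N : Set ℝ} (hN : N ∈ 𝓝 t)
    (hc : ContinuousOn r N) (hi : InjOn r N) : r '' N ∈ 𝓝 (r t) := by
  obtain ⟨ε, hε, h⟩ := Metric.nhds_basis_closedBall.mem_iff.1 hN
  rw [Real.closedBall_eq_Icc] at h
  have h0 : t - ε ∈ Icc (t - ε) (t + ε) := left_mem_Icc.2 (by linarith)
  have h1 : t ∈ Icc (t - ε) (t + ε) := ⟨by linarith, by linarith⟩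
  have h2 : t + ε ∈ Icc (t - ε) (t + ε) := right_mem_Icc.2 (by linarith)
  have hle : t - ε ≤ t + ε := by linarith
  rcases (hc.mono h).strictMonoOn_of_injOn_Icc' hle (hi.mono h) with hm | hm
  · exact mem_of_superset (Icc_mem_nhds (hm h0 h1 (by linarith)) (hm h1 h2 (by linarith)))
      ((intermediate_value_Icc hle (hc.mono h)).trans (image_mono h))
  · exact mem_of_superset (Icc_mem_nhds (hm h1 h2 (by linarith)) (hm h0 h1 (by linarith)))
      ((intermediate_value_Icc' hle (hc.mono h)).trans (image_mono h))

namespace Spacetime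

section Forward

variable {M : Type*} [TopologicalSpace M]
  [ChartedSpace (EuclideanSpace ℝ (Fin 2)) M] [IsManifold (𝓡 2) ∞ M]
  {g : LorentzianMetric 2 M} {T : TimeOrientation g}

namespace OrientedAtlas

variable {𝒜 : OrientedAtlas T}

/-- A linear isomorphism of the line with the model space of the manifold `𝒩_g`. -/
def lineEquiv : ℝ ≃L[ℝ] EuclideanSpace ℝ (Fin (2 * 2 - 3)) :=
  ContinuousLinearEquiv.ofFinrankEq (by simp)

/-- A local section of `ℒ*M → 𝒩_g` gives a curve that meets nearby leaves exactly once, and the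
first coordinate of a box runs through an interval along this curve. -/
theorem locallySimple (hT : T.NullGeodesicsIsSmoothManifold) : 𝒜.toNullAtlas.LocallySimple := by
  intro x
  obtain ⟨-, -, _, -, hsub⟩ := hT
  obtain ⟨B, hB, hx⟩ := 𝒜.exists_mem x
  let α : T.nullCone := ⟨_, B.covector_mem one_pos hx⟩
  obtain ⟨U, σ, hU, hαU, hσ, hsec, hσα⟩ := (hsub α).2
  have hσc : ∀ κ ∈ U, ContinuousAt σ κ := fun κ hκ ↦
    Topology.IsInducing.subtypeVal.continuousAt_iff.2 (hσ.continuousOn.continuousAt (hU.mem_nhds hκ))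
  have hproj : Continuous fun α : T.nullCone ↦ α.1.proj :=
    (FiberBundle.continuous_proj _ _).comp continuous_subtype_val
  let S : Set T.NullGeodesics := {κ | κ ∈ U ∧ (σ κ).1.proj ∈ B.chart.source ∧ 𝒜.Along (σ κ).1}
  have hS : S ∈ 𝓝 (T.toLeaf α) := by
    have h1 := hσc _ hαU
    rw [ContinuousAt, hσα] at h1
    filter_upwards [hU.mem_nhds hαU, h1 (𝒜.isOpen_along.mem_nhds (along_covector hB 1 hx)),
      h1 ((B.chart.open_source.preimage hproj).mem_nhds (show α ∈ _ from hx))]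
      with κ h2 h3 h4 using ⟨h2, h4, h3⟩
  have hgeo : ∀ κ ∈ S, 𝒜.geodesic (σ κ).1.proj = κ := fun κ hκ ↦
    (toLeaf_eq_geodesic hκ.2.2).symm.trans (hsec κ hκ.1)
  let φ := chartAt (EuclideanSpace ℝ (Fin (2 * 2 - 3))) (T.toLeaf α)
  let η (t : ℝ) : T.NullGeodesics := φ.symm (φ (T.toLeaf α) + lineEquiv t)
  have hη0 : η 0 = T.toLeaf α := by
    simp only [η, map_zero, add_zero]
    exact φ.left_inv (mem_chart_source _ _)
  have hline : Continuous fun t : ℝ ↦ φ (T.toLeaf α) + lineEquiv t := by fun_prop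
  let N : Set ℝ := {t | φ (T.toLeaf α) + lineEquiv t ∈ φ.target ∧ η t ∈ S}
  have hηc : ∀ t, φ (T.toLeaf α) + lineEquiv t ∈ φ.target → ContinuousAt η t := fun t ht ↦
    ContinuousAt.comp (g := φ.symm) (f := fun t ↦ φ (T.toLeaf α) + lineEquiv t)
      (φ.continuousAt_symm ht) hline.continuousAt
  have hN : N ∈ 𝓝 (0 : ℝ) := by
    have h1 : φ (T.toLeaf α) + lineEquiv 0 ∈ φ.target := by
      rw [map_zero, add_zero]
      exact φ.map_source (mem_chart_source _ _)
    filter_upwards [(φ.open_target.preimage hline).mem_nhds h1, hηc 0 h1 (hη0 ▸ hS)]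
      with t h2 h3 using ⟨h2, h3⟩
  let r (t : ℝ) : ℝ := (B.chart (σ (η t)).1.proj).1
  have hr0 : r 0 = (B.chart x).1 := by
    simp only [r, hη0, hσα]
    rfl
  have hrc : ContinuousOn r N := fun t ht ↦ by
    refine (ContinuousAt.fst ?_).continuousWithinAt
    refine ContinuousAt.comp (g := B.chart) (f := fun t ↦ (σ (η t)).1.proj)
      (B.chart.continuousAt ht.2.2.1) ?_
    exact hproj.continuousAt.comp ((hσc _ ht.2.1).comp (hηc t ht.1))
  have hri : InjOn r N := fun t ht t' ht' h ↦ by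
    have h1 : η t = η t' := by
      rw [← hgeo _ ht.2, ← hgeo _ ht'.2, geodesic_eq_iff]
      exact (plaque_iff.2 ⟨B, hB, ht.2.2.1, ht'.2.2.1, h⟩).leaf
    exact lineEquiv.injective (add_left_cancel (φ.symm.injOn ht.1 ht'.1 h1))
  have hmem := image_mem_nhds_of_continuousOn_injOn hN hrc hri
  rw [hr0] at hmem
  obtain ⟨B', hB', hx', hO, hBB', hBeq⟩ := 𝒜.exists_restrict B hB x hx _
    ((B.chart.continuousAt hx).fst hmem)
  refine ⟨B'.chart, ⟨mem_image_of_mem _ hB', fun y hy z hz hyz ↦ ?_⟩, hx'⟩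
  rw [hBeq, hBeq]
  obtain ⟨t, ht, hty⟩ : ∃ t ∈ N, r t = (B.chart y).1 := hO hy
  obtain ⟨t', ht', htz⟩ : ∃ t ∈ N, r t = (B.chart z).1 := hO hz
  have h1 : η t = 𝒜.geodesic y := by
    rw [← hgeo _ ht.2, geodesic_eq_iff]
    exact (plaque_iff.2 ⟨B, hB, ht.2.2.1, hBB' hy, hty⟩).leaf
  have h2 : η t' = 𝒜.geodesic z := by
    rw [← hgeo _ ht'.2, geodesic_eq_iff]
    exact (plaque_iff.2 ⟨B, hB, ht'.2.2.1, hBB' hz, htz⟩).leaf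
  rw [← hty, ← htz]
  simp only [r, h1, h2, geodesic_eq_iff.2 hyz]

theorem t2Space_leaves [T2Space T.NullGeodesics] : T2Space (Quotient 𝒜.toNullAtlas.leafSetoid) := by
  refine T2Space.of_injective_continuous
    (f := Quotient.lift 𝒜.geodesic fun _ _ ↦ geodesic_eq_iff.2) ?_
    (𝒜.continuous_geodesic.quotient_lift _)
  rintro ⟨x⟩ ⟨y⟩ h
  exact Quotient.sound (geodesic_eq_iff.1 h)

end OrientedAtlas

theorem isCausallySimple_of_isSmoothManifold [T2Space M] [SecondCountableTopology M]
    [SimplyConnectedSpace M] (hT : T.NullGeodesicsIsSmoothManifold) : T.IsCausallySimple := by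
  obtain ⟨𝒜⟩ := exists_orientedAtlas T
  have : LocallyPathConnectedSpace M :=
    ChartedSpace.locallyPathConnectedSpace (EuclideanSpace ℝ (Fin 2)) M
  have : T2Space T.NullGeodesics := hT.1
  have : T2Space (Quotient 𝒜.toNullAtlas.leafSetoid) := OrientedAtlas.t2Space_leaves
  have : T2Space (Quotient 𝒜.toNullAtlas.swap.leafSetoid) := by
    rw [← 𝒜.swap_toNullAtlas]
    exact OrientedAtlas.t2Space_leaves
  have h1 : 𝒜.toNullAtlas.swap.LocallySimple := by
    rw [← 𝒜.swap_toNullAtlas]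
    exact OrientedAtlas.locallySimple hT
  exact (OrientedAtlas.locallySimple hT).isClosed_causal h1 𝒜.isCausalRel

end Forward

end Spacetime

namespace Spacetime

section SmoothStructure

variable {M : Type*} [TopologicalSpace M]
  [ChartedSpace (EuclideanSpace ℝ (Fin 2)) M] [IsManifold (𝓡 2) ∞ M]
  {g : LorentzianMetric 2 M} {T : TimeOrientation g} {B B' : NullBox T} {x y : M}

/-! ### The smooth structure of the space of null geodesics -/

namespace OrientedAtlas

variable {𝒜 : OrientedAtlas T}

/-- Smooth holonomy: a germ of a smooth map of the surface that maps a given point to a given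
point of the same leaf, and each point near the former into its leaf. -/
theorem exists_holonomy (h : 𝒜.toNullAtlas.Leaf x y) : ∃ ψ : M → M,
    ContMDiffAt (𝓡 2) (𝓡 2) ∞ ψ x ∧ ψ x = y ∧ ∀ᶠ z in 𝓝 x, 𝒜.toNullAtlas.Leaf z (ψ z) := by
  induction h with
  | refl => exact ⟨id, contMDiffAt_id, rfl, .of_forall fun _ ↦ .refl⟩
  | @tail y z _ h1 ih =>
    obtain ⟨ψ, hψ, rfl, hleaf⟩ := ih
    obtain ⟨B, hB, hy, hz, hu⟩ := plaque_iff.1 h1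
    have h2 : ((B.chart (ψ x)).1, (B.chart z).2) ∈ B.chart.target := hu ▸ B.chart.map_source hz
    have h3 : ContMDiffAt (𝓡 2) (𝓡 2) ∞
        (fun w ↦ B.chart.symm ((B.chart (ψ w)).1, (B.chart z).2)) x := by
      have h3 : ContDiff ℝ ∞ fun q : ℝ × ℝ ↦ (q.1, (B.chart z).2) :=
        contDiff_fst.prodMk contDiff_const
      exact ContMDiffAt.comp (g := B.chart.symm) x (B.contMDiffAt_symm h2)
        (h3.contMDiff.contMDiffAt.comp x ((B.contMDiffAt hy).comp x hψ))
    have h4 : B.chart.symm ((B.chart (ψ x)).1, (B.chart z).2) = z := by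
      rw [hu]; exact B.chart.left_inv hz
    refine ⟨_, h3, h4, ?_⟩
    have h5 := h3.continuousAt.eventually (h4.symm ▸ B.chart.open_source.mem_nhds hz)
    filter_upwards [hleaf, h5, hψ.continuousAt.eventually (B.chart.open_source.mem_nhds hy)]
      with w hw hw1 hw2
    refine hw.trans (plaque_iff.2 ⟨B, hB, hw2, hw1, ?_⟩).leaf
    rw [B.chart.right_inv]
    exact 𝒜.toNullAtlas.mk_mem_target (mem_image_of_mem _ hB) (B.chart.map_source hw2)
      (B.chart.map_source hz)

/-- `φ` is the chart of `𝒩_g` that is given by the first coordinate of the box `B`, whose plaques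
lie on distinct leaves. -/
structure IsLeafChart (𝒜 : OrientedAtlas T) (B : NullBox T)
    (φ : OpenPartialHomeomorph T.NullGeodesics ℝ) : Prop where
  mem : B ∈ 𝒜.boxes
  source_eq : φ.source = 𝒜.geodesic '' B.chart.source
  apply_geodesic : ∀ x ∈ B.chart.source, φ (𝒜.geodesic x) = (B.chart x).1

theorem exists_isLeafChart (hB : B ∈ 𝒜.boxes) (hx : x ∈ B.chart.source)
    (h : ∀ y ∈ B.chart.source, ∀ z ∈ B.chart.source, 𝒜.toNullAtlas.Leaf y z →
      (B.chart y).1 = (B.chart z).1) : ∃ φ, 𝒜.IsLeafChart B φ := by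
  let I : Set ℝ := {t | (t, (B.chart x).2) ∈ B.chart.target}
  have hI : IsOpen I := B.chart.open_target.preimage (by fun_prop)
  have hmk : ∀ y ∈ B.chart.source, (B.chart y).1 ∈ I := fun y hy ↦
    𝒜.toNullAtlas.mk_mem_target (mem_image_of_mem _ hB) (B.chart.map_source hy)
      (B.chart.map_source hx)
  let ψ (t : ℝ) : T.NullGeodesics := 𝒜.geodesic (B.chart.symm (t, (B.chart x).2))
  have hψ : ∀ y ∈ B.chart.source, ψ (B.chart y).1 = 𝒜.geodesic y := fun y hy ↦ by
    refine geodesic_eq_iff.2 (plaque_iff.2 ⟨B, hB, B.chart.map_target (hmk y hy), hy, ?_⟩).leaf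
    rw [B.chart.right_inv (hmk y hy)]
  have hψi : InjOn ψ I := fun t ht t' ht' h1 ↦ by
    have h2 := h _ (B.chart.map_target ht) _ (B.chart.map_target ht') (geodesic_eq_iff.1 h1)
    rwa [B.chart.right_inv ht, B.chart.right_inv ht'] at h2
  have hψc : ContinuousOn ψ I := 𝒜.continuous_geodesic.comp_continuousOn
    (B.chart.continuousOn_symm.comp (by fun_prop) fun _ ht ↦ ht)
  have himage : ∀ W ⊆ I, ψ '' W =
      𝒜.geodesic '' (B.chart.source ∩ B.chart ⁻¹' (Prod.fst ⁻¹' W)) := by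
    intro W hW
    ext κ
    constructor
    · rintro ⟨t, ht, rfl⟩
      refine ⟨_, ⟨B.chart.map_target (hW ht), ?_⟩, rfl⟩
      rw [mem_preimage, B.chart.right_inv (hW ht)]
      exact ht
    · rintro ⟨y, ⟨hy, hyW⟩, rfl⟩
      exact ⟨_, hyW, hψ y hy⟩
  have hψo : IsOpenMap (I.domRestrict ψ) := fun W hW ↦ by
    have h1 : I.domRestrict ψ '' W = ψ '' (Subtype.val '' W) := by
      rw [image_image]; rfl
    rw [h1, himage _ (Subtype.coe_image_subset _ _)]
    exact 𝒜.isOpenMap_geodesic _ (B.chart.isOpen_inter_preimage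
      ((hI.isOpenMap_subtype_val _ hW).preimage continuous_fst))
  refine ⟨(OpenPartialHomeomorph.ofContinuousOpenRestrict (hψi.bijOn_image.toPartialEquiv ψ I _)
    hψc hψo hI).symm, hB, ?_, fun y hy ↦ ?_⟩
  · refine (himage I subset_rfl).trans (congrArg _ (inter_eq_left.2 hmk))
  · have h1 := (OpenPartialHomeomorph.ofContinuousOpenRestrict
      (hψi.bijOn_image.toPartialEquiv ψ I _) hψc hψo hI).left_inv (hmk y hy)
    refine Eq.trans (congrArg _ ?_) h1
    exact (hψ y hy).symm

theorem exists_isLeafChart_of_locallySimple (h : 𝒜.toNullAtlas.LocallySimple) (x : M) :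
    ∃ B φ, 𝒜.IsLeafChart B φ ∧ x ∈ B.chart.source := by
  obtain ⟨_, ⟨⟨B, hB, rfl⟩, h1⟩, hx⟩ := h x
  obtain ⟨φ, hφ⟩ := exists_isLeafChart hB hx h1
  exact ⟨B, φ, hφ, hx⟩

namespace IsLeafChart

variable {φ φ' : OpenPartialHomeomorph T.NullGeodesics ℝ}

theorem geodesic_mem (hφ : 𝒜.IsLeafChart B φ) (hx : x ∈ B.chart.source) :
    𝒜.geodesic x ∈ φ.source :=
  hφ.source_eq ▸ mem_image_of_mem _ hx

theorem symm_apply (hφ : 𝒜.IsLeafChart B φ) (hx : x ∈ B.chart.source) :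
    φ.symm (B.chart x).1 = 𝒜.geodesic x := by
  rw [← hφ.apply_geodesic x hx]
  exact φ.left_inv (hφ.geodesic_mem hx)

theorem mk_mem_target (hφ : 𝒜.IsLeafChart B φ) {κ : T.NullGeodesics} (hκ : κ ∈ φ.source)
    (hx : x ∈ B.chart.source) : (φ κ, (B.chart x).2) ∈ B.chart.target := by
  rw [hφ.source_eq] at hκ
  obtain ⟨y, hy, rfl⟩ := hκ
  rw [hφ.apply_geodesic y hy]
  exact 𝒜.toNullAtlas.mk_mem_target (mem_image_of_mem _ hφ.mem) (B.chart.map_source hy)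
    (B.chart.map_source hx)

theorem geodesic_symm (hφ : 𝒜.IsLeafChart B φ) {κ : T.NullGeodesics} (hκ : κ ∈ φ.source)
    (hx : x ∈ B.chart.source) : 𝒜.geodesic (B.chart.symm (φ κ, (B.chart x).2)) = κ := by
  have h1 := hφ.mk_mem_target hκ hx
  rw [← hφ.symm_apply (B.chart.map_target h1), B.chart.right_inv h1]
  exact φ.left_inv hκ

/-- The transition functions are smooth, because holonomy is. -/
theorem contDiffOn_transition (hφ : 𝒜.IsLeafChart B φ) (hφ' : 𝒜.IsLeafChart B' φ') :
    ContDiffOn ℝ ∞ (φ' ∘ φ.symm) (φ.symm.trans φ').source := by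
  intro t ht
  rw [OpenPartialHomeomorph.trans_source, OpenPartialHomeomorph.symm_source] at ht
  have h1 := φ.map_target ht.1
  rw [hφ.source_eq] at h1
  obtain ⟨x, hx, hxt⟩ := h1
  have h2 : φ.symm t ∈ φ'.source := ht.2
  rw [hφ'.source_eq] at h2
  obtain ⟨y, hy, hyt⟩ := h2
  have h3 : (B.chart x).1 = t := by
    rw [← hφ.apply_geodesic x hx, hxt]
    exact φ.right_inv ht.1
  obtain ⟨ψ, hψ, rfl, hleaf⟩ := exists_holonomy (geodesic_eq_iff.1 (hxt.trans hyt.symm))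
  let c (s : ℝ) : M := B.chart.symm (s, (B.chart x).2)
  have h4 : (t, (B.chart x).2) ∈ B.chart.target := h3 ▸ B.chart.map_source hx
  have h5 : c t = x := by
    rw [← h3]
    exact B.chart.left_inv hx
  have hc : ContMDiffAt 𝓘(ℝ, ℝ) (𝓡 2) ∞ c t :=
    ContMDiffAt.comp (g := B.chart.symm) t (B.contMDiffAt_symm h4)
      (contDiff_id.prodMk contDiff_const).contMDiff.contMDiffAt
  have h6 : ContMDiffAt 𝓘(ℝ, ℝ) 𝓘(ℝ, ℝ × ℝ) ∞ (fun s ↦ B'.chart (ψ (c s))) t := by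
    refine ContMDiffAt.comp (g := B'.chart) (f := fun s ↦ ψ (c s)) t (B'.contMDiffAt ?_)
      (ContMDiffAt.comp (g := ψ) t ?_ hc)
    · rwa [h5]
    · rwa [h5]
  refine (h6.contDiffAt.fst.congr_of_eventuallyEq ?_).contDiffWithinAt
  have h7 : Tendsto c (𝓝 t) (𝓝 x) := by
    have := hc.continuousAt
    rwa [ContinuousAt, h5] at this
  have h8 : ∀ᶠ s in 𝓝 t, (s, (B.chart x).2) ∈ B.chart.target :=
    (B.chart.open_target.preimage (by fun_prop)).mem_nhds h4
  filter_upwards [h7.eventually hleaf, h8,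
    h7.eventually (hψ.continuousAt.eventually (B'.chart.open_source.mem_nhds hy))] with s hs hs' hs''
  have h9 : φ.symm s = 𝒜.geodesic (ψ (c s)) := by
    rw [← geodesic_eq_iff.2 hs, ← hφ.symm_apply (B.chart.map_target hs'), B.chart.right_inv hs']
  rw [Function.comp_apply, h9, hφ'.apply_geodesic _ hs'']

end IsLeafChart

/-- The atlas of `𝒩_g`, which consists of the charts given by the boxes of both orientations. -/
def leafCharts (𝒜 : OrientedAtlas T) :
    Set (OpenPartialHomeomorph T.NullGeodesics (EuclideanSpace ℝ (Fin (2 * 2 - 3)))) :=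
  {e | ∃ B φ, (𝒜.IsLeafChart B φ ∨ 𝒜.swap.IsLeafChart B φ) ∧
    e = φ.transHomeomorph lineEquiv.toHomeomorph}

theorem exists_mem_leafCharts (h : 𝒜.toNullAtlas.LocallySimple)
    (h' : 𝒜.swap.toNullAtlas.LocallySimple) (κ : T.NullGeodesics) :
    ∃ e ∈ 𝒜.leafCharts, κ ∈ e.source := by
  rcases 𝒜.exists_eq_geodesic κ with ⟨x, rfl⟩ | ⟨x, rfl⟩
  · obtain ⟨B, φ, hφ, hx⟩ := exists_isLeafChart_of_locallySimple h x
    exact ⟨_, ⟨B, φ, .inl hφ, rfl⟩, hφ.geodesic_mem hx⟩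
  · obtain ⟨B, φ, hφ, hx⟩ := exists_isLeafChart_of_locallySimple h' x
    exact ⟨_, ⟨B, φ, .inr hφ, rfl⟩, hφ.geodesic_mem hx⟩

/-- The charted space structure of `𝒩_g`. -/
@[reducible] def leafChartedSpace (h : 𝒜.toNullAtlas.LocallySimple)
    (h' : 𝒜.swap.toNullAtlas.LocallySimple) :
    ChartedSpace (EuclideanSpace ℝ (Fin (2 * 2 - 3))) T.NullGeodesics where
  atlas := 𝒜.leafCharts
  chartAt κ := (exists_mem_leafCharts h h' κ).choose
  mem_chart_source κ := (exists_mem_leafCharts h h' κ).choose_spec.2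
  chart_mem_atlas κ := (exists_mem_leafCharts h h' κ).choose_spec.1

theorem isManifold_leafChartedSpace (h : 𝒜.toNullAtlas.LocallySimple)
    (h' : 𝒜.swap.toNullAtlas.LocallySimple) :
    letI := leafChartedSpace h h'
    IsManifold (𝓡 (2 * 2 - 3)) ∞ T.NullGeodesics := by
  let _ := leafChartedSpace h h'
  refine isManifold_of_contDiffOn _ _ _ ?_
  rintro _ _ ⟨B, φ, hφ, rfl⟩ ⟨B', φ', hφ', rfl⟩
  have key : ContDiffOn ℝ ∞ (φ' ∘ φ.symm) (φ.symm.trans φ').source := by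
    rcases hφ, hφ' with ⟨h1 | h1, h2 | h2⟩
    · exact h1.contDiffOn_transition h2
    · intro t ht
      have h3 := φ.map_target ht.1
      have h4 : φ.symm t ∈ φ'.source := ht.2
      rw [h1.source_eq] at h3
      rw [h2.source_eq] at h4
      obtain ⟨x, -, hx⟩ := h3
      obtain ⟨y, -, hy⟩ := h4
      exact absurd (hy.trans hx.symm) geodesic_swap_ne
    · intro t ht
      have h3 := φ.map_target ht.1
      have h4 : φ.symm t ∈ φ'.source := ht.2
      rw [h1.source_eq] at h3
      rw [h2.source_eq] at h4
      obtain ⟨x, -, hx⟩ := h3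
      obtain ⟨y, -, hy⟩ := h4
      exact absurd (hx.trans hy.symm) geodesic_swap_ne
    · exact h1.contDiffOn_transition h2
  have h1 := lineEquiv.contDiff.comp_contDiffOn (key.comp (lineEquiv.symm.contDiff.contDiffOn
    (s := lineEquiv.symm ⁻¹' (φ.symm.trans φ').source)) fun _ h ↦ h)
  exact h1.mono fun p hp ↦ hp.1

section Submersion

variable [ChartedSpace (EuclideanSpace ℝ (Fin (2 * 2 - 3))) T.NullGeodesics]
  [IsManifold (𝓡 (2 * 2 - 3)) ∞ T.NullGeodesics]

theorem contMDiffOn_geodesic {φ : OpenPartialHomeomorph T.NullGeodesics ℝ}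
    (hφ : 𝒜.IsLeafChart B φ)
    (h : φ.transHomeomorph lineEquiv.toHomeomorph ∈
      atlas (EuclideanSpace ℝ (Fin (2 * 2 - 3))) T.NullGeodesics) :
    ContMDiffOn (𝓡 2) (𝓡 (2 * 2 - 3)) ∞ 𝒜.geodesic B.chart.source := by
  have h1 := contMDiffOn_symm_of_mem_maximalAtlas (I := 𝓡 (2 * 2 - 3)) (n := ∞)
    (IsManifold.subset_maximalAtlas h)
  have h2 : ContMDiffOn (𝓡 2) 𝓘(ℝ, EuclideanSpace ℝ (Fin (2 * 2 - 3))) ∞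
      (fun x ↦ lineEquiv (B.chart x).1) B.chart.source :=
    (lineEquiv.contDiff.comp contDiff_fst).contMDiff.comp_contMDiffOn B.contMDiffOn
  refine (h1.comp h2 fun x hx ↦ ?_).congr fun x hx ↦ ?_
  · change lineEquiv.symm (lineEquiv _) ∈ φ.target
    rw [lineEquiv.symm_apply_apply, ← hφ.apply_geodesic x hx]
    exact φ.map_source (hφ.geodesic_mem hx)
  · change _ = φ.symm (lineEquiv.symm (lineEquiv _))
    rw [lineEquiv.symm_apply_apply, hφ.symm_apply hx]

theorem submersion_at {φ : OpenPartialHomeomorph T.NullGeodesics ℝ}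
    (hφ : 𝒜.IsLeafChart B φ)
    (h : φ.transHomeomorph lineEquiv.toHomeomorph ∈
      atlas (EuclideanSpace ℝ (Fin (2 * 2 - 3))) T.NullGeodesics)
    {α : T.nullCone} (hα : 𝒜.Along α.1) (hx : α.1.proj ∈ B.chart.source) :
    (∃ (U : Set (Cotangent 2 M)) (F : Cotangent 2 M → T.NullGeodesics),
      IsOpen U ∧ α.1 ∈ U ∧ ContMDiffOn (cotangentModel 2) (𝓡 (2 * 2 - 3)) ∞ F U ∧
        ∀ β : T.nullCone, β.1 ∈ U → F β = T.toLeaf β) ∧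
    (∃ (U : Set T.NullGeodesics) (σ : T.NullGeodesics → T.nullCone),
      IsOpen U ∧ T.toLeaf α ∈ U ∧
        ContMDiffOn (𝓡 (2 * 2 - 3)) (cotangentModel 2) ∞ (fun κ ↦ (σ κ : Cotangent 2 M)) U ∧
        (∀ κ ∈ U, T.toLeaf (σ κ) = κ) ∧ σ (T.toLeaf α) = α) := by
  have hc := (along_iff_compU_neg α.2 hφ.mem hx).1 hα
  constructor
  · have h1 : ContinuousOn B.compU (TotalSpace.proj ⁻¹' B.chart.source) := fun β hβ ↦
      (B.contMDiffAt_comp hβ (1, 0)).continuousAt.continuousWithinAt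
    refine ⟨TotalSpace.proj ⁻¹' B.chart.source ∩ B.compU ⁻¹' Iio 0,
      fun β ↦ 𝒜.geodesic β.proj, h1.isOpen_inter_preimage
        (B.chart.open_source.preimage (FiberBundle.continuous_proj _ _)) isOpen_Iio, ⟨hx, hc⟩,
      (contMDiffOn_geodesic hφ h).comp (contMDiff_proj _).contMDiffOn fun β hβ ↦ hβ.1,
      fun β hβ ↦ (toLeaf_eq_geodesic ((along_iff_compU_neg β.2 hφ.mem hβ.1).2 hβ.2)).symm⟩
  · -- the section `-c du` over the transversal `v = const` through the base point of `α`
    let p (κ : T.NullGeodesics) : M := B.chart.symm (φ κ, (B.chart α.1.proj).2)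
    have hp : ∀ κ ∈ φ.source, p κ ∈ B.chart.source := fun κ hκ ↦
      B.chart.map_target (hφ.mk_mem_target hκ hx)
    have hφs : ContMDiffOn (𝓡 (2 * 2 - 3)) 𝓘(ℝ, ℝ) ∞ φ φ.source := by
      have h1 := contMDiffOn_of_mem_maximalAtlas (I := 𝓡 (2 * 2 - 3)) (n := ∞)
        (IsManifold.subset_maximalAtlas h)
      refine ((lineEquiv.symm.contDiff.contMDiff (n := ∞)).comp_contMDiffOn h1).congr
        fun κ hκ ↦ (lineEquiv.symm_apply_apply (φ κ)).symm
    have hps : ContMDiffOn (𝓡 (2 * 2 - 3)) (𝓡 2) ∞ p φ.source :=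
      B.contMDiffOn_symm.comp ((contDiff_id.prodMk contDiff_const).contMDiff.comp_contMDiffOn hφs)
        fun κ hκ ↦ hφ.mk_mem_target hκ hx
    have hmem : T.toLeaf α ∈ φ.source := by
      rw [toLeaf_eq_geodesic hα]
      exact hφ.geodesic_mem hx
    classical
    let σ (κ : T.NullGeodesics) : T.nullCone :=
      if hκ : κ ∈ φ.source then ⟨_, B.covector_mem (neg_pos.2 hc) (hp κ hκ)⟩ else α
    have hσ : ∀ κ (hκ : κ ∈ φ.source), σ κ = ⟨_, B.covector_mem (neg_pos.2 hc) (hp κ hκ)⟩ :=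
      fun κ hκ ↦ dif_pos hκ
    refine ⟨φ.source, σ, φ.open_source, hmem, fun κ hκ ↦ ?_, fun κ hκ ↦ ?_, ?_⟩
    · refine ContMDiffWithinAt.congr (f := fun κ ↦ B.covector (-B.compU α.1) (p κ)) ?_
        (fun κ hκ ↦ by rw [hσ κ hκ]) (by rw [hσ κ hκ])
      exact (B.contMDiffAt_covector _ (hp κ hκ)).comp_contMDiffWithinAt κ (hps κ hκ)
    · rw [hσ κ hκ]
      exact (toLeaf_eq_geodesic (along_covector hφ.mem _ (hp κ hκ))).trans
        (hφ.geodesic_symm hκ hx)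
    · rw [hσ _ hmem]
      refine Subtype.ext ?_
      have h1 : p (T.toLeaf α) = α.1.proj := by
        simp only [p, toLeaf_eq_geodesic hα, hφ.apply_geodesic _ hx]
        exact B.chart.left_inv hx
      change B.covector _ (p (T.toLeaf α)) = _
      rw [h1]
      exact (B.eq_covector hx ((along_iff hφ.mem hx).1 hα)).symm

end Submersion

/-! ### Causal simplicity makes the space of null geodesics smooth -/

theorem secondCountableTopology_nullGeodesics [SecondCountableTopology M] (𝒜 : OrientedAtlas T) :
    SecondCountableTopology T.NullGeodesics := by
  let q : M ⊕ M → T.NullGeodesics := Sum.elim 𝒜.geodesic 𝒜.swap.geodesic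
  have hq : IsOpenMap q := 𝒜.isOpenMap_geodesic.sumElim 𝒜.swap.isOpenMap_geodesic
  have hqc : Continuous q := 𝒜.continuous_geodesic.sumElim 𝒜.swap.continuous_geodesic
  refine (hq.isQuotientMap hqc fun κ ↦ ?_).secondCountableTopology hq
  rcases 𝒜.exists_eq_geodesic κ with ⟨x, rfl⟩ | ⟨x, rfl⟩
  exacts [⟨.inl x, rfl⟩, ⟨.inr x, rfl⟩]

theorem t2Space_nullGeodesics [T2Space M] (hT : T.IsCausallySimple) {f f' : M → ℝ}
    (hf : 𝒜.toNullAtlas.IsHeight f) (hf' : 𝒜.swap.toNullAtlas.IsHeight f') :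
    T2Space T.NullGeodesics := by
  have hsep (𝒜 : OrientedAtlas T) {f : M → ℝ} (hf : 𝒜.toNullAtlas.IsHeight f) {x y : M}
      (h : 𝒜.geodesic x ≠ 𝒜.geodesic y) : ∃ U V : Set T.NullGeodesics, IsOpen U ∧ IsOpen V ∧
        𝒜.geodesic x ∈ U ∧ 𝒜.geodesic y ∈ V ∧ Disjoint U V := by
    obtain ⟨U, V, hU, hV, hx, hy, h1⟩ := hf.exists_separation 𝒜.isCausalRel hT.2
      fun h1 ↦ h (geodesic_eq_iff.2 h1)
    refine ⟨_, _, 𝒜.isOpenMap_geodesic U hU, 𝒜.isOpenMap_geodesic V hV, mem_image_of_mem _ hx,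
      mem_image_of_mem _ hy, disjoint_left.2 ?_⟩
    rintro _ ⟨u, hu, rfl⟩ ⟨v, hv, h2⟩
    exact h1 u hu v hv (geodesic_eq_iff.1 h2.symm)
  have hdisj : Disjoint (range 𝒜.geodesic) (range 𝒜.swap.geodesic) := by
    refine disjoint_left.2 ?_
    rintro _ ⟨x, rfl⟩ ⟨y, h⟩
    exact geodesic_swap_ne h
  refine ⟨fun κ κ' h ↦ ?_⟩
  rcases 𝒜.exists_eq_geodesic κ, 𝒜.exists_eq_geodesic κ' with
    ⟨⟨x, rfl⟩ | ⟨x, rfl⟩, ⟨y, rfl⟩ | ⟨y, rfl⟩⟩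
  · exact hsep 𝒜 hf h
  · exact ⟨_, _, 𝒜.isOpenMap_geodesic.isOpen_range, 𝒜.swap.isOpenMap_geodesic.isOpen_range,
      mem_range_self _, mem_range_self _, hdisj⟩
  · exact ⟨_, _, 𝒜.swap.isOpenMap_geodesic.isOpen_range, 𝒜.isOpenMap_geodesic.isOpen_range,
      mem_range_self _, mem_range_self _, hdisj.symm⟩
  · exact hsep 𝒜.swap hf' h

end OrientedAtlas

theorem isSmoothManifold_of_isCausallySimple [T2Space M] [SecondCountableTopology M]
    [SimplyConnectedSpace M] (hT : T.IsCausallySimple) : T.NullGeodesicsIsSmoothManifold := by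
  obtain ⟨𝒜⟩ := exists_orientedAtlas T
  have : LocallyPathConnectedSpace M :=
    ChartedSpace.locallyPathConnectedSpace (EuclideanSpace ℝ (Fin 2)) M
  have h := 𝒜.isCausalRel.locallySimple hT.1 hT.2
  have h' := 𝒜.swap.isCausalRel.locallySimple hT.1 hT.2
  obtain ⟨f, hf⟩ := h.exists_isHeight
  obtain ⟨f', hf'⟩ := h'.exists_isHeight
  let _ := OrientedAtlas.leafChartedSpace h h'
  have hm := OrientedAtlas.isManifold_leafChartedSpace h h'
  refine ⟨OrientedAtlas.t2Space_nullGeodesics hT hf hf',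
    𝒜.secondCountableTopology_nullGeodesics, _, hm, fun α ↦ ?_⟩
  by_cases hα : 𝒜.Along α.1
  · obtain ⟨B, φ, hφ, hx⟩ := OrientedAtlas.exists_isLeafChart_of_locallySimple h α.1.proj
    exact OrientedAtlas.submersion_at hφ (show _ ∈ 𝒜.leafCharts from ⟨B, φ, .inl hφ, rfl⟩) hα hx
  · obtain ⟨B, φ, hφ, hx⟩ := OrientedAtlas.exists_isLeafChart_of_locallySimple h' α.1.proj
    exact OrientedAtlas.submersion_at hφ (show _ ∈ 𝒜.leafCharts from ⟨B, φ, .inr hφ, rfl⟩)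
      ((OrientedAtlas.along_swap_iff_not α.2).2 hα) hx

end SmoothStructure

end Spacetime

end

theorem proposition2p4 {M : Type*} [TopologicalSpace M] [T2Space M] [SecondCountableTopology M]
    [ChartedSpace (EuclideanSpace ℝ (Fin 2)) M] [IsManifold (𝓡 2) ∞ M]
    [SimplyConnectedSpace M]
    (g : Spacetime.LorentzianMetric 2 M) (T : Spacetime.TimeOrientation g) :
    T.NullGeodesicsIsSmoothManifold ↔ T.IsCausallySimple :=
  ⟨Spacetime.isCausallySimple_of_isSmoothManifold,
    Spacetime.isSmoothManifold_of_isCausallySimple⟩
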